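/- Let $V$ be a real finite-dimensional Euclidean space and $R_0\subset V$ an irreducible reduced crystallographic root system spanning $V$, with simple roots $\alpha_1,\dots,\alpha_n$, highest root $\varphi$, highest short root $\vartheta$, and Weyl group $W_0$. (If $R_0$ is simply laced, all roots are called both long and short.) Fix $c>0$ and put $\alpha_0=-\vartheta$ (twisted case) or $\alpha_0=-\varphi$ (untwisted case). Let $m_\alpha=1$ for short $\alpha\in R_0$ and $m_\alpha=\langle\varphi,\varphi\rangle/\langle\alpha_0,\alpha_0\rangle$ for long $\alpha\in R_0$, and let $R=\{\alpha+m_\alpha rc \mid \alpha\in R_0,\ r\in\mathbb Z\}$ be the corresponding affine root system, an affine root $v+r$ being the function $x\mapsto\langle v,x\rangle+r$ on $V$. Its simple affine roots are $a_0=\alpha_0+c$ and $a_j=\alpha_j$ ($1\le j\le n$), with affine reflections $s_j(x)=x-a_j(x)\alpha_j^\vee$ ($0\le j\le n$), where $\alpha^\vee=2\alpha/\langle\alpha,\alpha\rangle$. Let $P$ be the weight lattice of $R_0$, and $\hat P$ the weight lattice of $\hat R_0=\{m_\alpha\alpha^\vee\mid\alpha\in R_0\}$. Let $t_y$ denote the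 translation $x\mapsto x+y$ of $V$. Let $W=W_0\ltimes t(c\hat P)$ be the extended affine Weyl group, consisting of the maps $vt_{c\lambda}$ ($v\in W_0$, $\lambda\in\hat P$), write $(vt_{c\lambda})'=v$, and write $s_j'\in W_0$ for the orthogonal reflection in $\alpha_j$ ($0\le j\le n$). Let $W$ act on functions on $V$ by $(wf)(x)=f(w^{-1}x)$, and let $\Omega\subset W$ be the subgroup of elements that permute $a_0,\dots,a_n$; for $u\in\Omega$ write $ua_j=a_{u_j}$. Let $m_{jk}\in\{1,2,3,\dots\}\cup\{\infty\}$ be the order of $s_js_k$. Let $\mathbb L$ be the ring of complex Laurent polynomials in indeterminates $\tau_\alpha$ ($\alpha\in R_0$) with $\tau_{w\alpha}=\tau_\alpha$ for $w\in W_0$ (one independent indeterminate for each $W_0$-orbit), and put $\tau_j=\tau_{\alpha_j}$ ($0\le j\le n$). The double affine Hecke algebra at critical level $\mathcal H$ is the unital associative $\mathbb L$-algebra with invertible generators $T_u$ ($u\in\Omega$), $T_j$ ($0\le j\le n$) and commuting generators $X^\lambda$ ($\lambda\in P$), subject to the relations $$T_uT_{\tilde u}=T_{u\tilde u},\qquad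 T_uT_j=T_{u_j}T_u,\qquad (T_j-\tau_j)(T_j+\tau_j^{-1})=0,$$ $$T_jT_kT_j\cdots=T_kT_jT_k\cdots\quad(m_{jk}\text{ factors on each side},\ j\ne k,\ m_{jk}<\infty),$$ $$T_uX^\lambda=X^{u'\lambda}T_u,\qquad T_jX^\lambda=X^{s_j'\lambda}T_j+(\tau_j-\tau_j^{-1})\frac{X^\lambda-X^{s_j'\lambda}}{1-X^{-\alpha_j}},$$ $$X^\lambda X^{\tilde\lambda}=X^{\lambda+\tilde\lambda},\qquad X^0=1,$$ where the quotient is the one in the group algebra $\mathbb L[P]$. Then every $w\in W$ has a reduced decomposition $w=us_{j_1}\cdots s_{j_\ell}$ with $u\in\Omega$ (that is, one with the least possible number $\ell$ of factors $s_j$); the element $T_w:=T_uT_{j_1}\cdots T_{j_\ell}\in\mathcal H$ does not depend on the choice of the reduced decomposition; the elements $X^\lambda T_w$ ($\lambda\in P$, $w\in W$) form an $\mathbb L$-basis of $\mathcal H$; and the elements $T_wX^\lambda$ ($\lambda\in P$, $w\in W$) also form an $\mathbb L$-basis of $\mathcal H$. -/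

import Mathlib

open scoped RealInnerProductSpace

noncomputable section

/-- For a family `β` of non-zero vectors (the roots of a root system) in a Euclidean space, the
lattice of all `x` with `⟪x, (β i)^∨⟫ ∈ ℤ` for every `i`, where `y^∨ = 2 y / ⟪y, y⟫`.
This is the weight lattice of the root system `{β i}`. -/
def weightLattice {ι V : Type*} [NormedAddCommGroup V] [InnerProductSpace ℝ V] (β : ι → V) :
    AddSubgroup V where
  carrier := {x | ∀ i, ∃ k : ℤ, ⟪x, (2 / ⟪β i, β i⟫) • β i⟫ = k}
  zero_mem' := fun i => ⟨0, by simp⟩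
  add_mem' := by
    intro x y hx hy i
    obtain ⟨k, hk⟩ := hx i
    obtain ⟨l, hl⟩ := hy i
    exact ⟨k + l, by rw [inner_add_left, hk, hl]; push_cast; rfl⟩
  neg_mem' := by
    intro x hx i
    obtain ⟨k, hk⟩ := hx i
    exact ⟨-k, by rw [inner_neg_left, hk]; push_cast; rfl⟩

/-- An orthogonal map that permutes the family `β` preserves its weight lattice. -/
theorem weightLattice_stable {ι V : Type*} [NormedAddCommGroup V] [InnerProductSpace ℝ V]
    (β : ι → V) (v : V ≃ₗ[ℝ] V) (hv : ∀ x y, ⟪v x, v y⟫ = ⟪x, y⟫)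
    (hβ : ∀ i, ∃ j, v.symm (β i) = β j) {x : V} (hx : x ∈ weightLattice β) :
    v x ∈ weightLattice β := by
  intro i
  obtain ⟨j, hj⟩ := hβ i
  obtain ⟨k, hk⟩ := hx j
  have e : β i = v (β j) := by rw [← hj]; simp
  refine ⟨k, ?_⟩
  rw [e, hv, ← map_smul, hv]
  exact hk

/-- The data that fix an irreducible reduced affine root system with reduced gradient root system,
together with its basis: a finite irreducible reduced crystallographic root system `Φ = R₀` (roots
indexed by `ι`) of full rank in the Euclidean space `V`, a basis of simple roots of it, its highest
root `φ` and highest short root `θ`, the choice between the twisted and the untwisted type, and the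
scale `c > 0`. -/
structure AffineRootDatum (ι V : Type*) [NormedAddCommGroup V] [InnerProductSpace ℝ V] where
  finite : Finite ι
  /-- The gradient root system `R₀`; roots and coroots both live in `V`. -/
  Φ : RootPairing ι ℝ V V
  pairing_eq_inner : ∀ x y, Φ.toLinearMap x y = ⟪x, y⟫
  coroot_eq : ∀ i, Φ.coroot i = (2 / ⟪Φ.root i, Φ.root i⟫) • Φ.root i
  isRootSystem : Φ.IsRootSystem
  isCrystallographic : Φ.IsCrystallographic
  isReduced : Φ.IsReduced
  isIrreducible : Φ.IsIrreducible
  /-- The simple roots `α₁, …, αₙ`. -/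
  base : Φ.Base
  /-- The highest root: `φ - α` is in the positive cone `Q⁺` for every root `α`. -/
  φ : ι
  highest : ∀ i, Φ.root φ - Φ.root i ∈ AddSubmonoid.closure (Φ.root '' base.support)
  /-- The highest short root: a root of minimal length such that `θ - α` is in the positive
  cone `Q⁺` for every root `α` of minimal length. -/
  θ : ι
  short_θ : ∀ j, ‖Φ.root θ‖ ≤ ‖Φ.root j‖
  highest_short : ∀ i, (∀ j, ‖Φ.root i‖ ≤ ‖Φ.root j‖) →
    Φ.root θ - Φ.root i ∈ AddSubmonoid.closure (Φ.root '' base.support)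
  /-- `true` if the affine root system is twisted, `false` if it is untwisted. -/
  twisted : Bool
  c : ℝ
  c_pos : 0 < c

namespace AffineRootDatum

variable {ι V : Type*} [NormedAddCommGroup V] [InnerProductSpace ℝ V] (D : AffineRootDatum ι V)

/-! ### The affine root system -/

/-- The index set `{0, 1, …, n}`: `none` stands for `0`, and `some i` for the simple roots. -/
abbrev Node : Type _ := Option D.base.support

/-- The gradient `α₀` of `a₀` (its index): `-θ` in the twisted and `-φ` in the untwisted case.
(`Φ.reflectionPerm i i` is the index of `-Φ.root i`.) -/
def zeroIdx : ι :=
  if D.twisted then D.Φ.reflectionPerm D.θ D.θ else D.Φ.reflectionPerm D.φ D.φ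

/-- The index of the gradient `α_j` of the simple affine root `a_j`, `j = 0, …, n`. -/
def nodeIdx : D.Node → ι
  | none => D.zeroIdx
  | some i => i

theorem root_neg (i : ι) : D.Φ.root (D.Φ.reflectionPerm i i) = -D.Φ.root i := by
  simp

/-- Short roots: the roots of minimal length. -/
def IsShort (i : ι) : Prop := ∀ j, ‖D.Φ.root i‖ ≤ ‖D.Φ.root j‖

open scoped Classical in
/-- The integer `m_α`: `1` for short `α` and `⟪φ, φ⟫ / ⟪α₀, α₀⟫` for long `α`. -/
def m (i : ι) : ℝ :=
  if D.IsShort i then 1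
  else ⟪D.Φ.root D.φ, D.Φ.root D.φ⟫ / ⟪D.Φ.root D.zeroIdx, D.Φ.root D.zeroIdx⟫

/-- The affine-linear function `x ↦ ⟪v, x⟫ + r`. -/
def affineFn (v : V) (r : ℝ) : V → ℝ := fun x => ⟪v, x⟫ + r

/-- The affine root system `R`: all `α + m_α r c` with `α ∈ R₀` and `r ∈ ℤ`. -/
def affineRoots : Set (V → ℝ) :=
  {a | ∃ (i : ι) (r : ℤ), a = affineFn (D.Φ.root i) (D.m i * r * D.c)}

/-- The constant term of the simple affine root `a_j`: `c` for `j = 0` and `0` for `j ≥ 1`. -/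
def nodeConst : D.Node → ℝ
  | none => D.c
  | some _ => 0

/-- The simple affine roots `a₀ = α₀ + c` and `a_j = α_j`, `j = 1, …, n`. -/
def simpleAffineRoot (j : D.Node) : V → ℝ :=
  affineFn (D.Φ.root (D.nodeIdx j)) (D.nodeConst j)

theorem simpleAffineRoot_mem (j : D.Node) : D.simpleAffineRoot j ∈ D.affineRoots := by
  rcases j with _ | i
  · refine ⟨D.zeroIdx, 1, ?_⟩
    have hm : D.m D.zeroIdx = 1 := by
      unfold m
      split_ifs with hs
      · rfl
      · unfold zeroIdx at hs ⊢
        split_ifs at hs ⊢ with ht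
        · exact absurd (fun j => by rw [D.root_neg, norm_neg]; exact D.short_θ j) hs
        · rw [D.root_neg, inner_neg_neg]
          exact div_self (inner_self_ne_zero.mpr (D.Φ.ne_zero _))
    simp [simpleAffineRoot, nodeIdx, nodeConst, hm]
  · exact ⟨i, 0, by simp [simpleAffineRoot, nodeIdx, nodeConst]⟩

/-! ### Weyl groups -/

/-- The orthogonal reflection in the root with index `i`: `x ↦ x - ⟪α, x⟫ α^∨`. -/
def refl (i : ι) : V ≃ₗ[ℝ] V := D.Φ.coreflection i

theorem refl_apply (i : ι) (x : V) :
    D.refl i x = x - ⟪D.Φ.root i, x⟫ • D.Φ.coroot i := by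
  rw [refl, D.Φ.coreflection_apply, ← D.pairing_eq_inner]

theorem refl_apply' (i : ι) (x : V) :
    D.refl i x = x - ⟪x, D.Φ.coroot i⟫ • D.Φ.root i := by
  rw [refl_apply, D.coroot_eq, inner_smul_right, smul_smul, real_inner_comm x]
  congr 2
  ring

theorem refl_root (i j : ι) : D.refl i (D.Φ.root j) = D.Φ.root (D.Φ.reflectionPerm i j) := by
  rw [refl_apply', ← D.pairing_eq_inner, D.Φ.reflectionPerm_root]

theorem refl_inner (i : ι) (x y : V) : ⟪D.refl i x, D.refl i y⟫ = ⟪x, y⟫ := by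
  have h : ⟪D.Φ.root i, D.Φ.root i⟫ ≠ 0 := inner_self_ne_zero.mpr (D.Φ.ne_zero i)
  simp only [refl_apply, D.coroot_eq, inner_sub_left, inner_sub_right, inner_smul_left,
    inner_smul_right, smul_smul, real_inner_comm x (D.Φ.root i), conj_trivial]
  field_simp
  ring

/-- The finite Weyl group `W₀`. -/
def W₀ : Subgroup (V ≃ₗ[ℝ] V) := Subgroup.closure (Set.range D.refl)

theorem W₀_spec {v : V ≃ₗ[ℝ] V} (hv : v ∈ D.W₀) :
    (∀ x y, ⟪v x, v y⟫ = ⟪x, y⟫) ∧ ∀ i, ∃ j, v (D.Φ.root i) = D.Φ.root j := by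
  induction hv using Subgroup.closure_induction_left with
  | one => exact ⟨fun _ _ => rfl, fun i => ⟨i, rfl⟩⟩
  | mul_left s hs v _ ih =>
    obtain ⟨i, rfl⟩ := hs
    refine ⟨fun x y => ?_, fun k => ?_⟩
    · exact (D.refl_inner i _ _).trans (ih.1 x y)
    · obtain ⟨j, hj⟩ := ih.2 k
      exact ⟨_, by rw [LinearEquiv.mul_apply, hj, D.refl_root]⟩
  | inv_mul_cancel s hs v _ ih =>
    obtain ⟨i, rfl⟩ := hs
    have e : (D.refl i)⁻¹ = D.refl i := D.Φ.flip.reflection_inv i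
    rw [e]
    refine ⟨fun x y => ?_, fun k => ?_⟩
    · exact (D.refl_inner i _ _).trans (ih.1 x y)
    · obtain ⟨j, hj⟩ := ih.2 k
      exact ⟨_, by rw [LinearEquiv.mul_apply, hj, D.refl_root]⟩

/-- The vectors `α̂ = m_α α^∨`, the roots of the root system `R̂₀`. -/
def hatRoot (i : ι) : V := D.m i • D.Φ.coroot i

/-- The weight lattice `P` of `R₀`. -/
def P : AddSubgroup V := weightLattice D.Φ.root

/-- The weight lattice `P̂` of `R̂₀`. -/
def hatP : AddSubgroup V := weightLattice D.hatRoot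

theorem W₀_P {v : V ≃ₗ[ℝ] V} (hv : v ∈ D.W₀) {x : V} (hx : x ∈ D.P) : v x ∈ D.P :=
  weightLattice_stable _ v (D.W₀_spec hv).1 (D.W₀_spec (inv_mem hv)).2 hx

theorem W₀_hatP {v : V ≃ₗ[ℝ] V} (hv : v ∈ D.W₀) {x : V} (hx : x ∈ D.hatP) :
    v x ∈ D.hatP := by
  refine weightLattice_stable _ v (D.W₀_spec hv).1 (fun i => ?_) hx
  obtain ⟨hin, hrt⟩ := D.W₀_spec (inv_mem hv)
  obtain ⟨j, hj⟩ := hrt i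
  change v.symm _ = _ at hj
  have hn : ⟪D.Φ.root j, D.Φ.root j⟫ = ⟪D.Φ.root i, D.Φ.root i⟫ := by
    rw [← hj]; exact hin _ _
  have hs : D.IsShort j ↔ D.IsShort i := by
    have : ‖D.Φ.root j‖ = ‖D.Φ.root i‖ := by
      rw [norm_eq_sqrt_real_inner, hn, ← norm_eq_sqrt_real_inner]
    simp only [IsShort, this]
  have hm : D.m j = D.m i := by
    unfold m
    by_cases h : D.IsShort i <;> simp [h, hs]
  refine ⟨j, ?_⟩
  rw [hatRoot, hatRoot, hm, D.coroot_eq, D.coroot_eq, hn, map_smul, map_smul, hj]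

/-- The translation `t_y : x ↦ x + y`. -/
def transl (y : V) : V ≃ᵃ[ℝ] V := AffineEquiv.constVAdd ℝ V y

theorem transl_apply (y x : V) : transl y x = x + y := add_comm y x

theorem linear_mul_transl (v : V ≃ₗ[ℝ] V) (y x : V) :
    (v.toAffineEquiv * transl y) x = v (x + y) := by
  rw [← transl_apply]; rfl

/-- The extended affine Weyl group `W`: all affine transformations `v t_{cλ}` of `V` with
`v ∈ W₀` and `λ ∈ P̂`. -/
def W : Subgroup (V ≃ᵃ[ℝ] V) where
  carrier := {w | ∃ v ∈ D.W₀, ∃ y ∈ D.hatP, w = v.toAffineEquiv * transl (D.c • y)}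
  one_mem' := ⟨1, one_mem _, 0, zero_mem _, by
    ext x; rw [linear_mul_transl]; simp⟩
  mul_mem' := by
    rintro _ _ ⟨v, hv, y, hy, rfl⟩ ⟨v', hv', y', hy', rfl⟩
    refine ⟨v * v', mul_mem hv hv', v'⁻¹ y + y',
      add_mem (D.W₀_hatP (inv_mem hv') hy) hy', ?_⟩
    ext x
    rw [linear_mul_transl]
    change (v.toAffineEquiv * transl (D.c • y)) ((v'.toAffineEquiv * transl (D.c • y')) x) = _
    rw [linear_mul_transl, linear_mul_transl, LinearEquiv.mul_apply]
    congr 1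
    have : v' (v'⁻¹ y) = y := v'.apply_symm_apply y
    simp only [smul_add, map_add, map_smul, this]
    abel
  inv_mem' := by
    rintro _ ⟨v, hv, y, hy, rfl⟩
    refine ⟨v⁻¹, inv_mem hv, -(v y), neg_mem (D.W₀_hatP hv hy), ?_⟩
    rw [inv_eq_iff_mul_eq_one]
    ext x
    change (v.toAffineEquiv * transl (D.c • y)) (((v⁻¹ : V ≃ₗ[ℝ] V).toAffineEquiv *
      transl (D.c • -(v y))) x) = x
    rw [linear_mul_transl, linear_mul_transl]
    simp

/-- The gradient `w' = v` of `w = v t_{cλ} ∈ W` lies in `W₀`. -/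
theorem linear_mem_W₀ {w : V ≃ᵃ[ℝ] V} (hw : w ∈ D.W) : w.linear ∈ D.W₀ := by
  obtain ⟨v, hv, y, -, rfl⟩ := hw
  exact hv

/-- The action `(w f)(x) = f (w⁻¹ x)` on functions. -/
def actFn (w : V ≃ᵃ[ℝ] V) (f : V → ℝ) : V → ℝ := fun x => f (w⁻¹ x)

/-- The subgroup `Ω` of those `u ∈ W` that permute the simple affine roots `a₀, …, aₙ`. -/
def Ω : Subgroup (V ≃ᵃ[ℝ] V) where
  carrier := {u | u ∈ D.W ∧
    actFn u '' Set.range D.simpleAffineRoot = Set.range D.simpleAffineRoot}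
  one_mem' := ⟨one_mem _, Set.image_id _⟩
  mul_mem' := by
    rintro u u' ⟨hu, h⟩ ⟨hu', h'⟩
    refine ⟨mul_mem hu hu', ?_⟩
    have e : actFn (u * u') = actFn u ∘ actFn u' := by
      funext f x; simp only [actFn, mul_inv_rev]; rfl
    rw [e, Set.image_comp, h', h]
  inv_mem' := by
    rintro u ⟨hu, h⟩
    refine ⟨inv_mem hu, ?_⟩
    have e : actFn u⁻¹ ∘ actFn u = id := by
      funext f x
      exact congrArg f (u.symm_apply_apply x)
    conv_lhs => rw [← h]
    rw [← Set.image_comp, e, Set.image_id]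

/-- The affine reflection `s_j = s_{a_j}`, i.e. `x ↦ x - a_j(x) α_j^∨`. -/
def s (j : D.Node) : V ≃ᵃ[ℝ] V :=
  transl (-(D.nodeConst j • D.Φ.coroot (D.nodeIdx j))) * (D.refl (D.nodeIdx j)).toAffineEquiv

theorem s_apply (j : D.Node) (x : V) :
    D.s j x = x - D.simpleAffineRoot j x • D.Φ.coroot (D.nodeIdx j) := by
  change transl _ (D.refl _ x) = _
  rw [transl_apply, refl_apply, simpleAffineRoot, affineFn, add_smul]
  abel

/-- `w = u s_{j₁} ⋯ s_{j_ℓ}`. -/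
def IsDecomposition (w : D.W) (u : D.Ω) (l : List D.Node) : Prop :=
  (w : V ≃ᵃ[ℝ] V) = u * (l.map D.s).prod

/-- `w = u s_{j₁} ⋯ s_{j_ℓ}` with the least possible number `ℓ = ℓ(w)` of factors `s_j`. -/
def IsReducedDecomposition (w : D.W) (u : D.Ω) (l : List D.Node) : Prop :=
  D.IsDecomposition w u l ∧ ∀ u' l', D.IsDecomposition w u' l' → l.length ≤ l'.length

/-! ### The coefficient ring -/

/-- Two roots are equivalent if they are in the same `W₀`-orbit. -/
def rootSetoid : Setoid ι where
  r i j := ∃ v ∈ D.W₀, v (D.Φ.root i) = D.Φ.root j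
  iseqv :=
    { refl := fun i => ⟨1, one_mem _, rfl⟩
      symm := by
        rintro i j ⟨v, hv, h⟩
        exact ⟨v⁻¹, inv_mem hv, by rw [← h]; exact v.symm_apply_apply _⟩
      trans := by
        rintro i j k ⟨v, hv, h⟩ ⟨v', hv', h'⟩
        exact ⟨v' * v, mul_mem hv' hv, by rw [LinearEquiv.mul_apply, h, h']⟩ }

/-- The ring `𝕃` of complex Laurent polynomials in indeterminates `τ_α`, one for each `W₀`-orbit
of roots, as the group algebra of the free abelian group of exponents. -/
abbrev 𝕃 : Type _ := AddMonoidAlgebra ℂ (Quotient D.rootSetoid →₀ ℤ)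

/-- The indeterminate `τ_j = τ_{α_j}`. -/
def τ (j : D.Node) : D.𝕃 :=
  AddMonoidAlgebra.single (Finsupp.single (Quotient.mk D.rootSetoid (D.nodeIdx j)) 1) 1

/-- The inverse `τ_j⁻¹`. -/
def τinv (j : D.Node) : D.𝕃 :=
  AddMonoidAlgebra.single (Finsupp.single (Quotient.mk D.rootSetoid (D.nodeIdx j)) (-1)) 1

theorem τ_mul_τinv (j : D.Node) : D.τ j * D.τinv j = 1 := by
  simp [τ, τinv, AddMonoidAlgebra.single_mul_single, AddMonoidAlgebra.one_def]

/-! ### The group algebra of the weight lattice -/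

theorem root_mem_P (i : ι) : D.Φ.root i ∈ D.P := by
  intro j
  obtain ⟨k, hk⟩ := D.isCrystallographic.exists_value i j
  refine ⟨k, ?_⟩
  rw [← D.coroot_eq, ← D.pairing_eq_inner, D.Φ.root_coroot_eq_pairing, ← hk]
  simp

/-- The gradient `α_j` as an element of `P`. -/
def αP (j : D.Node) : D.P := ⟨D.Φ.root (D.nodeIdx j), D.root_mem_P _⟩

/-- The action `λ ↦ w' λ` on `P` of the gradient of `w ∈ W`. -/
def gradAct (w : D.W) (x : D.P) : D.P :=
  ⟨(w : V ≃ᵃ[ℝ] V).linear x, D.W₀_P (D.linear_mem_W₀ w.2) x.2⟩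

/-- The action `λ ↦ s_j' λ` on `P`, where `s_j'` is the orthogonal reflection in `α_j`. -/
def reflP (j : D.Node) (x : D.P) : D.P :=
  ⟨D.refl (D.nodeIdx j) x, D.W₀_P (Subgroup.subset_closure ⟨_, rfl⟩) x.2⟩

/-- The integer `⟪λ, α_j^∨⟫`, for `λ ∈ P`. -/
def corootPairing (x : D.P) (j : D.Node) : ℤ := ⌊⟪(x : V), D.Φ.coroot (D.nodeIdx j)⟫⌋

theorem corootPairing_eq (x : D.P) (j : D.Node) :
    (D.corootPairing x j : ℝ) = ⟪(x : V), D.Φ.coroot (D.nodeIdx j)⟫ := by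
  obtain ⟨k, hk⟩ := x.2 (D.nodeIdx j)
  rw [← D.coroot_eq] at hk
  rw [corootPairing, hk, Int.floor_intCast]

theorem reflP_eq (j : D.Node) (x : D.P) :
    D.reflP j x = x - D.corootPairing x j • D.αP j := by
  apply Subtype.ext
  change D.refl (D.nodeIdx j) x = (x : V) - D.corootPairing x j • D.Φ.root (D.nodeIdx j)
  rw [refl_apply', ← corootPairing_eq, Int.cast_smul_eq_zsmul]

/-- The group algebra `𝕃[P]`, with basis the `X^λ = single λ 1`. -/
abbrev 𝕃P : Type _ := AddMonoidAlgebra D.𝕃 D.P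

/-- The quotient `(X^λ - X^{s_j' λ}) / (1 - X^{-α_j})` in `𝕃[P]`: with `k = ⟪λ, α_j^∨⟫`, it is
`X^λ + X^{λ - α_j} + ⋯ + X^{λ - (k-1) α_j}` if `k ≥ 0`, and
`-(X^{λ + α_j} + ⋯ + X^{λ + |k| α_j})` if `k ≤ 0`; see `demazure_mul`. -/
def demazure (j : D.Node) (x : D.P) : D.𝕃P :=
  (∑ i ∈ Finset.range (D.corootPairing x j).toNat,
      AddMonoidAlgebra.single (x - i • D.αP j) 1)
    - ∑ i ∈ Finset.range (-D.corootPairing x j).toNat,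
      AddMonoidAlgebra.single (x + (i + 1) • D.αP j) 1

theorem demazure_mul (j : D.Node) (x : D.P) :
    D.demazure j x * (1 - AddMonoidAlgebra.single (-D.αP j) 1)
      = AddMonoidAlgebra.single x 1 - AddMonoidAlgebra.single (D.reflP j x) 1 := by
  have h1 : ∀ k : ℕ, (∑ i ∈ Finset.range k,
      (AddMonoidAlgebra.single (x - i • D.αP j) 1 : D.𝕃P))
        * (1 - AddMonoidAlgebra.single (-D.αP j) 1)
      = AddMonoidAlgebra.single x 1 - AddMonoidAlgebra.single (x - k • D.αP j) 1 := by
    intro k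
    induction k with
    | zero => simp
    | succ k ih =>
      rw [Finset.sum_range_succ, add_mul, ih, mul_sub, mul_one,
        AddMonoidAlgebra.single_mul_single, mul_one, add_smul, one_smul]
      rw [show x - k • D.αP j + -D.αP j = x - (k • D.αP j + D.αP j) by abel]
      abel
  have h2 : ∀ k : ℕ, (∑ i ∈ Finset.range k,
      (AddMonoidAlgebra.single (x + (i + 1) • D.αP j) 1 : D.𝕃P))
        * (1 - AddMonoidAlgebra.single (-D.αP j) 1)
      = AddMonoidAlgebra.single (x + k • D.αP j) 1 - AddMonoidAlgebra.single x 1 := by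
    intro k
    induction k with
    | zero => simp
    | succ k ih =>
      rw [Finset.sum_range_succ, add_mul, ih, mul_sub, mul_one,
        AddMonoidAlgebra.single_mul_single, mul_one, add_smul, one_smul]
      rw [show x + (k • D.αP j + D.αP j) + -D.αP j = x + k • D.αP j by abel]
      abel
  rw [demazure, sub_mul, h1, h2, reflP_eq]
  rcases le_total 0 (D.corootPairing x j) with hk | hk
  · obtain ⟨k, hk'⟩ := Int.eq_ofNat_of_zero_le hk
    simp [hk']
  · obtain ⟨k, hk'⟩ := Int.eq_ofNat_of_zero_le (neg_nonneg.mpr hk)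
    have hk'' : D.corootPairing x j = -(k : ℤ) := by omega
    simp [hk'']

/-! ### The double affine Hecke algebra at critical level -/

/-- The generators `T_j` (`j = 0, …, n`), `T_u` (`u ∈ Ω`) and `X^λ` (`λ ∈ P`). -/
inductive Gen : Type _
  | T (j : D.Node) : Gen
  | U (u : D.Ω) : Gen
  | X (x : D.P) : Gen

/-- The free `𝕃`-algebra on the generators. -/
abbrev Free : Type _ := FreeAlgebra D.𝕃 D.Gen

/-- `T_j` in the free algebra. -/
def fT (j : D.Node) : D.Free := FreeAlgebra.ι D.𝕃 (Gen.T j)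

/-- `T_u` in the free algebra. -/
def fU (u : D.Ω) : D.Free := FreeAlgebra.ι D.𝕃 (Gen.U u)

/-- `X^λ` in the free algebra. -/
def fX (x : D.P) : D.Free := FreeAlgebra.ι D.𝕃 (Gen.X x)

/-- An element of `𝕃[P]`, written as a linear combination of the generators `X^λ`. -/
def fElem (f : D.𝕃P) : D.Free := f.coeff.sum fun x r => r • D.fX x

/-- The alternating product `a b a ⋯` with `k` factors. -/
def altProd {A : Type*} [Monoid A] (a b : A) : ℕ → A
  | 0 => 1
  | k + 1 => a * altProd b a k

/-- The defining relations. In `braid` the number of factors is the order of `s_j s_k`; it is `0`,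
and the relation void, when this order is infinite. The relations `U_one` and `U_mul` say that the
`T_u` are invertible with `T_u T_{u'} = T_{u u'}`; invertibility of `T_j` follows from
`quadratic`. -/
inductive Rel : D.Free → D.Free → Prop
  | U_one : Rel (D.fU 1) 1
  | U_mul (u u' : D.Ω) : Rel (D.fU u * D.fU u') (D.fU (u * u'))
  | U_T (u : D.Ω) (j k : D.Node)
      (h : actFn (u : V ≃ᵃ[ℝ] V) (D.simpleAffineRoot j) = D.simpleAffineRoot k) :
      Rel (D.fU u * D.fT j) (D.fT k * D.fU u)
  | quadratic (j : D.Node) :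
      Rel ((D.fT j - algebraMap D.𝕃 D.Free (D.τ j)) *
        (D.fT j + algebraMap D.𝕃 D.Free (D.τinv j))) 0
  | braid (j k : D.Node) (h : j ≠ k) :
      Rel (altProd (D.fT j) (D.fT k) (orderOf (D.s j * D.s k)))
        (altProd (D.fT k) (D.fT j) (orderOf (D.s j * D.s k)))
  | U_X (u : D.Ω) (x : D.P) :
      Rel (D.fU u * D.fX x) (D.fX (D.gradAct ⟨u, u.2.1⟩ x) * D.fU u)
  | T_X (j : D.Node) (x : D.P) :
      Rel (D.fT j * D.fX x)
        (D.fX (D.reflP j x) * D.fT j + (D.τ j - D.τinv j) • D.fElem (D.demazure j x))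
  | X_zero : Rel (D.fX 0) 1
  | X_add (x y : D.P) : Rel (D.fX x * D.fX y) (D.fX (x + y))

/-- The double affine Hecke algebra `ℋ` at critical level. -/
def H : Type _ := RingQuot D.Rel

instance : Ring D.H := inferInstanceAs (Ring (RingQuot D.Rel))

instance : Algebra D.𝕃 D.H := inferInstanceAs (Algebra D.𝕃 (RingQuot D.Rel))

/-- The quotient map onto `ℋ`. -/
def toH : D.Free →ₐ[D.𝕃] D.H := RingQuot.mkAlgHom D.𝕃 D.Rel

theorem toH_rel {x y : D.Free} (h : D.Rel x y) : D.toH x = D.toH y :=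
  RingQuot.mkAlgHom_rel D.𝕃 h

/-- The element `T_j` of `ℋ`. -/
def T (j : D.Node) : D.H := D.toH (D.fT j)

/-- The element `T_u` of `ℋ`. -/
def TΩ (u : D.Ω) : D.H := D.toH (D.fU u)

/-- The element `X^λ` of `ℋ`. -/
def X (x : D.P) : D.H := D.toH (D.fX x)

theorem TΩ_mul_inv (u : D.Ω) : D.TΩ u * D.TΩ u⁻¹ = 1 := by
  rw [TΩ, TΩ, ← map_mul, D.toH_rel (.U_mul u u⁻¹), mul_inv_cancel, D.toH_rel .U_one, map_one]

theorem T_isUnit (j : D.Node) : IsUnit (D.T j) := by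
  have h := D.toH_rel (.quadratic j)
  rw [map_mul, map_sub, map_add, AlgHom.commutes, AlgHom.commutes, map_zero] at h
  change (D.T j - _) * (D.T j + _) = 0 at h
  have hτ : algebraMap D.𝕃 D.H (D.τ j) * algebraMap D.𝕃 D.H (D.τinv j) = 1 := by
    rw [← map_mul, τ_mul_τinv, map_one]
  have c1 := Algebra.commutes (D.τ j) (D.T j)
  have c2 := Algebra.commutes (D.τinv j) (D.T j)
  generalize algebraMap D.𝕃 D.H (D.τ j) = p at *
  generalize algebraMap D.𝕃 D.H (D.τinv j) = q at *
  generalize D.T j = t at *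
  have e : t * (t - p + q) = 1 := by
    have : (t - p) * (t + q) = t * (t - p + q) - p * q := by
      simp only [sub_mul, mul_add, mul_sub, c1]
      abel
    rw [this, hτ] at h
    exact sub_eq_zero.mp h
  have e' : (t - p + q) * t = 1 := by
    rw [← e]
    simp only [sub_mul, add_mul, mul_add, mul_sub, c1, c2]
  exact ⟨⟨_, _, e, e'⟩, rfl⟩

end AffineRootDatum

end

/-! Reduced decompositions exist by minimality, and independence of `T_w` from the choice is
Matsumoto's theorem. Spanning is also soft: the relations move every generator past `X^λ`, so the
span of the `X^λ T_w` is a left ideal containing `1`. The real content is linear independence,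
obtained from a representation of `ℋ` and a vector that the `X^λ T_w` send to distinct basis
vectors.

The combinatorics of `W` rests on a base point in the fundamental alcove where all simple affine
roots take one common positive value; the sign of an affine root is the sign of its value there.
Every affine root is up to sign a sum of simple ones (`exists_sum_simple`), so `s_j` changes the
sign of only one positive affine root, `Ω` is the stabilizer of the base point, and descent of the
distance to it shows that `Ω` and the `s_j` generate `W` (`exists_prod_mul`). These facts are
packaged as a `SignSystem`, which suffices for the exchange property, `SignSystem.matsumoto` and the
regular representation of the Hecke algebra of `W` (`SignSystem.regular_braid`).

The representation of `ℋ` is built like a module induced from this regular representation `N`: `X^λ`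
acts by translation on functions from a lattice to `N`, and `T_j` by a Demazure–Lusztig operator
`dl`. The hard relation is the braid relation. The subspace where it holds is stable under the
operators involved, by the quadratic relations, and contains `X^0 ⊗ N`; it remains to see that it is
stable under every `X^l`. For a fundamental weight `l` of the rank two system, the Bernstein
relation turns a braid word in the inverses `T_i⁻¹` applied to `X^l v` into a word in the `T_i` with
a single inverse left, and the two sides are compared by the braid relation on `v`
(`BernsteinFamily.stab_two` to `stab_six`). Since `α₀, …, αₙ` are linearly dependent, `P` need not
contain fundamental weights for pairs of affine nodes; it is therefore enlarged to `Lat = P ×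
ℤ^{n+1}`, and `X^λ` acts through `(λ, 0)`.

The second basis is the image of the first under the anti-involution that fixes `T_j` and `X^λ` and
inverts `T_u`; it sends `X^λ T_w` to `T_{w⁻¹} X^λ`. -/

noncomputable section

namespace AffineRootDatum

section Roots

variable {ι V : Type*} [NormedAddCommGroup V] [InnerProductSpace ℝ V] (D : AffineRootDatum ι V)

/-! ### Roots and the positive cone -/

/-- The positive cone `Q⁺` generated by the simple roots. -/
def posCone : AddSubmonoid V := AddSubmonoid.closure (D.Φ.root '' D.base.support)

theorem exists_inner_coroot (i j : ι) : ∃ k : ℤ, ⟪D.Φ.root i, D.Φ.coroot j⟫ = k := by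
  obtain ⟨k, hk⟩ := D.isCrystallographic.exists_value i j
  refine ⟨k, ?_⟩
  rw [← D.pairing_eq_inner, D.Φ.root_coroot_eq_pairing, ← hk]
  simp

theorem inner_root_self_pos (i : ι) : 0 < ⟪D.Φ.root i, D.Φ.root i⟫ := by
  have : NeZero (2 : ℝ) := ⟨two_ne_zero⟩
  exact real_inner_self_pos.mpr (D.Φ.ne_zero i)

theorem isShort_iff (i : ι) :
    D.IsShort i ↔ ∀ j, ⟪D.Φ.root i, D.Φ.root i⟫ ≤ ⟪D.Φ.root j, D.Φ.root j⟫ := by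
  simp only [IsShort, real_inner_self_eq_norm_sq]
  exact forall_congr' fun j => (sq_le_sq₀ (norm_nonneg _) (norm_nonneg _)).symm

/-- The inner product as an invariant form of the root system. -/
def innerForm : D.Φ.InvariantForm where
  form := innerₗ V
  symm := ⟨fun x y => by simpa using real_inner_comm _ _⟩
  ne_zero i := (D.inner_root_self_pos i).ne'
  isOrthogonal_reflection i x y := by
    have e : ∀ z, D.Φ.reflection i z = D.refl i z := fun z => by
      rw [D.refl_apply', D.Φ.reflection_apply, ← D.pairing_eq_inner]; rfl
    simp only [e]
    exact D.refl_inner i x y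

theorem innerForm_apply (x y : V) : D.innerForm.form x y = ⟪x, y⟫ := rfl

theorem pairing_eq (i j : ι) : D.Φ.pairing i j = ⟪D.Φ.root i, D.Φ.coroot j⟫ := by
  rw [← D.pairing_eq_inner, D.Φ.root_coroot_eq_pairing]

theorem exists_root_neg (i : ι) : ∃ j, D.Φ.root j = -D.Φ.root i := ⟨_, D.root_neg i⟩

theorem root_mem_posCone_or (i : ι) : D.Φ.root i ∈ D.posCone ∨ -D.Φ.root i ∈ D.posCone :=
  D.base.root_mem_or_neg_mem i

/-- There is a vector on which all simple roots take the value `1`. -/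
theorem exists_inner_simple_eq_one : ∃ ξ : V, ∀ i ∈ D.base.support, ⟪D.Φ.root i, ξ⟫ = 1 := by
  have := D.isRootSystem
  let L : V →ₗ[ℝ] ℝ := D.base.toWeightBasis.constr ℝ fun _ => (1 : ℝ)
  obtain ⟨ξ, hξ⟩ := D.Φ.toLinearMap.flip.toPerfPair.surjective L
  refine ⟨ξ, fun i hi => ?_⟩
  rw [← D.pairing_eq_inner]
  have h1 : D.Φ.toLinearMap (D.Φ.root i) ξ = L (D.Φ.root i) := by rw [← hξ]; rfl
  have h2 : L (D.base.toWeightBasis ⟨i, hi⟩) = 1 := D.base.toWeightBasis.constr_basis ..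
  rw [h1, ← h2, D.base.toWeightBasis_apply]

/-- A vector with value `1` on all simple roots. -/
def rhoCheck : V := D.exists_inner_simple_eq_one.choose

theorem inner_rhoCheck {i : ι} (hi : i ∈ D.base.support) : ⟪D.Φ.root i, D.rhoCheck⟫ = 1 :=
  D.exists_inner_simple_eq_one.choose_spec i hi

/-- Pairing with `rhoCheck` is the height. Its strict positivity off `0` makes the order defined by
the cone antisymmetric. -/
theorem posCone_inner {v : V} (hv : v ∈ D.posCone) :
    v = 0 ∨ 0 < ⟪v, D.rhoCheck⟫ := by
  induction hv using AddSubmonoid.closure_induction with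
  | mem x hx =>
    obtain ⟨i, hi, rfl⟩ := hx
    right; rw [D.inner_rhoCheck hi]; exact one_pos
  | zero => exact Or.inl rfl
  | add x y _ _ hx hy =>
    rcases hx with rfl | hx
    · simpa using hy
    · rcases hy with rfl | hy
      · right; simpa using hx
      · right; rw [inner_add_left]; exact add_pos hx hy

theorem posCone_inner_nonneg {v : V} (hv : v ∈ D.posCone) : 0 ≤ ⟪v, D.rhoCheck⟫ := by
  rcases D.posCone_inner hv with rfl | h
  · simp
  · exact h.le

/-- Comparing `φ` with the root `-φ` puts `2φ` in the cone; if `-φ` were in it as well, adding the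
two would again give `φ`. -/
theorem root_φ_mem_posCone : D.Φ.root D.φ ∈ D.posCone := by
  rcases D.root_mem_posCone_or D.φ with h | h
  · exact h
  · obtain ⟨j, hj⟩ := D.exists_root_neg D.φ
    have h1 := D.highest j
    change _ ∈ D.posCone at h1
    rw [hj, sub_neg_eq_add] at h1
    have h2 := add_mem h1 h
    rwa [add_neg_cancel_right] at h2

theorem root_θ_mem_posCone : D.Φ.root D.θ ∈ D.posCone := by
  rcases D.root_mem_posCone_or D.θ with h | h
  · exact h
  · obtain ⟨j, hj⟩ := D.exists_root_neg D.θ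
    have h1 : D.Φ.root D.θ - D.Φ.root j ∈ D.posCone :=
      D.highest_short j fun k => by rw [hj, norm_neg]; exact D.short_θ k
    rw [hj, sub_neg_eq_add] at h1
    have h2 := add_mem h1 h
    rwa [add_neg_cancel_right] at h2

theorem root_φ_ne_zero : D.Φ.root D.φ ≠ 0 := fun h => by
  have := D.inner_root_self_pos D.φ
  simp [h] at this

/-- The integer pairings of two roots, and the ratio of their lengths. -/
theorem exists_pairings (i j : ι) : ∃ k l : ℤ,
    ⟪D.Φ.root i, D.Φ.coroot j⟫ = k ∧ ⟪D.Φ.root j, D.Φ.coroot i⟫ = l ∧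
    (l : ℝ) * ⟪D.Φ.root i, D.Φ.root i⟫ = k * ⟪D.Φ.root j, D.Φ.root j⟫ ∧
    2 * ⟪D.Φ.root i, D.Φ.root j⟫ = k * ⟪D.Φ.root j, D.Φ.root j⟫ ∧
    (k, l) ∈
      ({(0, 0), (1, 1), (-1, -1), (1, 2), (2, 1), (-1, -2), (-2, -1), (1, 3), (3, 1), (-1, -3),
        (-3, -1), (2, 2), (-2, -2)} : Set (ℤ × ℤ)) := by
  have := D.finite
  have := D.isCrystallographic
  have := D.isReduced
  have e : ∀ i j, ⟪D.Φ.root i, D.Φ.coroot j⟫ = (D.Φ.pairingIn ℤ i j : ℝ) := fun i j => by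
    rw [← D.pairing_eq, ← D.Φ.algebraMap_pairingIn ℤ]; simp
  refine ⟨D.Φ.pairingIn ℤ i j, D.Φ.pairingIn ℤ j i, e i j, e j i, ?_, ?_,
    D.Φ.pairingIn_pairingIn_mem_set_of_isCrystal_of_isRed i j⟩
  · rw [← e, ← e, ← D.pairing_eq, ← D.pairing_eq]
    exact D.innerForm.pairing_mul_eq_pairing_mul_swap i j
  · rw [← e, ← D.pairing_eq]
    exact D.innerForm.two_mul_apply_root_root i j

/-- No root is longer than the highest root. -/
theorem inner_root_le_φ (i : ι) :
    ⟪D.Φ.root i, D.Φ.root i⟫ ≤ ⟪D.Φ.root D.φ, D.Φ.root D.φ⟫ := by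
  have := D.finite
  have := D.isCrystallographic
  have := D.isReduced
  have := D.isIrreducible
  by_contra! hlt
  -- By irreducibility some root of the length of `i` is not orthogonal to `φ`; up to sign the
  -- product is positive.
  obtain ⟨k, hk, hk0⟩ : ∃ k, ⟪D.Φ.root k, D.Φ.root k⟫ = ⟪D.Φ.root i, D.Φ.root i⟫ ∧
      0 < ⟪D.Φ.root D.φ, D.Φ.root k⟫ := by
    obtain ⟨k, hk, hk0⟩ := D.Φ.exists_form_eq_form_and_form_ne_zero D.innerForm D.φ i
    rw [innerForm_apply] at hk0
    rcases lt_or_gt_of_ne hk0 with h | h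
    · obtain ⟨l, hl⟩ := D.exists_root_neg k
      refine ⟨l, ?_, ?_⟩
      · rw [hl, inner_neg_neg]; exact hk
      · rw [hl, inner_neg_right]; linarith
    · exact ⟨k, hk, h⟩
  obtain ⟨n, l, hn, hl, hnl, h2, hmem⟩ := D.exists_pairings k D.φ
  have hφ := D.inner_root_self_pos D.φ
  have hn2 : 2 ≤ n := by
    have hn0 : (0 : ℝ) < n := by
      rw [real_inner_comm] at hk0
      by_contra! h
      nlinarith
    have hn0' : 0 < n := by exact_mod_cast hn0
    rw [hk] at hnl
    simp only [Set.mem_insert_iff, Set.mem_singleton_iff, Prod.mk.injEq] at hmem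
    by_contra! h
    have hn1 : n = 1 := by omega
    have hl1 : 1 ≤ l := by omega
    have hl1' : (1 : ℝ) ≤ l := by exact_mod_cast hl1
    subst hn1
    push_cast at hnl
    nlinarith
  -- The root `nφ - k` is at most `φ`, so `(n - 1)φ ≤ k ≤ φ` in the cone order. As `n ≥ 2`, heights
  -- force `k = φ`, against the assumed lengths.
  have h3 : D.refl D.φ (D.Φ.root k) = D.Φ.root k - (n : ℝ) • D.Φ.root D.φ := by
    rw [D.refl_apply', hn]
  rw [D.refl_root] at h3
  have h4 : D.Φ.root D.φ - (n : ℝ) • D.Φ.root D.φ + D.Φ.root k ∈ D.posCone := by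
    have := D.highest (D.Φ.reflectionPerm (D.Φ.reflectionPerm D.φ k) (D.Φ.reflectionPerm D.φ k))
    rw [D.root_neg, h3] at this
    have e : D.Φ.root D.φ - (n : ℝ) • D.Φ.root D.φ + D.Φ.root k =
        D.Φ.root D.φ - -(D.Φ.root k - (n : ℝ) • D.Φ.root D.φ) := by module
    rw [e]
    exact this
  have h5 : D.Φ.root D.φ - D.Φ.root k ∈ D.posCone := D.highest k
  have hφp : 0 < ⟪D.Φ.root D.φ, D.rhoCheck⟫ :=
    (D.posCone_inner D.root_φ_mem_posCone).resolve_left D.root_φ_ne_zero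
  have h6 := D.posCone_inner_nonneg h4
  simp only [inner_add_left, inner_sub_left, inner_smul_left, conj_trivial] at h6
  have hn2' : (2 : ℝ) ≤ n := by exact_mod_cast hn2
  rcases D.posCone_inner h5 with h7 | h7
  · rw [sub_eq_zero] at h7
    rw [h7, hk] at hlt
    exact lt_irrefl _ hlt
  · simp only [inner_sub_left] at h7
    nlinarith

/-- Roots that are not short have the length of the highest root. -/
theorem inner_root_eq_φ {i : ι} (hi : ¬ D.IsShort i) :
    ⟪D.Φ.root i, D.Φ.root i⟫ = ⟪D.Φ.root D.φ, D.Φ.root D.φ⟫ := by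
  have := D.finite
  have := D.isCrystallographic
  have := D.isReduced
  have := D.isIrreducible
  have hθ := (D.isShort_iff D.θ).mp D.short_θ
  have hlt : ⟪D.Φ.root D.θ, D.Φ.root D.θ⟫ < ⟪D.Φ.root i, D.Φ.root i⟫ := by
    by_contra! h
    exact hi ((D.isShort_iff i).mpr fun j => h.trans (hθ j))
  rcases D.innerForm.apply_eq_or_of_apply_ne (i := D.θ) (j := i) hlt.ne D.φ with h | h
  · simp only [innerForm_apply] at h
    have := D.inner_root_le_φ i
    linarith
  · exact h.symm

/-- If there are two root lengths, the squared length ratio is an integer at least `2`, and the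
highest root is a sum of two short roots. -/
theorem exists_ratio {i : ι} (hi : ¬ D.IsShort i) :
    (∃ n : ℕ, 2 ≤ n ∧
      ⟪D.Φ.root D.φ, D.Φ.root D.φ⟫ = n * ⟪D.Φ.root D.θ, D.Φ.root D.θ⟫) ∧
    2 • D.Φ.root D.θ - D.Φ.root D.φ ∈ D.posCone := by
  have := D.finite
  have := D.isCrystallographic
  have := D.isReduced
  have := D.isIrreducible
  have hθ := (D.isShort_iff D.θ).mp D.short_θ
  have hlt : ⟪D.Φ.root D.θ, D.Φ.root D.θ⟫ < ⟪D.Φ.root D.φ, D.Φ.root D.φ⟫ := by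
    rw [← D.inner_root_eq_φ hi]
    by_contra! h
    exact hi ((D.isShort_iff i).mpr fun j => h.trans (hθ j))
  obtain ⟨k, hk, hk0⟩ : ∃ k, ⟪D.Φ.root k, D.Φ.root k⟫ = ⟪D.Φ.root D.θ, D.Φ.root D.θ⟫ ∧
      0 < ⟪D.Φ.root D.φ, D.Φ.root k⟫ := by
    obtain ⟨k, hk, hk0⟩ := D.Φ.exists_form_eq_form_and_form_ne_zero D.innerForm D.φ D.θ
    rw [innerForm_apply] at hk0
    rcases lt_or_gt_of_ne hk0 with h | h
    · obtain ⟨l, hl⟩ := D.exists_root_neg k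
      refine ⟨l, ?_, ?_⟩
      · rw [hl, inner_neg_neg]; exact hk
      · rw [hl, inner_neg_right]; linarith
    · exact ⟨k, hk, h⟩
  obtain ⟨n, l, hn, hl, hnl, h2, hmem⟩ := D.exists_pairings k D.φ
  have hφ := D.inner_root_self_pos D.φ
  have hθ0 := D.inner_root_self_pos D.θ
  have hn0 : 0 < n := by
    have : (0 : ℝ) < n := by
      rw [real_inner_comm] at hk0
      by_contra! h
      nlinarith
    exact_mod_cast this
  rw [hk] at hnl
  have hnlt : n < l := by
    have : (n : ℝ) < l := by
      by_contra! h
      have hl0 : (0 : ℝ) < l := by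
        have : (0 : ℝ) < n := by exact_mod_cast hn0
        by_contra! h
        nlinarith
      nlinarith
    exact_mod_cast this
  have hn1 : n = 1 := by
    simp only [Set.mem_insert_iff, Set.mem_singleton_iff, Prod.mk.injEq] at hmem
    omega
  subst hn1
  refine ⟨⟨l.toNat, by omega, ?_⟩, ?_⟩
  · have : ((l.toNat : ℤ) : ℝ) = l := by rw [Int.toNat_of_nonneg (by omega)]
    rw [← Int.cast_natCast, this, hnl]
    simp
  -- Here `φ = k + (φ - k)` with both summands short roots, the second one being `-s_φ k`; each is
  -- at most `θ`.
  · have h3 : D.refl D.φ (D.Φ.root k) = D.Φ.root k - D.Φ.root D.φ := by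
      rw [D.refl_apply', hn]; simp
    have hkS : ∀ j, ‖D.Φ.root k‖ ≤ ‖D.Φ.root j‖ := (D.isShort_iff k).mpr fun j => hk ▸ hθ j
    have h4 : D.Φ.root D.θ - D.Φ.root k ∈ D.posCone := D.highest_short k hkS
    have h5 : D.Φ.root D.θ - D.Φ.root (D.Φ.reflectionPerm (D.Φ.reflectionPerm D.φ k)
        (D.Φ.reflectionPerm D.φ k)) ∈ D.posCone := by
      refine D.highest_short _ ((D.isShort_iff _).mpr fun j => ?_)
      rw [D.root_neg, inner_neg_neg, ← D.refl_root, D.refl_inner, hk]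
      exact hθ j
    rw [D.root_neg, ← D.refl_root, h3] at h5
    convert add_mem h4 h5 using 1
    rw [two_smul]
    abel

/-! ### The root `-α₀`, the integers `m_α` and the lattice `P̂` -/

/-- The root `-α₀`. -/
def ψ : ι := if D.twisted then D.θ else D.φ

theorem root_zeroIdx : D.Φ.root D.zeroIdx = -D.Φ.root D.ψ := by
  unfold zeroIdx ψ
  split_ifs <;> exact D.root_neg _

theorem root_ψ_mem_posCone : D.Φ.root D.ψ ∈ D.posCone := by
  unfold ψ
  split_ifs
  · exact D.root_θ_mem_posCone
  · exact D.root_φ_mem_posCone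

theorem m_congr {i j : ι} (h : ⟪D.Φ.root i, D.Φ.root i⟫ = ⟪D.Φ.root j, D.Φ.root j⟫) :
    D.m i = D.m j := by
  have hs : D.IsShort i ↔ D.IsShort j := by rw [isShort_iff, isShort_iff, h]
  unfold m
  by_cases h : D.IsShort j <;> simp [h, hs]

/-- `m_α` is a positive integer, and `m_α (-α₀) + α` is in the positive cone. -/
theorem exists_m_eq (i : ι) : ∃ n : ℕ, 1 ≤ n ∧ D.m i = n ∧
    n • D.Φ.root D.ψ + D.Φ.root i ∈ D.posCone := by
  obtain ⟨j, hj⟩ := D.exists_root_neg i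
  have hφ : D.Φ.root D.φ + D.Φ.root i ∈ D.posCone := by
    have : D.Φ.root D.φ - D.Φ.root j ∈ D.posCone := D.highest j
    rwa [hj, sub_neg_eq_add] at this
  by_cases hs : D.IsShort i
  · refine ⟨1, le_rfl, by simp [m, hs], ?_⟩
    rw [one_smul, ψ]
    split_ifs
    · have : D.Φ.root D.θ - D.Φ.root j ∈ D.posCone :=
        D.highest_short j fun k => by rw [hj, norm_neg]; exact hs k
      rwa [hj, sub_neg_eq_add] at this
    · exact hφ
  · rw [m, if_neg hs, root_zeroIdx, inner_neg_neg, ψ]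
    split_ifs with ht
    · obtain ⟨⟨n, hn, h⟩, h2⟩ := D.exists_ratio hs
      refine ⟨n, by omega, ?_, ?_⟩
      · rw [h]; exact mul_div_cancel_right₀ _ (D.inner_root_self_pos _).ne'
      -- With `n = 2 + k`, the vector `nθ + α` is `kθ + (2θ - φ) + (φ + α)`; this is where a length
      -- ratio of at least `2` is needed.
      · obtain ⟨k, rfl⟩ := Nat.exists_eq_add_of_le hn
        have := add_mem (nsmul_mem D.root_θ_mem_posCone k) (add_mem h2 hφ)
        convert this using 1
        rw [add_smul]
        abel
    · refine ⟨1, le_rfl, ?_, ?_⟩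
      · simpa using div_self (D.inner_root_self_pos _).ne'
      · rw [one_smul]; exact hφ

theorem m_pos (i : ι) : 0 < D.m i := by
  obtain ⟨n, hn, h, -⟩ := D.exists_m_eq i
  rw [h]
  exact_mod_cast hn

theorem inner_hatRoot_coroot (x : V) (i : ι) :
    ⟪x, (2 / ⟪D.hatRoot i, D.hatRoot i⟫) • D.hatRoot i⟫ = ⟪x, D.Φ.root i⟫ / D.m i := by
  have h1 := (D.inner_root_self_pos i).ne'
  have h2 := (D.m_pos i).ne'
  rw [hatRoot, D.coroot_eq]
  simp only [inner_smul_left, inner_smul_right, conj_trivial]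
  field_simp

/-- This divisibility is what lets translations by `c P̂` permute the affine roots: constants of
affine roots over `α` move in steps of `m_α c`. -/
theorem inner_mem_hatP {y : V} (hy : y ∈ D.hatP) (i : ι) :
    ∃ k : ℤ, ⟪D.Φ.root i, y⟫ = D.m i * k := by
  obtain ⟨k, hk⟩ := hy i
  rw [D.inner_hatRoot_coroot, div_eq_iff (D.m_pos i).ne'] at hk
  exact ⟨k, by rw [real_inner_comm, hk, mul_comm]⟩

/-- The coroot of `α₀` lies in `P̂`. -/
theorem coroot_zeroIdx_mem_hatP : D.Φ.coroot D.zeroIdx ∈ D.hatP := by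
  intro i
  rw [D.inner_hatRoot_coroot, real_inner_comm]
  obtain ⟨k, l, hk, hl, hkl, -, hmem⟩ := D.exists_pairings i D.zeroIdx
  by_cases hs : D.IsShort i
  · refine ⟨k, ?_⟩
    rw [m, if_pos hs, hk, div_one]
  -- For long `α` one has `m_α = ⟪α, α⟫ / ⟪α₀, α₀⟫`, and dividing `⟪α, α₀^∨⟫` by it gives the
  -- transposed Cartan integer `⟪α₀, α^∨⟫`.
  · refine ⟨l, ?_⟩
    rw [m, if_neg hs, hk, div_eq_iff, ← D.inner_root_eq_φ hs, ← mul_div_assoc, hkl,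
      mul_div_cancel_right₀ _ (D.inner_root_self_pos _).ne']
    exact (div_pos (D.inner_root_self_pos _) (D.inner_root_self_pos _)).ne'

end Roots

end AffineRootDatum

end

noncomputable section

namespace AffineRootDatum

section AffineRoots

variable {ι V : Type*} [NormedAddCommGroup V] [InnerProductSpace ℝ V] (D : AffineRootDatum ι V)

/-! ### The action of the extended affine Weyl group on the affine roots -/

theorem actFn_mul (u w : V ≃ᵃ[ℝ] V) (f : V → ℝ) : actFn (u * w) f = actFn u (actFn w f) := by
  funext x
  simp only [actFn, mul_inv_rev]
  rfl

theorem actFn_one (f : V → ℝ) : actFn (1 : V ≃ᵃ[ℝ] V) f = f := rfl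

theorem actFn_inv_apply (w : V ≃ᵃ[ℝ] V) (f : V → ℝ) (x : V) : actFn w⁻¹ f x = f (w x) := by
  simp [actFn]

theorem affineFn_inj {v v' : V} {r r' : ℝ} (h : affineFn v r = affineFn v' r') :
    v = v' ∧ r = r' := by
  have h0 : r = r' := by simpa [affineFn] using congrFun h 0
  refine ⟨?_, h0⟩
  refine ext_inner_right ℝ fun x => ?_
  have := congrFun h x
  simp only [affineFn, h0] at this
  linarith

theorem linear_inner {w : V ≃ᵃ[ℝ] V} (hw : w ∈ D.W) (x y : V) :
    ⟪w.linear x, w.linear y⟫ = ⟪x, y⟫ :=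
  (D.W₀_spec (D.linear_mem_W₀ hw)).1 x y

theorem exists_actFn_affineFn {w : V ≃ᵃ[ℝ] V} (hw : w ∈ D.W) : ∃ y ∈ D.hatP, ∀ v r,
    actFn w (affineFn v r) = affineFn (w.linear v) (r - D.c * ⟪v, y⟫) := by
  have hlin := D.linear_inner hw
  obtain ⟨v', hv', y, hy, rfl⟩ := hw
  refine ⟨y, hy, fun v r => funext fun x => ?_⟩
  obtain ⟨z, rfl⟩ := (v'.toAffineEquiv * transl (D.c • y)).surjective x
  have h1 : actFn (v'.toAffineEquiv * transl (D.c • y)) (affineFn v r)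
      ((v'.toAffineEquiv * transl (D.c • y)) z) = ⟪v, z⟫ + r :=
    congrArg (affineFn v r) ((v'.toAffineEquiv * transl (D.c • y)).symm_apply_apply z)
  rw [h1, linear_mul_transl]
  have h2 : ⟪(v'.toAffineEquiv * transl (D.c • y)).linear v, v' (z + D.c • y)⟫ =
      ⟪v, z + D.c • y⟫ := hlin v (z + D.c • y)
  rw [affineFn, h2, inner_add_right, inner_smul_right]
  ring

theorem exists_linear_root {w : V ≃ᵃ[ℝ] V} (hw : w ∈ D.W) (i : ι) :
    ∃ j, w.linear (D.Φ.root i) = D.Φ.root j :=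
  (D.W₀_spec (D.linear_mem_W₀ hw)).2 i

/-- The constant changes by a multiple of `m_α c`, and `m` depends only on the length of the root,
which the gradient of `w` preserves. -/
theorem actFn_mem_affineRoots {w : V ≃ᵃ[ℝ] V} (hw : w ∈ D.W) {f : V → ℝ}
    (hf : f ∈ D.affineRoots) : actFn w f ∈ D.affineRoots := by
  obtain ⟨i, r, rfl⟩ := hf
  obtain ⟨y, hy, h⟩ := D.exists_actFn_affineFn hw
  obtain ⟨j, hj⟩ := D.exists_linear_root hw i
  obtain ⟨k, hk⟩ := D.inner_mem_hatP hy i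
  refine ⟨j, r - k, ?_⟩
  have hm : D.m j = D.m i := D.m_congr (by rw [← hj, D.linear_inner hw])
  rw [h, hj, hk, hm]
  congr 1
  push_cast
  ring

theorem transl_mem_W {y : V} (hy : y ∈ D.hatP) : transl (D.c • y) ∈ D.W :=
  ⟨1, one_mem _, y, hy, by ext; rfl⟩

theorem refl_mem_W (i : ι) : (D.refl i).toAffineEquiv ∈ D.W :=
  ⟨D.refl i, Subgroup.subset_closure ⟨i, rfl⟩, 0, zero_mem _, by
    ext x; rw [linear_mul_transl]; simp⟩

/-- Only `j = 0` has a translation part, by `-c α₀^∨`, and `α₀^∨` lies in `P̂`. -/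
theorem s_mem_W (j : D.Node) : D.s j ∈ D.W := by
  refine mul_mem ?_ (D.refl_mem_W _)
  rcases j with _ | i
  · have : -(D.nodeConst none • D.Φ.coroot (D.nodeIdx none)) =
        D.c • -D.Φ.coroot D.zeroIdx := by
      rw [smul_neg]; rfl
    rw [this]
    exact D.transl_mem_W (neg_mem D.coroot_zeroIdx_mem_hatP)
  · have : -(D.nodeConst (some i) • D.Φ.coroot (D.nodeIdx (some i))) = D.c • (0 : V) := by
      simp [nodeConst]
    rw [this]
    exact D.transl_mem_W (zero_mem _)

theorem inner_root_coroot (i : ι) : ⟪D.Φ.root i, D.Φ.coroot i⟫ = 2 := by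
  rw [← D.pairing_eq, D.Φ.pairing_same]

theorem affineFn_s (v : V) (r : ℝ) (j : D.Node) (x : V) : affineFn v r (D.s j x) =
    affineFn v r x - ⟪v, D.Φ.coroot (D.nodeIdx j)⟫ * D.simpleAffineRoot j x := by
  rw [s_apply, affineFn, inner_sub_right, inner_smul_right, affineFn]
  ring

theorem simpleAffineRoot_s (j : D.Node) (x : V) :
    D.simpleAffineRoot j (D.s j x) = -D.simpleAffineRoot j x := by
  have := D.affineFn_s (D.Φ.root (D.nodeIdx j)) (D.nodeConst j) j x
  rw [inner_root_coroot] at this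
  simp only [simpleAffineRoot] at this ⊢
  linarith

theorem s_mul_self (j : D.Node) : D.s j * D.s j = 1 := by
  ext x
  change D.s j (D.s j x) = x
  rw [s_apply, simpleAffineRoot_s, s_apply, neg_smul]
  abel

theorem s_inv (j : D.Node) : (D.s j)⁻¹ = D.s j := inv_eq_of_mul_eq_one_left (D.s_mul_self j)

theorem actFn_s_simple (j : D.Node) :
    actFn (D.s j) (D.simpleAffineRoot j) = -D.simpleAffineRoot j := by
  funext x
  rw [actFn, s_inv, simpleAffineRoot_s]
  rfl

theorem exists_actFn_s {f : V → ℝ} (hf : f ∈ D.affineRoots) (j : D.Node) :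
    ∃ n : ℤ, actFn (D.s j) f = f - n • D.simpleAffineRoot j := by
  obtain ⟨i, r, rfl⟩ := hf
  obtain ⟨n, hn⟩ := D.exists_inner_coroot i (D.nodeIdx j)
  refine ⟨n, funext fun x => ?_⟩
  rw [actFn, s_inv, affineFn_s, hn]
  simp

theorem linear_root_of_actFn {g : V ≃ᵃ[ℝ] V} (hg : g ∈ D.W) {i j : D.Node}
    (h : actFn g (D.simpleAffineRoot j) = D.simpleAffineRoot i) :
    g.linear (D.Φ.root (D.nodeIdx j)) = D.Φ.root (D.nodeIdx i) := by
  obtain ⟨y, -, hy⟩ := D.exists_actFn_affineFn hg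
  rw [simpleAffineRoot, hy] at h
  exact (affineFn_inj h).1

theorem linear_coroot {g : V ≃ᵃ[ℝ] V} (hg : g ∈ D.W) {i j : ι}
    (h : g.linear (D.Φ.root j) = D.Φ.root i) : g.linear (D.Φ.coroot j) = D.Φ.coroot i := by
  rw [D.coroot_eq, D.coroot_eq, map_smul, h, ← h, D.linear_inner hg]

/-- Conjugating a simple reflection by an element that maps a simple affine root to another. -/
theorem conj_s {g : V ≃ᵃ[ℝ] V} (hg : g ∈ D.W) {i j : D.Node}
    (h : actFn g (D.simpleAffineRoot j) = D.simpleAffineRoot i) :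
    g * D.s j * g⁻¹ = D.s i := by
  rw [mul_inv_eq_iff_eq_mul]
  ext x
  change g (D.s j x) = D.s i (g x)
  rw [s_apply, s_apply, ← h, actFn, ← D.linear_coroot hg (D.linear_root_of_actFn hg h)]
  have e : x - D.simpleAffineRoot j x • D.Φ.coroot (D.nodeIdx j) =
      (-(D.simpleAffineRoot j x • D.Φ.coroot (D.nodeIdx j))) +ᵥ x := by
    rw [vadd_eq_add]; abel
  rw [e, AffineEquiv.map_vadd, vadd_eq_add]
  simp only [map_neg, map_smul]
  rw [show g⁻¹ (g x) = x from g.symm_apply_apply x]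
  abel

/-! ### Signs of affine roots -/

/-- At the origin only `a₀` is non-zero, so its coefficient vanishes; the rest is independence of
the base. The gradients alone are dependent. -/
theorem linearIndependent_simpleAffineRoot : LinearIndependent ℝ D.simpleAffineRoot := by
  have := D.isRootSystem
  rw [Fintype.linearIndependent_iff]
  intro z hz
  rw [Fintype.sum_option] at hz
  have h0 : z none = 0 := by
    have := congrFun hz 0
    simp only [simpleAffineRoot, affineFn, nodeConst, Pi.add_apply, Pi.smul_apply,
      Finset.sum_apply, inner_zero_right, zero_add, smul_eq_mul, mul_zero, Pi.zero_apply,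
      Finset.sum_const_zero, add_zero] at this
    exact (mul_eq_zero.mp this).resolve_right D.c_pos.ne'
  have h1 : ∑ i, z (some i) • D.base.toWeightBasis i = 0 := by
    refine ext_inner_right ℝ fun x => ?_
    have := congrFun hz x
    simp only [h0, zero_smul, zero_add, simpleAffineRoot, affineFn, nodeConst, nodeIdx,
      Pi.smul_apply, Finset.sum_apply, Pi.zero_apply, add_zero, smul_eq_mul] at this
    simp only [sum_inner, inner_smul_left, conj_trivial, D.base.toWeightBasis_apply,
      inner_zero_left]
    exact this
  have h2 := Fintype.linearIndependent_iff.mp D.base.toWeightBasis.linearIndependent _ h1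
  intro j
  rcases j with _ | i
  · exact h0
  · exact h2 i

theorem sum_simple_inj {k l : D.Node → ℤ}
    (h : ∑ j, k j • D.simpleAffineRoot j = ∑ j, l j • D.simpleAffineRoot j) : k = l := by
  have := Fintype.linearIndependent_iff.mp D.linearIndependent_simpleAffineRoot
    (fun j => ((k j - l j : ℤ) : ℝ)) (by
      simp only [Int.cast_smul_eq_zsmul, sub_smul, Finset.sum_sub_distrib]
      rw [h, sub_self])
  funext j
  have hj := this j
  rw [Int.cast_eq_zero] at hj
  omega

theorem posCone_affineFn {v : V} (hv : v ∈ D.posCone) :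
    affineFn v 0 ∈ AddSubmonoid.closure (Set.range D.simpleAffineRoot) := by
  induction hv using AddSubmonoid.closure_induction with
  | mem x hx =>
    obtain ⟨i, hi, rfl⟩ := hx
    exact AddSubmonoid.subset_closure ⟨some ⟨i, hi⟩, rfl⟩
  | zero =>
    have : affineFn (0 : V) 0 = 0 := by funext x; simp [affineFn]
    rw [this]
    exact zero_mem _
  | add x y _ _ hx hy =>
    have : affineFn (x + y) 0 = affineFn x 0 + affineFn y 0 := by
      funext z; simp [affineFn, inner_add_left]
    rw [this]
    exact add_mem hx hy

theorem exists_sum_of_mem_closure {f : V → ℝ}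
    (hf : f ∈ AddSubmonoid.closure (Set.range D.simpleAffineRoot)) :
    ∃ k : D.Node → ℕ, f = ∑ j, k j • D.simpleAffineRoot j := by
  classical
  induction hf using AddSubmonoid.closure_induction with
  | mem x hx =>
    obtain ⟨j, rfl⟩ := hx
    exact ⟨Pi.single j 1, by simp [Pi.single_apply, ite_smul]⟩
  | zero => exact ⟨0, by simp⟩
  | add x y _ _ hx hy =>
    obtain ⟨k, rfl⟩ := hx
    obtain ⟨l, rfl⟩ := hy
    exact ⟨k + l, by simp [add_smul, Finset.sum_add_distrib]⟩

theorem neg_mem_affineRoots {f : V → ℝ} (hf : f ∈ D.affineRoots) : -f ∈ D.affineRoots := by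
  obtain ⟨i, r, rfl⟩ := hf
  obtain ⟨j, hj⟩ := D.exists_root_neg i
  refine ⟨j, -r, funext fun x => ?_⟩
  have hm : D.m j = D.m i := D.m_congr (by rw [hj, inner_neg_neg])
  simp only [affineFn, Pi.neg_apply, hj, hm, inner_neg_left]
  push_cast
  ring

/-- Every affine root is, up to sign, a sum of simple affine roots. -/
theorem exists_sum_simple {f : V → ℝ} (hf : f ∈ D.affineRoots) : ∃ k : D.Node → ℕ,
    f = ∑ j, k j • D.simpleAffineRoot j ∨ f = -∑ j, k j • D.simpleAffineRoot j := by
  -- With `n = m_α` and `a₀ = -ψ + c`, one has `α + n(r+1)c = n(r+1) a₀ + (n(r+1)ψ + α)`, and the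
  -- bracket is in the cone because `nψ + α` and `ψ` are. The shift to `r + 1` covers the positive
  -- multiples; zero and negative ones follow from the cone dichotomy and negation.
  have key : ∀ (i : ι) (r : ℕ), affineFn (D.Φ.root i) (D.m i * ((r + 1 : ℕ) : ℝ) * D.c) ∈
      AddSubmonoid.closure (Set.range D.simpleAffineRoot) := by
    intro i r
    obtain ⟨n, hn, hm, hcone⟩ := D.exists_m_eq i
    have h1 : (n * (r + 1)) • D.Φ.root D.ψ + D.Φ.root i ∈ D.posCone := by
      have := add_mem (nsmul_mem D.root_ψ_mem_posCone (n * r)) hcone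
      convert this using 1
      rw [mul_add, add_smul, mul_one]
      abel
    have h2 := add_mem (nsmul_mem (AddSubmonoid.subset_closure
      (Set.mem_range_self (f := D.simpleAffineRoot) none)) (n * (r + 1))) (D.posCone_affineFn h1)
    convert h2 using 1
    funext x
    simp only [affineFn, simpleAffineRoot, nodeIdx, nodeConst, root_zeroIdx, hm, Pi.add_apply,
      Pi.smul_apply, inner_add_left, inner_neg_left]
    simp only [← Nat.cast_smul_eq_nsmul ℝ, inner_smul_left, conj_trivial]
    push_cast
    ring
  have key0 : ∀ i, D.Φ.root i ∈ D.posCone → affineFn (D.Φ.root i) (D.m i * (0 : ℤ) * D.c) ∈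
      AddSubmonoid.closure (Set.range D.simpleAffineRoot) := fun i hi => by
    simpa using D.posCone_affineFn hi
  suffices h : f ∈ AddSubmonoid.closure (Set.range D.simpleAffineRoot) ∨
      -f ∈ AddSubmonoid.closure (Set.range D.simpleAffineRoot) by
    rcases h with h | h
    · obtain ⟨k, hk⟩ := D.exists_sum_of_mem_closure h
      exact ⟨k, Or.inl hk⟩
    · obtain ⟨k, hk⟩ := D.exists_sum_of_mem_closure h
      exact ⟨k, Or.inr (by rw [← hk, neg_neg])⟩
  obtain ⟨i, r, rfl⟩ := hf
  obtain ⟨j, hj⟩ := D.exists_root_neg i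
  have hm : D.m j = D.m i := D.m_congr (by rw [hj, inner_neg_neg])
  have hneg : ∀ z : ℝ, -affineFn (D.Φ.root i) (D.m i * z * D.c) =
      affineFn (D.Φ.root j) (D.m j * -z * D.c) := fun z => by
    funext x
    simp only [affineFn, Pi.neg_apply, hj, hm, inner_neg_left]
    ring
  rcases lt_trichotomy r 0 with hr | rfl | hr
  · right
    obtain ⟨n, hn⟩ := Int.eq_ofNat_of_zero_le (show 0 ≤ -r - 1 by omega)
    rw [hneg]
    convert key j n using 4
    have : r = -((n : ℤ) + 1) := by omega
    rw [this]
    push_cast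
    ring
  · rcases D.root_mem_posCone_or i with h | h
    · exact Or.inl (key0 i h)
    · right
      rw [← hj] at h
      rw [hneg]
      simpa using key0 j h
  · left
    obtain ⟨n, hn⟩ := Int.eq_ofNat_of_zero_le (show 0 ≤ r - 1 by omega)
    convert key i n using 4
    have : r = (n : ℤ) + 1 := by omega
    rw [this]
    push_cast
    ring

/-! ### The base point of the fundamental alcove and the signs it defines -/

/-- The common value of the simple affine roots at the base point. -/
def baseVal : ℝ := D.c / (1 + ⟪D.Φ.root D.ψ, D.rhoCheck⟫)

/-- The point of the fundamental alcove at which all simple affine roots have the same value. -/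
def basePt : V := D.baseVal • D.rhoCheck

theorem baseVal_pos : 0 < D.baseVal :=
  div_pos D.c_pos (add_pos_of_pos_of_nonneg one_pos (D.posCone_inner_nonneg D.root_ψ_mem_posCone))

/-- At `t ρ^∨` the finite simple roots have value `t` and `a₀` has value `c - t ⟪ψ, ρ^∨⟫`; equating
them gives the formula for `baseVal`. -/
theorem simpleAffineRoot_basePt (j : D.Node) : D.simpleAffineRoot j D.basePt = D.baseVal := by
  rw [simpleAffineRoot, affineFn, basePt, inner_smul_right]
  rcases j with _ | i
  · have h := add_pos_of_pos_of_nonneg one_pos (D.posCone_inner_nonneg D.root_ψ_mem_posCone)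
    simp only [nodeIdx, nodeConst, root_zeroIdx, inner_neg_left, baseVal]
    field_simp
    ring
  · simp only [nodeIdx, nodeConst, D.inner_rhoCheck i.2]
    ring

theorem sum_simple_basePt (k : D.Node → ℕ) :
    (∑ j, k j • D.simpleAffineRoot j) D.basePt = (∑ j, k j : ℕ) * D.baseVal := by
  rw [Finset.sum_apply, Nat.cast_sum, Finset.sum_mul]
  exact Finset.sum_congr rfl fun j _ => by
    rw [Pi.smul_apply, simpleAffineRoot_basePt, nsmul_eq_mul]

theorem affineRoot_ne_zero {f : V → ℝ} (hf : f ∈ D.affineRoots) : f ≠ 0 := by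
  obtain ⟨i, r, rfl⟩ := hf
  intro h
  have h0 : (0 : V → ℝ) = affineFn 0 0 := by funext x; simp [affineFn]
  rw [h0] at h
  have h1 := D.inner_root_self_pos i
  rw [(affineFn_inj h).1] at h1
  simp at h1

theorem exists_sum_of_pos {f : V → ℝ} (hf : f ∈ D.affineRoots) (h : 0 < f D.basePt) :
    ∃ k : D.Node → ℕ, 1 ≤ ∑ j, k j ∧ f = ∑ j, k j • D.simpleAffineRoot j := by
  have hδ := D.baseVal_pos
  obtain ⟨k, hk | hk⟩ := D.exists_sum_simple hf
  · refine ⟨k, ?_, hk⟩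
    rw [hk, sum_simple_basePt] at h
    by_contra! h1
    rw [Nat.lt_one_iff.mp h1] at h
    simp at h
  · rw [hk, Pi.neg_apply, sum_simple_basePt] at h
    have : (0 : ℝ) ≤ (∑ j, k j : ℕ) * D.baseVal := by positivity
    linarith

/-- The value of a sum of simple affine roots at the base point is the number of summands times
`baseVal`. Hence each affine root is either positive or negative there. -/
theorem affineRoot_basePt_ne_zero {f : V → ℝ} (hf : f ∈ D.affineRoots) : f D.basePt ≠ 0 := by
  have hδ := D.baseVal_pos
  have aux : ∀ k : D.Node → ℕ, (∑ j, k j • D.simpleAffineRoot j) ≠ 0 →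
      (∑ j, k j • D.simpleAffineRoot j) D.basePt ≠ 0 := by
    intro k hk h0
    rw [sum_simple_basePt, mul_eq_zero, Nat.cast_eq_zero] at h0
    have h1 := Finset.sum_eq_zero_iff.mp (h0.resolve_right hδ.ne')
    exact hk (Finset.sum_eq_zero fun j hj => by rw [h1 j hj, zero_smul])
  have hne := D.affineRoot_ne_zero hf
  obtain ⟨k, rfl | rfl⟩ := D.exists_sum_simple hf
  · exact aux k hne
  · rw [Pi.neg_apply, neg_ne_zero]
    exact aux k (neg_ne_zero.mp hne)

theorem baseVal_le_of_pos {f : V → ℝ} (hf : f ∈ D.affineRoots) (h : 0 < f D.basePt) :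
    D.baseVal ≤ f D.basePt := by
  obtain ⟨k, hk, rfl⟩ := D.exists_sum_of_pos hf h
  rw [sum_simple_basePt]
  have hk' : (1 : ℝ) ≤ (∑ j, k j : ℕ) := by exact_mod_cast hk
  have := D.baseVal_pos
  nlinarith

/-- The value `baseVal` means that the sum of simple affine roots has exactly one term. -/
theorem eq_simple_of_basePt {f : V → ℝ} (hf : f ∈ D.affineRoots)
    (h : f D.basePt = D.baseVal) : ∃ j, f = D.simpleAffineRoot j := by
  have hδ := D.baseVal_pos
  obtain ⟨k, hk, rfl⟩ := D.exists_sum_of_pos hf (h ▸ hδ)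
  rw [sum_simple_basePt, mul_eq_right₀ hδ.ne'] at h
  have hsum : ∑ j, k j = 1 := by exact_mod_cast h
  obtain ⟨j, hj⟩ : ∃ j, k j ≠ 0 := by
    by_contra! h0
    simp [h0] at hsum
  have hle : ∀ i, i ≠ j → k i = 0 := fun i hi => by
    have := Finset.add_le_sum (f := k) (fun _ _ => Nat.zero_le _) (Finset.mem_univ i)
      (Finset.mem_univ j) hi
    omega
  refine ⟨j, ?_⟩
  rw [Finset.sum_eq_single j (fun i _ hi => by rw [hle i hi, zero_smul]) (by simp)]
  have : k j = 1 := by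
    rw [← hsum]
    exact (Finset.sum_eq_single j (fun i _ hi => hle i hi) (by simp)).symm
  rw [this, one_smul]

/-- The only positive multiple of a simple affine root that is an affine root is itself. -/
theorem eq_simple_of_nsmul {k : ℕ} {j : D.Node} (hf : k • D.simpleAffineRoot j ∈ D.affineRoots) :
    k • D.simpleAffineRoot j = D.simpleAffineRoot j := by
  have := D.isReduced
  have h0 := D.affineRoot_ne_zero hf
  obtain ⟨i, r, h⟩ := hf
  have h1 : k • D.simpleAffineRoot j =
      affineFn ((k : ℝ) • D.Φ.root (D.nodeIdx j)) (k * D.nodeConst j) := by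
    funext x
    simp only [simpleAffineRoot, affineFn, Pi.smul_apply, nsmul_eq_mul, inner_smul_left,
      conj_trivial]
    ring
  have h2 : (k : ℝ) • D.Φ.root (D.nodeIdx j) = D.Φ.root i := (affineFn_inj (h1.symm.trans h)).1
  have hk : k ≠ 0 := by rintro rfl; simp at h0
  have h3 : D.Φ.root i = D.Φ.root (D.nodeIdx j) ∨ D.Φ.root i = -D.Φ.root (D.nodeIdx j) := by
    refine RootPairing.IsReduced.eq_or_eq_neg i (D.nodeIdx j) fun hli => ?_
    have := LinearIndependent.pair_iff.mp hli 1 (-k) (by rw [← h2]; simp)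
    exact one_ne_zero this.1
  have h4 := D.inner_root_self_pos (D.nodeIdx j)
  have h5 := congrArg (fun x => ⟪D.Φ.root (D.nodeIdx j), x⟫) h2
  simp only [inner_smul_right] at h5
  have hk' : (0 : ℝ) < k := by positivity
  rcases h3 with h3 | h3
  · rw [h3] at h5
    have : (k : ℝ) = 1 := by
      rwa [mul_eq_right₀ h4.ne'] at h5
    have : k = 1 := by exact_mod_cast this
    rw [this, one_smul]
  · rw [h3, inner_neg_right] at h5
    have := mul_pos hk' h4
    linarith

/-- A simple reflection changes the sign of one positive affine root only. -/
theorem eq_simple_of_sign_change {f : V → ℝ} (hf : f ∈ D.affineRoots) (h : 0 < f D.basePt)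
    {j : D.Node} (hs : actFn (D.s j) f D.basePt < 0) : f = D.simpleAffineRoot j := by
  classical
  have hf' := D.neg_mem_affineRoots (D.actFn_mem_affineRoots (D.s_mem_W j) hf)
  obtain ⟨n, hn⟩ := D.exists_actFn_s hf j
  obtain ⟨k, -, rfl⟩ := D.exists_sum_of_pos hf h
  obtain ⟨l, -, hl⟩ := D.exists_sum_of_pos hf' (by rw [Pi.neg_apply]; linarith)
  rw [hn] at hl
  -- Both `f` and `-s_j f` are non-negative combinations and their sum is a multiple of `a_j`, so
  -- all other coefficients of both vanish.
  have e : ∑ i, ((k i + l i : ℕ) : ℤ) • D.simpleAffineRoot i =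
      ∑ i, (if i = j then n else 0) • D.simpleAffineRoot i := by
    simp only [Nat.cast_smul_eq_nsmul, add_smul, Finset.sum_add_distrib, ← hl, ite_smul, zero_smul,
      Finset.sum_ite_eq', Finset.mem_univ, if_true]
    abel
  have e' := D.sum_simple_inj e
  have hk : ∀ i, i ≠ j → k i = 0 := fun i hi => by
    have := congrFun e' i
    simp only [hi, if_false] at this
    omega
  rw [Finset.sum_eq_single j (fun i _ hi => by rw [hk i hi, zero_smul]) (by simp)] at hf ⊢
  exact D.eq_simple_of_nsmul hf

theorem eq_of_simple_inner {x y : V}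
    (h : ∀ j, D.simpleAffineRoot j x = D.simpleAffineRoot j y) : x = y := by
  have := D.isRootSystem
  have h' : ∀ i, innerₗ V (D.base.toWeightBasis i) x = innerₗ V (D.base.toWeightBasis i) y := by
    intro i
    have := h (some i)
    simp only [simpleAffineRoot, affineFn] at this
    rw [D.base.toWeightBasis_apply]
    exact add_right_cancel this
  refine ext_inner_left ℝ fun v => ?_
  have : (innerₗ V).flip x = (innerₗ V).flip y := D.base.toWeightBasis.ext h'
  exact congrArg (fun l => l v) this

/-- `Ω` is the stabilizer of the base point. -/
theorem mem_Ω_iff {w : V ≃ᵃ[ℝ] V} (hw : w ∈ D.W) : w ∈ D.Ω ↔ w D.basePt = D.basePt := by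
  constructor
  · rintro ⟨-, h⟩
    refine D.eq_of_simple_inner fun j => ?_
    obtain ⟨f, ⟨k, rfl⟩, hk⟩ := h.ge ⟨j, rfl⟩
    rw [D.simpleAffineRoot_basePt j, ← hk, actFn,
      show w⁻¹ (w D.basePt) = D.basePt from w.symm_apply_apply _, simpleAffineRoot_basePt]
  -- Fixing the base point preserves values there, and the simple affine roots are exactly those of
  -- value `baseVal`.
  · have key : ∀ u ∈ D.W, u D.basePt = D.basePt →
        ∀ j, ∃ k, actFn u (D.simpleAffineRoot j) = D.simpleAffineRoot k := by
      intro u hu h j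
      refine D.eq_simple_of_basePt (D.actFn_mem_affineRoots hu (D.simpleAffineRoot_mem j)) ?_
      have h' : u⁻¹ D.basePt = D.basePt := by
        conv_lhs => rw [← h]
        exact u.symm_apply_apply _
      rw [actFn, h', simpleAffineRoot_basePt]
    intro h
    refine ⟨hw, Set.Subset.antisymm ?_ ?_⟩
    · rintro _ ⟨_, ⟨j, rfl⟩, rfl⟩
      obtain ⟨k, hk⟩ := key w hw h j
      exact ⟨k, hk.symm⟩
    · rintro _ ⟨j, rfl⟩
      have h' : w⁻¹ D.basePt = D.basePt := by
        conv_lhs => rw [← h]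
        exact w.symm_apply_apply _
      obtain ⟨k, hk⟩ := key w⁻¹ (inv_mem hw) h' j
      exact ⟨_, ⟨k, rfl⟩, by rw [← hk, ← actFn_mul, mul_inv_cancel, actFn_one]⟩

theorem exists_actFn_simple {u : V ≃ᵃ[ℝ] V} (hu : u ∈ D.Ω) (j : D.Node) :
    ∃ k, actFn u (D.simpleAffineRoot j) = D.simpleAffineRoot k := by
  obtain ⟨k, hk⟩ := hu.2.le ⟨_, ⟨j, rfl⟩, rfl⟩
  exact ⟨k, hk.symm⟩

/-! ### Generation of `W` by `Ω` and the simple reflections -/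

/-- An element that maps the base point into the fundamental alcove fixes it. -/
theorem fixes_basePt {w : V ≃ᵃ[ℝ] V} (hw : w ∈ D.W)
    (h : ∀ j, 0 < D.simpleAffineRoot j (w D.basePt)) : w D.basePt = D.basePt := by
  have hδ := D.baseVal_pos
  have hpos : ∀ f ∈ D.affineRoots, 0 < f D.basePt → 0 < f (w D.basePt) := by
    intro f hf hf0
    obtain ⟨k, hk, rfl⟩ := D.exists_sum_of_pos hf hf0
    obtain ⟨j, hj⟩ : ∃ j, k j ≠ 0 := by
      by_contra! h0
      simp [h0] at hk
    rw [Finset.sum_apply]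
    refine Finset.sum_pos' (fun i _ => ?_) ⟨j, Finset.mem_univ j, ?_⟩
    · exact nsmul_nonneg (h i).le _
    · exact nsmul_pos (h j) hj
  -- If `w a_i` were negative, its negative would be positive at the base point, hence also at its
  -- image under `w`, where however it has the value `-baseVal`.
  have hw' : ∀ i, D.baseVal ≤ actFn w (D.simpleAffineRoot i) D.basePt := by
    intro i
    have hmem := D.actFn_mem_affineRoots hw (D.simpleAffineRoot_mem i)
    refine D.baseVal_le_of_pos hmem ?_
    by_contra! hle
    have hlt := lt_of_le_of_ne hle (D.affineRoot_basePt_ne_zero hmem)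
    have := hpos _ (D.neg_mem_affineRoots hmem) (by rw [Pi.neg_apply]; linarith)
    rw [Pi.neg_apply, actFn, show w⁻¹ (w D.basePt) = D.basePt from w.symm_apply_apply _,
      simpleAffineRoot_basePt] at this
    linarith
  refine D.eq_of_simple_inner fun j => ?_
  rw [simpleAffineRoot_basePt]
  have hmem := D.actFn_mem_affineRoots (inv_mem hw) (D.simpleAffineRoot_mem j)
  have hp : 0 < actFn w⁻¹ (D.simpleAffineRoot j) D.basePt := by
    rw [actFn_inv_apply]; exact h j
  have hle := D.baseVal_le_of_pos hmem hp
  rw [actFn_inv_apply] at hle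
  refine le_antisymm ?_ hle
  obtain ⟨k, hk, e⟩ := D.exists_sum_of_pos hmem hp
  rw [← actFn_inv_apply w (D.simpleAffineRoot j), e, sum_simple_basePt]
  -- Applying `w` to `w⁻¹ a_j = ∑ k_i a_i` gives `baseVal = ∑ k_i (w a_i)(basePt) ≥ (∑ k_i)
  -- baseVal`, the upper bound needed for `a_j` at the image of the base point.
  have e2 : D.simpleAffineRoot j D.basePt =
      ∑ i, k i * actFn w (D.simpleAffineRoot i) D.basePt := by
    have : D.simpleAffineRoot j = actFn w (actFn w⁻¹ (D.simpleAffineRoot j)) := by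
      rw [← actFn_mul, mul_inv_cancel, actFn_one]
    rw [this, e]
    simp [actFn, Finset.sum_apply]
  rw [simpleAffineRoot_basePt] at e2
  refine le_of_le_of_eq ?_ e2.symm
  push_cast
  rw [Finset.sum_mul]
  exact Finset.sum_le_sum fun i _ => mul_le_mul_of_nonneg_left (hw' i) (Nat.cast_nonneg _)

/-- Reflecting in a wall that separates a point from the base point brings it closer to it. -/
theorem norm_s_sub_basePt (j : D.Node) (x : V) :
    ‖D.s j x - D.basePt‖ ^ 2 = ‖x - D.basePt‖ ^ 2 + 4 / ⟪D.Φ.root (D.nodeIdx j),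
      D.Φ.root (D.nodeIdx j)⟫ * D.baseVal * D.simpleAffineRoot j x := by
  have h := (D.inner_root_self_pos (D.nodeIdx j)).ne'
  have e1 : ⟪D.Φ.root (D.nodeIdx j), x - D.basePt⟫ = D.simpleAffineRoot j x - D.baseVal := by
    rw [← D.simpleAffineRoot_basePt j, inner_sub_right]
    simp only [simpleAffineRoot, affineFn]
    ring
  have e2 : D.s j x - D.basePt = (x - D.basePt) - (D.simpleAffineRoot j x *
      (2 / ⟪D.Φ.root (D.nodeIdx j), D.Φ.root (D.nodeIdx j)⟫)) • D.Φ.root (D.nodeIdx j) := by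
    rw [s_apply, D.coroot_eq, smul_smul]
    abel
  rw [e2, norm_sub_sq_real, inner_smul_right, real_inner_comm _ (x - D.basePt), e1, norm_smul, mul_pow,
    ← real_inner_self_eq_norm_sq (D.Φ.root _), Real.norm_eq_abs, sq_abs]
  field_simp
  ring

/-- `W` is generated by `Ω` and the simple reflections. -/
theorem exists_prod_mul {w : V ≃ᵃ[ℝ] V} (hw : w ∈ D.W) :
    ∃ (l : List D.Node) (u : D.Ω), w = (l.map D.s).prod * u := by
  have hδ := D.baseVal_pos
  have hφ := D.inner_root_self_pos D.φ
  -- A uniform lower bound for the drop of the squared distance under a separating reflection: no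
  -- root is longer than `φ`, and a negative value at a point of the orbit is at most `-baseVal`. So
  -- the descent ends.
  set ε := 4 / ⟪D.Φ.root D.φ, D.Φ.root D.φ⟫ * D.baseVal * D.baseVal with hε
  have hε0 : 0 < ε := by positivity
  obtain ⟨n, hn⟩ := exists_nat_gt (‖w D.basePt - D.basePt‖ ^ 2 / ε)
  rw [div_lt_iff₀ hε0] at hn
  induction n generalizing w with
  | zero =>
    simp only [Nat.cast_zero, zero_mul] at hn
    exact absurd hn (not_lt.mpr (sq_nonneg _))
  | succ n ih =>
    by_cases hall : ∀ j, 0 < D.simpleAffineRoot j (w D.basePt)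
    · exact ⟨[], ⟨w, (D.mem_Ω_iff hw).mpr (D.fixes_basePt hw hall)⟩, by simp⟩
    · push Not at hall
      obtain ⟨j, hj⟩ := hall
      have hmem := D.neg_mem_affineRoots
        (D.actFn_mem_affineRoots (inv_mem hw) (D.simpleAffineRoot_mem j))
      have hne := D.affineRoot_basePt_ne_zero hmem
      have hle := D.baseVal_le_of_pos hmem (lt_of_le_of_ne
        (by rw [Pi.neg_apply, actFn_inv_apply]; linarith) hne.symm)
      rw [Pi.neg_apply, actFn_inv_apply] at hle
      have hdec := D.norm_s_sub_basePt j (w D.basePt)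
      have h1 : 4 / ⟪D.Φ.root D.φ, D.Φ.root D.φ⟫ ≤ 4 / ⟪D.Φ.root (D.nodeIdx j),
          D.Φ.root (D.nodeIdx j)⟫ :=
        div_le_div_of_nonneg_left (by norm_num) (D.inner_root_self_pos _) (D.inner_root_le_φ _)
      have h2 : ε ≤ 4 / ⟪D.Φ.root (D.nodeIdx j), D.Φ.root (D.nodeIdx j)⟫ * D.baseVal *
          -D.simpleAffineRoot j (w D.basePt) := by
        refine mul_le_mul (mul_le_mul_of_nonneg_right h1 hδ.le) hle hδ.le ?_
        have := D.inner_root_self_pos (D.nodeIdx j)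
        positivity
      obtain ⟨l, u, hl⟩ := ih (mul_mem (D.s_mem_W j) hw) (by
        change ‖D.s j (w D.basePt) - D.basePt‖ ^ 2 < _
        push_cast at hn
        linarith)
      refine ⟨j :: l, u, ?_⟩
      rw [List.map_cons, List.prod_cons, mul_assoc, ← hl, ← mul_assoc, s_mul_self, one_mul]

end AffineRoots

end AffineRootDatum

end

noncomputable section

/-! ### Groups generated by reflections, described by the signs of simple roots -/

section AltProd

open AffineRootDatum (altProd)

/-- The letter that continues the alternating word `j k j ⋯` of length `p`. -/
def altNext {J : Type*} (j k : J) : ℕ → J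
  | 0 => j
  | p + 1 => altNext k j p

/-- The alternating word `j k j ⋯` of length `p`. -/
def altList {J : Type*} (j k : J) : ℕ → List J
  | 0 => []
  | p + 1 => j :: altList k j p

theorem altNext_eq_or {J : Type*} (j k : J) (p : ℕ) : altNext j k p = j ∨ altNext j k p = k := by
  induction p generalizing j k with
  | zero => exact Or.inl rfl
  | succ p ih => exact (ih k j).symm

theorem eq_or_of_mem_altList {J : Type*} {j k x : J} {p : ℕ} (h : x ∈ altList j k p) :
    x = j ∨ x = k := by
  induction p generalizing j k with
  | zero => simp [altList] at h
  | succ p ih =>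
    rcases List.mem_cons.mp h with rfl | h
    · exact Or.inl rfl
    · exact (ih h).symm

theorem length_altList {J : Type*} (j k : J) (p : ℕ) : (altList j k p).length = p := by
  induction p generalizing j k with
  | zero => rfl
  | succ p ih => simp [altList, ih]

theorem prod_map_altList {J A : Type*} [Monoid A] (f : J → A) (j k : J) (p : ℕ) :
    ((altList j k p).map f).prod = altProd (f j) (f k) p := by
  induction p generalizing j k with
  | zero => rfl
  | succ p ih => simp [altList, ih, altProd]

theorem altProd_succ_right {J A : Type*} [Monoid A] (f : J → A) (j k : J) (p : ℕ) :
    altProd (f j) (f k) (p + 1) = altProd (f j) (f k) p * f (altNext j k p) := by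
  induction p generalizing j k with
  | zero => simp [altProd, altNext]
  | succ p ih => rw [altProd, ih, altProd, altNext, mul_assoc]

/-- For involutions the two alternating words of length `p` differ by `(a b)^p`, so they agree
exactly when this power is trivial. -/
theorem altProd_eq_pow_mul {G : Type*} [Group G] {a b : G} (ha : a * a = 1) (hb : b * b = 1)
    (p : ℕ) : altProd a b p = (a * b) ^ p * altProd b a p := by
  induction p generalizing a b with
  | zero => simp [altProd]
  | succ p ih =>
    have h2 : (b * a) ^ p * (a * b) ^ p = 1 := by
      have : b * a = (a * b)⁻¹ := by
        rw [mul_inv_rev, inv_eq_of_mul_eq_one_left ha, inv_eq_of_mul_eq_one_left hb]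
      rw [this, inv_pow, inv_mul_cancel]
    rw [altProd, altProd, pow_succ, mul_assoc, mul_assoc a b, ← mul_assoc b b, hb, one_mul,
      ← mul_assoc, mul_pow_mul]
    rw [ih (a := a) (b := b) ha hb, mul_assoc a, ← mul_assoc _ ((a * b) ^ p), h2, one_mul]

end AltProd

/-- A group `G` with generators `s j` and a complement `Ω`, together with the signs `pos g j` of
the images under `g` of the simple roots. -/
structure SignSystem (G J : Type*) [Group G] where
  s : J → G
  Ω : Subgroup G
  pos : G → J → Prop
  s_mul_self (j : J) : s j * s j = 1
  pos_one (j : J) : pos 1 j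
  pos_mul_s (g : G) (j : J) : pos (g * s j) j ↔ ¬ pos g j
  -- Geometrically, the only positive root that `s i` makes negative is the simple root of `i`, so
  -- `g` maps the simple root of `j` to it.
  conj {g : G} {i j : J} : pos g j → ¬ pos (s i * g) j → g * s j * g⁻¹ = s i
  pos_Ω {u : G} (hu : u ∈ Ω) (g : G) (j : J) : pos (u * g) j ↔ pos g j
  exists_eq (g : G) : ∃ (l : List J) (u : Ω), g = (l.map s).prod * u
  -- A positive root of the rank two system of `j` and `k` is a non-negative combination of its two
  -- simple roots, so its image under `g` inherits their common sign. This is the only trace of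
  -- linear algebra retained.
  pos_comb {j k i : J} (hi : i = j ∨ i = k) {l : List J} (hl : ∀ x ∈ l, x = j ∨ x = k)
    (h : pos (l.map s).prod i) {g : G} (hj : pos g j) (hk : pos g k) :
    pos (g * (l.map s).prod) i
  neg_comb {j k i : J} (hi : i = j ∨ i = k) {l : List J} (hl : ∀ x ∈ l, x = j ∨ x = k)
    (h : pos (l.map s).prod i) {g : G} (hj : ¬ pos g j) (hk : ¬ pos g k) :
    ¬ pos (g * (l.map s).prod) i

namespace SignSystem

open AffineRootDatum (altProd)

/-! ### Length, the exchange property and Matsumoto's theorem -/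

section Group

variable {G J : Type*} [Group G] (S : SignSystem G J)

/-- The product of the simple reflections in a word. -/
def word (l : List J) : G := (l.map S.s).prod

theorem word_cons (j : J) (l : List J) : S.word (j :: l) = S.s j * S.word l := by
  simp [word]

theorem word_append (l l' : List J) : S.word (l ++ l') = S.word l * S.word l' := by
  simp [word]

theorem word_altList (j k : J) (p : ℕ) : S.word (altList j k p) = altProd (S.s j) (S.s k) p :=
  prod_map_altList _ _ _ _

theorem s_inv (j : J) : (S.s j)⁻¹ = S.s j := inv_eq_of_mul_eq_one_left (S.s_mul_self j)

theorem s_mul_s_mul (j : J) (w : G) : S.s j * (S.s j * w) = w := by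
  rw [← mul_assoc, S.s_mul_self, one_mul]

theorem exists_length (g : G) : ∃ (n : ℕ) (l : List J) (u : S.Ω), l.length = n ∧
    g = S.word l * u := by
  obtain ⟨l, u, h⟩ := S.exists_eq g
  exact ⟨_, l, u, rfl, h⟩

open scoped Classical in
/-- The length of an element: the least number of simple reflections in a decomposition. -/
def len (g : G) : ℕ := Nat.find (S.exists_length g)

theorem exists_reduced (g : G) : ∃ (l : List J) (u : S.Ω), l.length = S.len g ∧
    g = S.word l * u := by
  classical
  exact Nat.find_spec (S.exists_length g)

theorem len_le (l : List J) (u : S.Ω) : S.len (S.word l * u) ≤ l.length := by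
  classical
  exact Nat.find_min' (S.exists_length _) ⟨l, u, rfl, rfl⟩

theorem len_s_mul_le (j : J) (w : G) : S.len (S.s j * w) ≤ S.len w + 1 := by
  obtain ⟨l, u, hl, rfl⟩ := S.exists_reduced w
  rw [← mul_assoc, ← word_cons, ← hl]
  exact S.len_le (j :: l) u

theorem len_le_s_mul (j : J) (w : G) : S.len w ≤ S.len (S.s j * w) + 1 := by
  have := S.len_s_mul_le j (S.s j * w)
  rwa [s_mul_s_mul] at this

/-- As the letters of the word are applied from the left, the root becomes negative at some letter
`i`. By `conj` the reflection in the root reached just before is `s i`, and this letter is deleted.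
-/
theorem exchange {l : List J} {g : G} {j : J} (hg : S.pos g j)
    (h : ¬ S.pos ((S.word l)⁻¹ * g) j) :
    ∃ l' : List J, l'.length + 1 = l.length ∧ g * S.s j * g⁻¹ * S.word l = S.word l' := by
  induction l generalizing g with
  | nil => simp [word, hg] at h
  | cons i l ih =>
    by_cases hi : S.pos (S.s i * g) j
    · obtain ⟨l', hl', e⟩ := ih hi (by
        rwa [word_cons, mul_inv_rev, s_inv, mul_assoc] at h)
      refine ⟨i :: l', by simp [hl'], ?_⟩
      rw [word_cons, word_cons, ← e, mul_inv_rev, s_inv]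
      simp only [mul_assoc, s_mul_s_mul]
    · refine ⟨l, by simp, ?_⟩
      rw [S.conj hg hi, word_cons, s_mul_s_mul]

/-- The exchange property with `g = 1` removes one letter from a reduced word of `w` and produces `s
j * w`; elements of `Ω` do not affect signs. -/
theorem len_of_not_pos {w : G} {j : J} (h : ¬ S.pos w⁻¹ j) :
    S.len w = S.len (S.s j * w) + 1 := by
  refine le_antisymm (S.len_le_s_mul j w) ?_
  obtain ⟨l, u, hl, rfl⟩ := S.exists_reduced w
  rw [mul_inv_rev, S.pos_Ω (inv_mem u.2), ← mul_one (S.word l)⁻¹] at h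
  obtain ⟨l', hl', e⟩ := S.exchange (S.pos_one j) h
  rw [one_mul, inv_one, mul_one] at e
  rw [← hl, ← mul_assoc, e, ← hl']
  exact Nat.succ_le_succ (S.len_le l' u)

theorem pos_inv_s_mul (w : G) (j : J) : S.pos (S.s j * w)⁻¹ j ↔ ¬ S.pos w⁻¹ j := by
  rw [mul_inv_rev, s_inv, pos_mul_s]

theorem len_of_pos {w : G} {j : J} (h : S.pos w⁻¹ j) :
    S.len (S.s j * w) = S.len w + 1 := by
  have := S.len_of_not_pos (w := S.s j * w) (j := j) (by rw [pos_inv_s_mul]; exact not_not.mpr h)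
  rwa [s_mul_s_mul] at this

theorem pow_comm_ne_one {j k : J} {n : ℕ} (h : (S.s j * S.s k) ^ n ≠ 1) :
    (S.s k * S.s j) ^ n ≠ 1 := by
  have : S.s k * S.s j = (S.s j * S.s k)⁻¹ := by rw [mul_inv_rev, s_inv, s_inv]
  rwa [this, inv_pow, inv_ne_one]

/-- The roots in the rank two system of `j` and `k` met along an alternating word. -/
theorem pos_altProd {j k : J} {p : ℕ} (h : ∀ n, 0 < n → n ≤ p → (S.s j * S.s k) ^ n ≠ 1) :
    S.pos (altProd (S.s j) (S.s k) p) (altNext j k p) := by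
  induction p generalizing j k with
  | zero => exact S.pos_one j
  | succ p ih =>
    have h1 := ih (j := k) (k := j) fun n hn hnp => S.pow_comm_ne_one (h n hn (by omega))
    by_contra hneg
    -- A sign change would identify the two alternating words of length `p + 1`, that is, make `(s j
    -- * s k) ^ (p + 1)` trivial.
    have h2 := S.conj h1 hneg
    rw [mul_inv_eq_iff_eq_mul, ← altProd_succ_right] at h2
    refine h (p + 1) (by omega) le_rfl ?_
    have h3 := altProd_eq_pow_mul (S.s_mul_self j) (S.s_mul_self k) (p + 1)
    rw [h2] at h3
    exact (mul_eq_right.mp h3.symm)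

theorem pos_mul_altProd {j k : J} {p : ℕ} (h : ∀ n, 0 < n → n ≤ p → (S.s j * S.s k) ^ n ≠ 1)
    {g : G} (hj : S.pos g j) (hk : S.pos g k) :
    S.pos (g * altProd (S.s j) (S.s k) p) (altNext j k p) := by
  have h1 := S.pos_altProd h
  rw [← word_altList] at h1 ⊢
  exact S.pos_comb (altNext_eq_or j k p) (fun x => eq_or_of_mem_altList) h1 hj hk

theorem not_pos_mul_altProd {j k : J} {p : ℕ}
    (h : ∀ n, 0 < n → n ≤ p → (S.s j * S.s k) ^ n ≠ 1)
    {g : G} (hj : ¬ S.pos g j) (hk : ¬ S.pos g k) :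
    ¬ S.pos (g * altProd (S.s j) (S.s k) p) (altNext j k p) := by
  have h1 := S.pos_altProd h
  rw [← word_altList] at h1 ⊢
  exact S.neg_comb (altNext_eq_or j k p) (fun x => eq_or_of_mem_altList) h1 hj hk

theorem pow_ne_one_of_lt {j k : J} {p : ℕ}
    (hp : p < orderOf (S.s j * S.s k) ∨ orderOf (S.s j * S.s k) = 0) :
    ∀ n, 0 < n → n ≤ p → (S.s j * S.s k) ^ n ≠ 1 := by
  intro n hn hnp h1
  rcases hp with hp | hp
  · exact absurd (orderOf_le_of_pow_eq_one hn h1) (by omega)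
  · exact (orderOf_eq_zero_iff'.mp hp) n hn h1

theorem altProd_comm (j k : J) :
    altProd (S.s j) (S.s k) (orderOf (S.s j * S.s k)) =
      altProd (S.s k) (S.s j) (orderOf (S.s j * S.s k)) := by
  rw [altProd_eq_pow_mul (S.s_mul_self j) (S.s_mul_self k), pow_orderOf_eq_one, one_mul]

theorem orderOf_comm (j k : J) : orderOf (S.s k * S.s j) = orderOf (S.s j * S.s k) := by
  have : S.s k * S.s j = (S.s j * S.s k)⁻¹ := by rw [mul_inv_rev, s_inv, s_inv]
  rw [this, orderOf_inv]

/-- When `j` and `k` are both left descents, stripping letters alternately from the left shortens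
`w` at every step, up to the order of `s j * s k`, or indefinitely if that order is infinite. -/
theorem len_altProd_inv_mul {w : G} {j k : J} (hj : ¬ S.pos w⁻¹ j) (hk : ¬ S.pos w⁻¹ k) {p : ℕ}
    (hp : p ≤ orderOf (S.s j * S.s k) ∨ orderOf (S.s j * S.s k) = 0) :
    S.len ((altProd (S.s j) (S.s k) p)⁻¹ * w) + p = S.len w := by
  induction p with
  | zero => simp [altProd]
  | succ p ih =>
    have ih := ih (hp.imp (by omega) id)
    have h1 := S.not_pos_mul_altProd
      (S.pow_ne_one_of_lt (p := p) (hp.imp (by omega) id)) hj hk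
    have h2 := S.len_of_not_pos (w := (altProd (S.s j) (S.s k) p)⁻¹ * w)
      (by rw [mul_inv_rev, inv_inv]; exact h1)
    rw [altProd_succ_right, mul_inv_rev, s_inv, mul_assoc]
    omega

/-- If `j` and `k` are both left descents of `w`, then `w` is the product of the longest element of
the dihedral group of `s j` and `s k` and an element `v`, and the lengths add up. -/
theorem exists_dihedral {w : G} {j k : J} (hj : ¬ S.pos w⁻¹ j) (hk : ¬ S.pos w⁻¹ k) :
    orderOf (S.s j * S.s k) ≠ 0 ∧ ∃ v,
      w = altProd (S.s j) (S.s k) (orderOf (S.s j * S.s k)) * v ∧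
      S.len w = orderOf (S.s j * S.s k) + S.len v := by
  constructor
  · intro h0
    -- With infinite order one could strip more letters than `w` has.
    have := S.len_altProd_inv_mul hj hk (p := S.len w + 1) (Or.inr h0)
    omega
  · refine ⟨(altProd (S.s j) (S.s k) (orderOf (S.s j * S.s k)))⁻¹ * w, by group, ?_⟩
    have := S.len_altProd_inv_mul hj hk (Or.inl le_rfl)
    omega

/-- **Matsumoto's theorem**: products along reduced words of elements that satisfy the braid
relations depend only on the element of the group. -/
theorem matsumoto {A : Type*} [Monoid A] (t : J → A) (τ : S.Ω → A)
    (hbraid : ∀ j k, j ≠ k → altProd (t j) (t k) (orderOf (S.s j * S.s k)) =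
      altProd (t k) (t j) (orderOf (S.s j * S.s k)))
    {l l' : List J} {u u' : S.Ω} (h : S.word l * u = S.word l' * u')
    (hl : l.length = S.len (S.word l * u)) (hl' : l'.length = S.len (S.word l * u)) :
    (l.map t).prod * τ u = (l'.map t).prod * τ u' := by
  obtain ⟨n, hn⟩ : ∃ n, l.length = n := ⟨_, rfl⟩
  induction n generalizing l l' u u' with
  | zero =>
    have hn' : l'.length = 0 := by omega
    rw [List.length_eq_zero_iff] at hn hn'
    subst hn hn'
    have : u = u' := Subtype.ext (by simpa [word] using h)
    rw [this]
  | succ n ih =>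
    obtain ⟨w, hw⟩ : ∃ w, S.word l * u = w := ⟨_, rfl⟩
    have key : ∀ (j : J) (l1 l2 : List J) (u1 u2 : S.Ω), S.word (j :: l1) * u1 = w →
        S.word (j :: l2) * u2 = w → l1.length = n → l2.length = n → S.len w = n + 1 →
        ((j :: l1).map t).prod * τ u1 = ((j :: l2).map t).prod * τ u2 := by
      intro j l1 l2 u1 u2 h1 h2 hl1 hl2 hlen
      rw [List.map_cons, List.map_cons, List.prod_cons, List.prod_cons, mul_assoc, mul_assoc]
      have e1 : S.word l1 * u1 = S.word l2 * u2 := by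
        rw [← h2, word_cons, word_cons, mul_assoc, mul_assoc] at h1
        exact mul_left_cancel h1
      have hle := S.len_le l1 u1
      have hge := S.len_s_mul_le j (S.word l1 * u1)
      rw [← mul_assoc, ← word_cons, h1] at hge
      rw [ih e1 (by omega) (by omega) hl1]
    have hdesc : ∀ (j : J) (l1 : List J) (u1 : S.Ω), S.word (j :: l1) * u1 = w →
        l1.length = n → S.len w = n + 1 → ¬ S.pos w⁻¹ j := by
      intro j l1 u1 h1 hl1 hlen hpos
      have h2 := S.len_of_pos hpos
      have h3 : S.s j * w = S.word l1 * u1 := by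
        rw [← h1, word_cons, mul_assoc, s_mul_s_mul]
      have h4 := S.len_le l1 u1
      rw [← h3] at h4
      omega
    rw [hw] at h hl hl'
    rcases l with _ | ⟨j, l1⟩
    · simp at hn
    rcases l' with _ | ⟨k, l2⟩
    · simp at hl'; omega
    have hl1 : l1.length = n := by simpa using hn
    have hl2 : l2.length = n := by simp at hl hl'; omega
    have hlen : S.len w = n + 1 := by omega
    by_cases hjk : j = k
    · subst hjk
      exact key j l1 l2 u u' hw h.symm hl1 hl2 hlen
    -- Two further reduced words of `w`, starting with `j k j ⋯` and `k j k ⋯` and continuing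
    -- equally, interpolate: each shares its first letter with one of the given words, and the braid
    -- relation joins them.
    · obtain ⟨h0, v, hv, hvl⟩ := S.exists_dihedral (hdesc j l1 u hw hl1 hlen)
        (hdesc k l2 u' h.symm hl2 hlen)
      obtain ⟨m, hm⟩ := Nat.exists_eq_succ_of_ne_zero h0
      obtain ⟨lv, uv, hlv, hv'⟩ := S.exists_reduced v
      have e1 := key j l1 (altList k j m ++ lv) u uv hw (by
        change S.word (altList j k (m + 1) ++ lv) * uv = w
        rw [word_append, word_altList, hv, hv', mul_assoc, hm]) hl1
        (by rw [List.length_append, length_altList]; omega) hlen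
      have e2 := key k l2 (altList j k m ++ lv) u' uv h.symm (by
        change S.word (altList k j (m + 1) ++ lv) * uv = w
        rw [word_append, word_altList, hv, hv', mul_assoc, ← Nat.succ_eq_add_one, ← hm,
          S.altProd_comm j k]) hl2
        (by rw [List.length_append, length_altList]; omega) hlen
      have b := hbraid j k hjk
      rw [hm, ← prod_map_altList t, ← prod_map_altList t] at b
      rw [e1, e2]
      change ((altList j k (m + 1) ++ lv).map t).prod * _ =
        ((altList k j (m + 1) ++ lv).map t).prod * _
      rw [List.map_append, List.map_append, List.prod_append, List.prod_append, b]

end Group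

end SignSystem

end

noncomputable section

namespace AffineRootDatum

section SignSystem

variable {ι V : Type*} [NormedAddCommGroup V] [InnerProductSpace ℝ V] (D : AffineRootDatum ι V)

/-! ### Signs of affine roots under the extended affine Weyl group -/

/-- The image under `g` of a simple affine root. -/
def rootImage (g : D.W) (j : D.Node) : V → ℝ := actFn (g : V ≃ᵃ[ℝ] V) (D.simpleAffineRoot j)

theorem rootImage_mem (g : D.W) (j : D.Node) : D.rootImage g j ∈ D.affineRoots :=
  D.actFn_mem_affineRoots g.2 (D.simpleAffineRoot_mem j)

/-- The simple reflection as an element of `W`. -/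
def sW (j : D.Node) : D.W := ⟨D.s j, D.s_mem_W j⟩

theorem coe_prod_sW (l : List D.Node) :
    (((l.map D.sW).prod : D.W) : V ≃ᵃ[ℝ] V) = (l.map D.s).prod := by
  induction l with
  | nil => rfl
  | cons j l ih => rw [List.map_cons, List.prod_cons, Subgroup.coe_mul, ih]; simp [sW]

theorem rootImage_neg_of_not_pos {g : D.W} {j : D.Node} (h : ¬ 0 < D.rootImage g j D.basePt) :
    D.rootImage g j D.basePt < 0 :=
  lt_of_le_of_ne (not_lt.mp h) (D.affineRoot_basePt_ne_zero (D.rootImage_mem g j))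

theorem actFn_sum (w : V ≃ᵃ[ℝ] V) (z : D.Node → ℤ) :
    actFn w (∑ i, z i • D.simpleAffineRoot i) = ∑ i, z i • actFn w (D.simpleAffineRoot i) := by
  funext x
  simp only [actFn, Finset.sum_apply, Pi.smul_apply]

/-- Each `s_y` changes an affine root by an integral multiple of `a_y`, so words in `j` and `k`
preserve the integral span of `a_j` and `a_k`. -/
theorem exists_rootImage_eq_sum {j k i : D.Node} (hi : i = j ∨ i = k) {l : List D.Node}
    (hl : ∀ x ∈ l, x = j ∨ x = k) : ∃ z : D.Node → ℤ, (∀ x, x ≠ j → x ≠ k → z x = 0) ∧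
      D.rootImage (l.map D.sW).prod i = ∑ x, z x • D.simpleAffineRoot x := by
  classical
  induction l with
  | nil =>
    refine ⟨Pi.single i 1, fun x hj hk => ?_, ?_⟩
    · rw [Pi.single_eq_of_ne]
      rintro rfl
      tauto
    · simp only [List.map_nil, List.prod_nil, Pi.single_apply, ite_smul, one_smul, zero_smul,
        Finset.sum_ite_eq', Finset.mem_univ, if_true]
      rfl
  | cons y l ih =>
    obtain ⟨z, hz, e⟩ := ih fun x hx => hl x (List.mem_cons_of_mem _ hx)
    have hy := hl y List.mem_cons_self
    choose n hn using fun x => D.exists_actFn_s (D.simpleAffineRoot_mem x) y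
    refine ⟨z - Pi.single y (∑ x, z x * n x), fun x hj hk => ?_, ?_⟩
    · rw [Pi.sub_apply, hz x hj hk, Pi.single_eq_of_ne, sub_zero]
      rintro rfl
      tauto
    · have e1 : D.rootImage ((y :: l).map D.sW).prod i =
          actFn (D.s y) (D.rootImage (l.map D.sW).prod i) := by
        rw [List.map_cons, List.prod_cons, rootImage, rootImage, Subgroup.coe_mul, actFn_mul]
        rfl
      rw [e1, e, actFn_sum]
      simp only [hn, Pi.sub_apply, sub_smul, smul_sub, Finset.sum_sub_distrib, Pi.single_apply,
        ite_smul, zero_smul, Finset.sum_ite_eq', Finset.mem_univ, if_true, Finset.sum_smul,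
        smul_smul]

/-- By independence, the integral expansion in `a_j, a_k` coincides with the non-negative expansion
of a positive affine root. Applying `g` to it yields both `pos_comb` and `neg_comb`. -/
theorem exists_rootImage_mul {j k i : D.Node} (hi : i = j ∨ i = k) {l : List D.Node}
    (hl : ∀ x ∈ l, x = j ∨ x = k) (h : 0 < D.rootImage (l.map D.sW).prod i D.basePt) :
    ∃ n : D.Node → ℕ, (∀ x, x ≠ j → x ≠ k → n x = 0) ∧ (∃ x, n x ≠ 0) ∧
      ∀ g : D.W, D.rootImage (g * (l.map D.sW).prod) i D.basePt =
        ∑ x, n x • D.rootImage g x D.basePt := by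
  obtain ⟨z, hz, e⟩ := D.exists_rootImage_eq_sum hi hl
  obtain ⟨n, hn, e'⟩ := D.exists_sum_of_pos (D.rootImage_mem _ _) h
  have hzn : z = fun x => (n x : ℤ) := D.sum_simple_inj (by
    rw [← e, e']
    simp)
  refine ⟨n, fun x hj hk => ?_, ?_, fun g => ?_⟩
  · have := hz x hj hk
    simp only [hzn] at this
    exact_mod_cast this
  · by_contra! h0
    simp [h0] at hn
  · have : D.rootImage (g * (l.map D.sW).prod) i =
        actFn (g : V ≃ᵃ[ℝ] V) (D.rootImage (l.map D.sW).prod i) := by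
      rw [rootImage, rootImage, Subgroup.coe_mul, actFn_mul]
    rw [this, e, actFn_sum, hzn]
    simp [rootImage, Finset.sum_apply]

/-- The sign system of the extended affine Weyl group. -/
def signSystem : SignSystem D.W D.Node where
  s := D.sW
  Ω := D.Ω.subgroupOf D.W
  pos g j := 0 < D.rootImage g j D.basePt
  s_mul_self j := Subtype.ext (D.s_mul_self j)
  pos_one j := by
    change 0 < D.simpleAffineRoot j D.basePt
    rw [simpleAffineRoot_basePt]
    exact D.baseVal_pos
  pos_mul_s g j := by
    have e : D.rootImage (g * D.sW j) j = -D.rootImage g j := by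
      rw [rootImage, Subgroup.coe_mul, actFn_mul, sW, actFn_s_simple]
      rfl
    have h := D.affineRoot_basePt_ne_zero (D.rootImage_mem g j)
    rw [e, Pi.neg_apply, neg_pos, not_lt]
    exact ⟨le_of_lt, fun h' => lt_of_le_of_ne h' h⟩
  conj {g i j} h h' := by
    have h2 := D.rootImage_neg_of_not_pos h'
    rw [rootImage, Subgroup.coe_mul, actFn_mul] at h2
    exact Subtype.ext (D.conj_s g.2 (D.eq_simple_of_sign_change (D.rootImage_mem g j) h h2))
  pos_Ω {u} hu g j := by
    have hu' := (D.mem_Ω_iff (inv_mem u.2)).mp (inv_mem (Subgroup.mem_subgroupOf.mp hu))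
    rw [rootImage, Subgroup.coe_mul, actFn_mul, actFn, hu']
    rfl
  exists_eq g := by
    obtain ⟨l, u, h⟩ := D.exists_prod_mul g.2
    refine ⟨l, ⟨⟨u, u.2.1⟩, u.2⟩, Subtype.ext ?_⟩
    rw [h, Subgroup.coe_mul, coe_prod_sW]
  pos_comb {j k i} hi l hl h g hj hk := by
    obtain ⟨n, h0, ⟨y, hy⟩, e⟩ := D.exists_rootImage_mul hi hl h
    rw [e]
    have hpos : ∀ x, n x ≠ 0 → 0 < D.rootImage g x D.basePt := fun x hx => by
      by_cases hxj : x = j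
      · exact hxj ▸ hj
      · by_cases hxk : x = k
        · exact hxk ▸ hk
        · exact absurd (h0 x hxj hxk) hx
    refine Finset.sum_pos' (fun x _ => ?_) ⟨y, Finset.mem_univ y, nsmul_pos (hpos y hy) hy⟩
    by_cases hx : n x = 0
    · rw [hx, zero_smul]
    · exact (nsmul_pos (hpos x hx) hx).le
  neg_comb {j k i} hi l hl h g hj hk := by
    obtain ⟨n, h0, -, e⟩ := D.exists_rootImage_mul hi hl h
    rw [e, not_lt]
    refine Finset.sum_nonpos fun x _ => ?_
    by_cases hxj : x = j
    · exact smul_nonpos_of_nonneg_of_nonpos (Nat.zero_le _) (hxj ▸ not_lt.mp hj)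
    · by_cases hxk : x = k
      · exact smul_nonpos_of_nonneg_of_nonpos (Nat.zero_le _) (hxk ▸ not_lt.mp hk)
      · rw [h0 x hxj hxk, zero_smul]

theorem signSystem_s (j : D.Node) : D.signSystem.s j = D.sW j := rfl

theorem orderOf_sW_mul (j k : D.Node) :
    orderOf (D.sW j * D.sW k) = orderOf (D.s j * D.s k) :=
  orderOf_injective D.W.subtype D.W.subtype_injective (D.sW j * D.sW k) ▸ rfl

/-! ### Rank two -/

/-- The affine root `s_k a_j` has coefficient `1` at `a_j`, hence no negative coefficient at `a_k`.
This treats the node `0` like all others. -/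
theorem exists_cartan {j k : D.Node} (hjk : j ≠ k) : ∃ n : ℕ,
    ⟪D.Φ.root (D.nodeIdx j), D.Φ.coroot (D.nodeIdx k)⟫ = -n := by
  classical
  obtain ⟨z, hz⟩ := D.exists_inner_coroot (D.nodeIdx j) (D.nodeIdx k)
  have e : actFn (D.s k) (D.simpleAffineRoot j) =
      ∑ i, (Pi.single j 1 - Pi.single k z : D.Node → ℤ) i • D.simpleAffineRoot i := by
    simp only [Pi.sub_apply, sub_smul, Pi.single_apply, ite_smul, one_smul, zero_smul,
      Finset.sum_sub_distrib, Finset.sum_ite_eq', Finset.mem_univ, if_true]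
    funext x
    rw [actFn, s_inv]
    have := D.affineFn_s (D.Φ.root (D.nodeIdx j)) (D.nodeConst j) k x
    rw [hz] at this
    simpa [simpleAffineRoot] using this
  obtain ⟨n, hn | hn⟩ := D.exists_sum_simple
    (D.actFn_mem_affineRoots (D.s_mem_W k) (D.simpleAffineRoot_mem j))
  · have h := D.sum_simple_inj (k := Pi.single j 1 - Pi.single k z) (l := fun i => (n i : ℤ))
      (by rw [← e, hn]; simp)
    have hk := congrFun h k
    rw [Pi.sub_apply, Pi.single_eq_same, Pi.single_eq_of_ne hjk.symm, zero_sub] at hk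
    exact ⟨n k, by rw [hz, eq_neg_iff_add_eq_zero, ← Int.cast_natCast, ← hk]; simp⟩
  · have h := D.sum_simple_inj (k := Pi.single j 1 - Pi.single k z) (l := fun i => -(n i : ℤ))
      (by rw [← e, hn]; simp)
    have hj := congrFun h j
    rw [Pi.sub_apply, Pi.single_eq_same, Pi.single_eq_of_ne hjk, sub_zero] at hj
    omega

theorem simpleAffineRoot_s_of {j k : D.Node} {n : ℕ}
    (h : ⟪D.Φ.root (D.nodeIdx j), D.Φ.coroot (D.nodeIdx k)⟫ = -n) (x : V) :
    D.simpleAffineRoot j (D.s k x) = D.simpleAffineRoot j x + n * D.simpleAffineRoot k x := by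
  have := D.affineFn_s (D.Φ.root (D.nodeIdx j)) (D.nodeConst j) k x
  rw [h] at this
  simp only [simpleAffineRoot] at this ⊢
  rw [this]
  ring

/-- The order of a product of two simple reflections, in terms of the Cartan integers. -/
theorem orderOf_cases {j k : D.Node} (hjk : j ≠ k) : ∃ b c : ℕ,
    ⟪D.Φ.root (D.nodeIdx k), D.Φ.coroot (D.nodeIdx j)⟫ = -b ∧
    ⟪D.Φ.root (D.nodeIdx j), D.Φ.coroot (D.nodeIdx k)⟫ = -c ∧
    ((b = 0 ∧ c = 0 ∧ orderOf (D.s j * D.s k) = 2) ∨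
     (b = 1 ∧ c = 1 ∧ orderOf (D.s j * D.s k) = 3) ∨
     (b = 1 ∧ c = 2 ∧ orderOf (D.s j * D.s k) = 4) ∨
     (b = 2 ∧ c = 1 ∧ orderOf (D.s j * D.s k) = 4) ∨
     (b = 1 ∧ c = 3 ∧ orderOf (D.s j * D.s k) = 6) ∨
     (b = 3 ∧ c = 1 ∧ orderOf (D.s j * D.s k) = 6) ∨
     orderOf (D.s j * D.s k) = 0) := by
  obtain ⟨b, hb⟩ := D.exists_cartan hjk.symm
  obtain ⟨c, hc⟩ := D.exists_cartan hjk
  refine ⟨b, c, hb, hc, ?_⟩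
  have hδ := D.baseVal_pos
  have vj := D.simpleAffineRoot_basePt j
  have vk := D.simpleAffineRoot_basePt k
  have jj := D.simpleAffineRoot_s j
  have kk := D.simpleAffineRoot_s k
  have jk := D.simpleAffineRoot_s_of hc
  have kj := D.simpleAffineRoot_s_of hb
  have hmul : ∀ (g h : V ≃ᵃ[ℝ] V) x, (g * h) x = g (h x) := fun _ _ _ => rfl
  -- The dihedral orbit of `x` is followed in the coordinates `A, B` along the two coroots, so that
  -- powers of `s_j s_k` become explicit polynomial identities.
  have sj : ∀ x A B, D.s j (x - A • D.Φ.coroot (D.nodeIdx j) - B • D.Φ.coroot (D.nodeIdx k)) =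
      x - (D.simpleAffineRoot j x - A + c * B) • D.Φ.coroot (D.nodeIdx j) -
        B • D.Φ.coroot (D.nodeIdx k) := by
    intro x A B
    have : D.simpleAffineRoot j (x - A • D.Φ.coroot (D.nodeIdx j) -
        B • D.Φ.coroot (D.nodeIdx k)) = D.simpleAffineRoot j x - 2 * A + c * B := by
      simp only [simpleAffineRoot, affineFn, inner_sub_right, inner_smul_right, hc,
        inner_root_coroot]
      ring
    rw [s_apply, this]
    module
  have sk : ∀ x A B, D.s k (x - A • D.Φ.coroot (D.nodeIdx j) - B • D.Φ.coroot (D.nodeIdx k)) =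
      x - A • D.Φ.coroot (D.nodeIdx j) -
        (D.simpleAffineRoot k x - B + b * A) • D.Φ.coroot (D.nodeIdx k) := by
    intro x A B
    have : D.simpleAffineRoot k (x - A • D.Φ.coroot (D.nodeIdx j) -
        B • D.Φ.coroot (D.nodeIdx k)) = D.simpleAffineRoot k x - 2 * B + b * A := by
      simp only [simpleAffineRoot, affineFn, inner_sub_right, inner_smul_right, hb,
        inner_root_coroot]
      ring
    rw [s_apply, this]
    module
  have heq : ∀ g : V ≃ᵃ[ℝ] V, (∀ x : V, g (x - (0 : ℝ) • D.Φ.coroot (D.nodeIdx j) -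
      (0 : ℝ) • D.Φ.coroot (D.nodeIdx k)) = x - (0 : ℝ) • D.Φ.coroot (D.nodeIdx j) -
      (0 : ℝ) • D.Φ.coroot (D.nodeIdx k)) → g = 1 := by
    intro g hg
    ext x
    simpa using hg x
  -- The unequal weights `7` and `1` only serve to detect with one number that the base point has
  -- moved, for each power that has to be excluded below.
  have hne : ∀ g : V ≃ᵃ[ℝ] V, 7 * D.simpleAffineRoot j (g D.basePt) +
      D.simpleAffineRoot k (g D.basePt) ≠ 8 * D.baseVal → g ≠ 1 := by
    rintro g hg rfl
    refine hg ?_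
    change 7 * D.simpleAffineRoot j D.basePt + D.simpleAffineRoot k D.basePt = _
    rw [vj, vk]
    ring
  obtain ⟨p, q, hp, hq, -, -, hmem⟩ := D.exists_pairings (D.nodeIdx k) (D.nodeIdx j)
  have hp' : p = -(b : ℤ) := by rw [hb] at hp; exact_mod_cast hp.symm
  have hq' : q = -(c : ℤ) := by rw [hc] at hq; exact_mod_cast hq.symm
  subst hp' hq'
  have hcases : (b = 0 ∧ c = 0) ∨ (b = 1 ∧ c = 1) ∨ (b = 1 ∧ c = 2) ∨ (b = 2 ∧ c = 1) ∨
      (b = 1 ∧ c = 3) ∨ (b = 3 ∧ c = 1) ∨ (b = 2 ∧ c = 2) := by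
    simp only [Set.mem_insert_iff, Set.mem_singleton_iff, Prod.mk.injEq] at hmem
    omega
  rcases hcases with ⟨rfl, rfl⟩ | ⟨rfl, rfl⟩ | ⟨rfl, rfl⟩ | ⟨rfl, rfl⟩ | ⟨rfl, rfl⟩ |
    ⟨rfl, rfl⟩ | ⟨rfl, rfl⟩
  · have : orderOf (D.s j * D.s k) = 2 := by
      refine (orderOf_eq_iff (by norm_num)).mpr ⟨heq _ fun x => ?_, fun m hm hm0 => hne _ ?_⟩
      · simp only [pow_succ, pow_zero, one_mul, hmul, sj, sk]
        push_cast
        congr 3 <;> ring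
      · interval_cases m <;>
        simp only [pow_succ, pow_zero, one_mul, hmul, jj, kk, jk, kj, vj, vk] <;>
        intro h <;> norm_num at h <;> linarith
    simp [this]
  · have : orderOf (D.s j * D.s k) = 3 := by
      refine (orderOf_eq_iff (by norm_num)).mpr ⟨heq _ fun x => ?_, fun m hm hm0 => hne _ ?_⟩
      · simp only [pow_succ, pow_zero, one_mul, hmul, sj, sk]
        push_cast
        congr 3 <;> ring
      · interval_cases m <;>
        simp only [pow_succ, pow_zero, one_mul, hmul, jj, kk, jk, kj, vj, vk] <;>
        intro h <;> norm_num at h <;> linarith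
    simp [this]
  · have : orderOf (D.s j * D.s k) = 4 := by
      refine (orderOf_eq_iff (by norm_num)).mpr ⟨heq _ fun x => ?_, fun m hm hm0 => hne _ ?_⟩
      · simp only [pow_succ, pow_zero, one_mul, hmul, sj, sk]
        push_cast
        congr 3 <;> ring
      · interval_cases m <;>
        simp only [pow_succ, pow_zero, one_mul, hmul, jj, kk, jk, kj, vj, vk] <;>
        intro h <;> norm_num at h <;> linarith
    simp [this]
  · have : orderOf (D.s j * D.s k) = 4 := by
      refine (orderOf_eq_iff (by norm_num)).mpr ⟨heq _ fun x => ?_, fun m hm hm0 => hne _ ?_⟩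
      · simp only [pow_succ, pow_zero, one_mul, hmul, sj, sk]
        push_cast
        congr 3 <;> ring
      · interval_cases m <;>
        simp only [pow_succ, pow_zero, one_mul, hmul, jj, kk, jk, kj, vj, vk] <;>
        intro h <;> norm_num at h <;> linarith
    simp [this]
  · have : orderOf (D.s j * D.s k) = 6 := by
      refine (orderOf_eq_iff (by norm_num)).mpr ⟨heq _ fun x => ?_, fun m hm hm0 => hne _ ?_⟩
      · simp only [pow_succ, pow_zero, one_mul, hmul, sj, sk]
        push_cast
        congr 3 <;> ring
      · interval_cases m <;>
        simp only [pow_succ, pow_zero, one_mul, hmul, jj, kk, jk, kj, vj, vk] <;>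
        intro h <;> norm_num at h <;> linarith
    simp [this]
  · have : orderOf (D.s j * D.s k) = 6 := by
      refine (orderOf_eq_iff (by norm_num)).mpr ⟨heq _ fun x => ?_, fun m hm hm0 => hne _ ?_⟩
      · simp only [pow_succ, pow_zero, one_mul, hmul, sj, sk]
        push_cast
        congr 3 <;> ring
      · interval_cases m <;>
        simp only [pow_succ, pow_zero, one_mul, hmul, jj, kk, jk, kj, vj, vk] <;>
        intro h <;> norm_num at h <;> linarith
    simp [this]
  · refine Or.inr (Or.inr (Or.inr (Or.inr (Or.inr (Or.inr ?_)))))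
    -- For Cartan integers `-2, -2` the product moves the base point off linearly, so its order is
    -- infinite.
    have key : ∀ n : ℕ, D.simpleAffineRoot j (((D.s j * D.s k) ^ n) D.basePt) =
        (1 - 4 * n) * D.baseVal ∧ D.simpleAffineRoot k (((D.s j * D.s k) ^ n) D.basePt) =
        (1 + 4 * n) * D.baseVal := by
      intro n
      induction n with
      | zero => simp [vj, vk]
      | succ n ih =>
        rw [pow_succ', hmul, hmul, jj, kj, kk, jk, ih.1, ih.2]
        push_cast
        constructor <;> ring
    rw [orderOf_eq_zero_iff']
    intro n hn
    refine hne _ ?_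
    rw [(key n).1, (key n).2]
    have : (0 : ℝ) < n := by exact_mod_cast hn
    intro h
    nlinarith

end SignSystem

end AffineRootDatum

end

noncomputable section

/-! ### Alternating products of elements that satisfy quadratic relations -/

section AltProd

open AffineRootDatum (altProd)

/-- The inverses of alternating products are alternating products of the inverses. -/
theorem exists_altProd_inv {J A : Type*} [Monoid A] {f g : J → A} (hfg : ∀ i, f i * g i = 1)
    (hgf : ∀ i, g i * f i = 1) (j k : J) (p : ℕ) :
    ∃ a b, (a = j ∧ b = k ∨ a = k ∧ b = j) ∧ altNext a b p = j ∧ altNext b a p = k ∧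
      altProd (f a) (f b) p * altProd (g k) (g j) p = 1 ∧
      altProd (g k) (g j) p * altProd (f a) (f b) p = 1 ∧
      altProd (f b) (f a) p * altProd (g j) (g k) p = 1 ∧
      altProd (g j) (g k) p * altProd (f b) (f a) p = 1 := by
  induction p generalizing j k with
  | zero => exact ⟨j, k, Or.inl ⟨rfl, rfl⟩, rfl, rfl, by simp [altProd]⟩
  | succ p ih =>
    obtain ⟨a, b, hab, h1, h2, e1, e2, e3, e4⟩ := ih k j
    have aux : ∀ {x y z w : A}, x * y = 1 → z * w = 1 → x * z * (w * y) = 1 := by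
      intro x y z w h h'
      rw [mul_assoc, ← mul_assoc z, h', one_mul, h]
    refine ⟨a, b, hab.symm, h2, h1, ?_, ?_, ?_, ?_⟩
    · rw [altProd_succ_right f a b p, h1, altProd]
      exact aux e1 (hfg k)
    · rw [altProd_succ_right f a b p, h1, altProd]
      exact aux (hgf k) e2
    · rw [altProd_succ_right f b a p, h2, altProd]
      exact aux e3 (hfg j)
    · rw [altProd_succ_right f b a p, h2, altProd]
      exact aux (hgf j) e4

/-! ### The subspace on which a braid relation holds -/

variable {J 𝕜 M : Type*} [CommRing 𝕜] [AddCommGroup M] [Module 𝕜 M]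

/-- The space of vectors on which the braid relation holds. -/
def braidKer (f : J → Module.End 𝕜 M) (j k : J) (m : ℕ) : Submodule 𝕜 M :=
  LinearMap.ker (altProd (f j) (f k) m - altProd (f k) (f j) m)

theorem mem_braidKer {f : J → Module.End 𝕜 M} {j k : J} {m : ℕ} {v : M} :
    v ∈ braidKer f j k m ↔ altProd (f j) (f k) m v = altProd (f k) (f j) m v := by
  rw [braidKer, LinearMap.mem_ker, LinearMap.sub_apply, sub_eq_zero]

theorem braidKer_comm (f : J → Module.End 𝕜 M) (j k : J) (m : ℕ) :
    braidKer f j k m = braidKer f k j m := by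
  ext v
  rw [mem_braidKer, mem_braidKer, eq_comm]

/-- The quadratic relations alone intertwine the braid defect: moving an operator through it from
the right gives `q j - f j` on the left. Hence the kernel of the defect is stable. -/
theorem altProd_sub_mul {f : J → Module.End 𝕜 M} {q : J → 𝕜}
    (hf : ∀ i, f i * f i = q i • f i + 1) {j k : J} {m : ℕ} (hq : q (altNext k j m) = q j) :
    (altProd (f j) (f k) (m + 1) - altProd (f k) (f j) (m + 1)) * f (altNext k j m) =
      (q j • 1 - f j) * (altProd (f j) (f k) (m + 1) - altProd (f k) (f j) (m + 1)) := by
  have e1 : altProd (f j) (f k) (m + 1) * f (altNext k j m) =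
      f j * altProd (f k) (f j) (m + 1) := by
    rw [altProd, mul_assoc, ← altProd_succ_right]
  have e2 : altProd (f k) (f j) (m + 1) * f (altNext k j m) =
      q j • altProd (f k) (f j) (m + 1) + altProd (f k) (f j) m := by
    rw [altProd_succ_right, mul_assoc, hf, hq, mul_add, mul_one, mul_smul_comm]
  have e3 : f j * altProd (f j) (f k) (m + 1) =
      q j • altProd (f j) (f k) (m + 1) + altProd (f k) (f j) m := by
    rw [altProd, ← mul_assoc, hf, add_mul, one_mul, smul_mul_assoc]
  rw [sub_mul, e1, e2, sub_mul, mul_sub, mul_sub, e3, smul_mul_assoc, smul_mul_assoc, one_mul,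
    one_mul]
  abel

theorem altNext_even {j k : J} {m : ℕ} (h : Even m) : altNext j k m = j := by
  obtain ⟨r, rfl⟩ := h
  induction r with
  | zero => rfl
  | succ r ih => rw [show r + 1 + (r + 1) = r + r + 1 + 1 by ring]; exact ih

theorem altNext_odd {j k : J} {m : ℕ} (h : Odd m) : altNext j k m = k := by
  obtain ⟨r, rfl⟩ := h
  exact altNext_even (even_two_mul r)

/-- The order of `j` and `k` in the defect is chosen by parity so that the operator moved through it
is `f j`. For odd length the first letter is then `k`, which is why the parameters must agree. -/
theorem apply_mem_braidKer_aux {f : J → Module.End 𝕜 M} {q : J → 𝕜}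
    (hf : ∀ i, f i * f i = q i • f i + 1) {j k : J} {m : ℕ} (hq : Odd m → q j = q k) {v : M}
    (hv : v ∈ braidKer f j k m) : f j v ∈ braidKer f j k m := by
  rcases m with _ | m
  · exact mem_braidKer.mpr rfl
  have key : ∀ i l : J, q (altNext l i m) = q i → altNext l i m = j →
      v ∈ braidKer f i l (m + 1) → f j v ∈ braidKer f i l (m + 1) := by
    intro i l h1 h2 h3
    have := LinearMap.congr_fun (altProd_sub_mul hf h1) v
    rw [h2, Module.End.mul_apply, Module.End.mul_apply, LinearMap.mem_ker.mp h3, map_zero] at this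
    exact this
  rcases Nat.even_or_odd m with hm | hm
  · rw [braidKer_comm] at hv ⊢
    exact key k j (by rw [altNext_even hm, hq hm.add_one]) (altNext_even hm) hv
  · exact key j k (by rw [altNext_odd hm]) (altNext_odd hm) hv

theorem apply_mem_braidKer {f : J → Module.End 𝕜 M} {q : J → 𝕜}
    (hf : ∀ i, f i * f i = q i • f i + 1) {j k : J} {m : ℕ} (hq : Odd m → q j = q k) {v : M}
    (hv : v ∈ braidKer f j k m) {i : J} (hi : i = j ∨ i = k) : f i v ∈ braidKer f j k m := by
  rcases hi with rfl | rfl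
  · exact apply_mem_braidKer_aux hf hq hv
  · rw [braidKer_comm] at hv ⊢
    exact apply_mem_braidKer_aux hf (fun h => (hq h).symm) hv

theorem altProd_apply_mem {f : J → Module.End 𝕜 M} {K : Submodule 𝕜 M} {j k : J}
    (hK : ∀ i, (i = j ∨ i = k) → ∀ v ∈ K, f i v ∈ K) (m : ℕ) {v : M} (hv : v ∈ K) :
    altProd (f j) (f k) m v ∈ K := by
  induction m generalizing j k with
  | zero => exact hv
  | succ m ih => exact hK j (Or.inl rfl) _ (ih fun i hi => hK i hi.symm)

/-- If the braid relation holds on a subspace, it also holds there for the inverses. -/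
theorem braid_inv {f g : J → Module.End 𝕜 M} (hfg : ∀ i, f i * g i = 1)
    (hgf : ∀ i, g i * f i = 1) {j k : J} {m : ℕ} {K : Submodule 𝕜 M}
    (hK : ∀ i, (i = j ∨ i = k) → ∀ v ∈ K, g i v ∈ K) (h : K ≤ braidKer f j k m) :
    K ≤ braidKer g j k m := by
  intro v hv
  obtain ⟨a, b, hab, -, -, e1, e2, e3, e4⟩ := exists_altProd_inv hfg hgf j k m
  have h' : ∀ w ∈ K, altProd (f a) (f b) m w = altProd (f b) (f a) m w := by
    rcases hab with ⟨rfl, rfl⟩ | ⟨rfl, rfl⟩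
    · exact fun w hw => mem_braidKer.mp (h hw)
    · exact fun w hw => (mem_braidKer.mp (h hw)).symm
  rw [mem_braidKer]
  have hw := h' _ (altProd_apply_mem hK m hv)
  rw [← Module.End.mul_apply (altProd (f b) (f a) m), e3, Module.End.one_apply] at hw
  have e := LinearMap.congr_fun e2 (altProd (g j) (g k) m v)
  rw [Module.End.mul_apply, hw] at e
  exact e.symm

end AltProd

/-! ### The regular representation of the Hecke algebra of a sign system -/

namespace SignSystem

open AffineRootDatum (altProd)

section Regular

variable {G J 𝕜 : Type*} [Group G] [CommRing 𝕜] (S : SignSystem G J) (q : J → 𝕜)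

open scoped Classical in
/-- The operators of the regular representation of the Hecke algebra. -/
def regular (j : J) : Module.End 𝕜 (G →₀ 𝕜) :=
  Finsupp.lsum 𝕜 fun w => LinearMap.toSpanSingleton 𝕜 (G →₀ 𝕜)
    (Finsupp.single (S.s j * w) 1 +
      (if S.pos w⁻¹ j then 0 else q j) • Finsupp.single w (1 : 𝕜))

theorem regular_of_pos {j : J} {w : G} (h : S.pos w⁻¹ j) :
    S.regular q j (Finsupp.single w 1) = Finsupp.single (S.s j * w) 1 := by
  rw [regular, Finsupp.lsum_single, LinearMap.toSpanSingleton_apply, one_smul, if_pos h, zero_smul,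
    add_zero]

theorem regular_of_not_pos {j : J} {w : G} (h : ¬ S.pos w⁻¹ j) :
    S.regular q j (Finsupp.single w 1) =
      Finsupp.single (S.s j * w) 1 + q j • Finsupp.single w 1 := by
  rw [regular, Finsupp.lsum_single, LinearMap.toSpanSingleton_apply, one_smul, if_neg h]

theorem regular_quadratic (j : J) :
    S.regular q j * S.regular q j = q j • S.regular q j + 1 := by
  refine Finsupp.lhom_ext' fun w => LinearMap.ext_ring ?_
  change S.regular q j (S.regular q j (Finsupp.single w 1)) =
    q j • S.regular q j (Finsupp.single w 1) + Finsupp.single w 1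
  by_cases h : S.pos w⁻¹ j
  · rw [S.regular_of_pos q h,
      S.regular_of_not_pos q (by rw [pos_inv_s_mul]; exact not_not.mpr h), s_mul_s_mul, add_comm]
  · rw [S.regular_of_not_pos q h, map_add, map_smul, S.regular_of_not_pos q h,
      S.regular_of_pos q ((S.pos_inv_s_mul w j).mpr h), s_mul_s_mul, add_comm]

/-- For `w` minimal in its dihedral coset every further letter raises the length, so the operators
only permute basis vectors. -/
theorem regular_altProd {j k : J} {w : G} (hj : S.pos w⁻¹ j) (hk : S.pos w⁻¹ k) {p : ℕ}
    (hp : p ≤ orderOf (S.s j * S.s k)) :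
    altProd (S.regular q j) (S.regular q k) p (Finsupp.single w 1) =
      Finsupp.single (altProd (S.s j) (S.s k) p * w) 1 := by
  induction p generalizing j k with
  | zero => simp [altProd]
  | succ p ih =>
    rw [altProd, altProd, Module.End.mul_apply, ih hk hj (by rw [orderOf_comm]; omega),
      regular_of_pos, mul_assoc]
    obtain ⟨a, b, hab, h1, -, e1, -⟩ := exists_altProd_inv S.s_mul_self S.s_mul_self j k p
    rw [mul_inv_rev, ← eq_inv_of_mul_eq_one_left e1, ← h1]
    rcases hab with ⟨rfl, rfl⟩ | ⟨rfl, rfl⟩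
    · exact S.pos_mul_altProd (S.pow_ne_one_of_lt (Or.inl (by omega))) hj hk
    · exact S.pos_mul_altProd (S.pow_ne_one_of_lt (Or.inl (by rw [orderOf_comm]; omega))) hk hj

/-- Induction on the length: if `i ∈ {j, k}` is a descent of `w`, the basis vector of `w` is the
image under the operator of `i` of that of `s i * w`, and the braid kernel is stable. Otherwise both
sides are computed directly. -/
theorem regular_braid {j k : J} (hq : Odd (orderOf (S.s j * S.s k)) → q j = q k) :
    altProd (S.regular q j) (S.regular q k) (orderOf (S.s j * S.s k)) =
      altProd (S.regular q k) (S.regular q j) (orderOf (S.s j * S.s k)) := by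
  suffices h : ∀ n w, S.len w = n →
      Finsupp.single w 1 ∈ braidKer (S.regular q) j k (orderOf (S.s j * S.s k)) by
    refine Finsupp.lhom_ext' fun w => LinearMap.ext_ring ?_
    exact mem_braidKer.mp (h _ w rfl)
  intro n
  induction n using Nat.strong_induction_on with
  | _ n ih =>
    intro w hw
    have hdesc : ∀ i, (i = j ∨ i = k) → ¬ S.pos w⁻¹ i →
        Finsupp.single w 1 ∈ braidKer (S.regular q) j k (orderOf (S.s j * S.s k)) := by
      intro i hi hneg
      have h1 := S.len_of_not_pos hneg
      have h2 := S.regular_of_pos q ((S.pos_inv_s_mul w i).mpr hneg)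
      rw [s_mul_s_mul] at h2
      rw [← h2]
      exact apply_mem_braidKer (S.regular_quadratic q) hq (ih _ (by omega) _ rfl) hi
    by_cases hj : S.pos w⁻¹ j
    · by_cases hk : S.pos w⁻¹ k
      · rw [mem_braidKer, S.regular_altProd q hj hk le_rfl,
          S.regular_altProd q hk hj (by rw [orderOf_comm]), altProd_comm]
      · exact hdesc k (Or.inr rfl) hk
    · exact hdesc j (Or.inl rfl) hj

end Regular

end SignSystem

end

noncomputable section

/-! ### Operators that satisfy the Bernstein relations -/

open AffineRootDatum (altProd) in
theorem commute_altProd {A : Type*} [Monoid A] {a b c : A} (ha : Commute c a) (hb : Commute c b)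
    (m : ℕ) : Commute c (altProd a b m) := by
  induction m generalizing a b with
  | zero => exact Commute.one_right c
  | succ m ih => exact ha.mul_right (ih hb ha)

/-- Operators `x λ` for `λ` in a lattice and invertible operators `T i` with inverse `u i` that
satisfy quadratic relations, and Bernstein relations for weights `λ` with small pairings `f i λ`. -/
structure BernsteinFamily (𝕜 Λ M J : Type*) [CommRing 𝕜] [AddCommGroup Λ] [AddCommGroup M]
    [Module 𝕜 M] where
  x : Λ → Module.End 𝕜 M
  T : J → Module.End 𝕜 M
  u : J → Module.End 𝕜 M
  q : J → 𝕜
  α : J → Λ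
  f : J → Λ →+ ℤ
  x_add (l m : Λ) : x (l + m) = x l * x m
  T_eq (i : J) : T i = u i + q i • 1
  T_mul_u (i : J) : T i * u i = 1
  u_mul_T (i : J) : u i * T i = 1
  u_mul_u (i : J) : u i * u i = (-q i) • u i + 1
  comm {i : J} {l : Λ} : f i l = 0 → u i * x l = x l * u i
  one {i : J} {l : Λ} : f i l = 1 → u i * x l = x (l - α i) * T i
  two {i : J} {l : Λ} : f i l = 2 → u i * x l = x (l - 2 • α i) * T i + q i • x (l - α i)
  f_α (i : J) : f i (α i) = 2

namespace BernsteinFamily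

open AffineRootDatum (altProd)

section

variable {𝕜 Λ M J : Type*} [CommRing 𝕜] [AddCommGroup Λ] [AddCommGroup M] [Module 𝕜 M]
  (B : BernsteinFamily 𝕜 Λ M J)

/-- The weights `λ` such that `x λ` preserves a subspace. -/
def stab (K : Submodule 𝕜 M) : AddSubsemigroup Λ where
  carrier := {l | ∀ v ∈ K, B.x l v ∈ K}
  add_mem' := by
    intro l m hl hm v hv
    rw [B.x_add]
    exact hl _ (hm _ hv)

variable {B} {j k : J} {m : ℕ}

theorem u_mem (hq : Odd m → B.q j = B.q k) {i : J} (hi : i = j ∨ i = k) {v : M}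
    (hv : v ∈ braidKer B.u j k m) : B.u i v ∈ braidKer B.u j k m :=
  apply_mem_braidKer (q := fun i => -B.q i) B.u_mul_u (fun h => by rw [hq h]) hv hi

theorem T_mem (hq : Odd m → B.q j = B.q k) {i : J} (hi : i = j ∨ i = k) {v : M}
    (hv : v ∈ braidKer B.u j k m) : B.T i v ∈ braidKer B.u j k m := by
  rw [B.T_eq]
  exact add_mem (u_mem hq hi hv) (Submodule.smul_mem _ _ hv)

theorem T_braid (hq : Odd m → B.q j = B.q k) {v : M} (hv : v ∈ braidKer B.u j k m) :
    altProd (B.T j) (B.T k) m v = altProd (B.T k) (B.T j) m v :=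
  mem_braidKer.mp (braid_inv B.u_mul_T B.T_mul_u (fun _ hi _ hv => T_mem hq hi hv) le_rfl hv)

theorem u_T_apply (i : J) (v : M) : B.u i (B.T i v) = v := LinearMap.congr_fun (B.u_mul_T i) v

theorem T_u_apply (i : J) (v : M) : B.T i (B.u i v) = v := LinearMap.congr_fun (B.T_mul_u i) v

theorem comm_apply {i : J} {l : Λ} (h : B.f i l = 0) (v : M) :
    B.u i (B.x l v) = B.x l (B.u i v) := LinearMap.congr_fun (B.comm h) v

theorem one_apply {i : J} {l : Λ} (h : B.f i l = 1) (v : M) :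
    B.u i (B.x l v) = B.x (l - B.α i) (B.T i v) := LinearMap.congr_fun (B.one h) v

theorem two_apply {i : J} {l : Λ} (h : B.f i l = 2) (v : M) :
    B.u i (B.x l v) = B.x (l - 2 • B.α i) (B.T i v) + B.q i • B.x (l - B.α i) v :=
  LinearMap.congr_fun (B.two h) v

theorem mem_stab_of_zero {l : Λ} (hj : B.f j l = 0) (hk : B.f k l = 0) :
    l ∈ B.stab (braidKer B.u j k m) := by
  intro v hv
  have cj : Commute (B.x l) (B.u j) := (B.comm hj).symm
  have ck : Commute (B.x l) (B.u k) := (B.comm hk).symm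
  have h1 := LinearMap.congr_fun (commute_altProd cj ck m) v
  have h2 := LinearMap.congr_fun (commute_altProd ck cj m) v
  simp only [Module.End.mul_apply] at h1 h2
  rw [mem_braidKer] at hv ⊢
  rw [← h1, ← h2, hv]

/-- For pairing `1` the Bernstein relation reads `x (l - α i) = u i * x l * u i`. -/
theorem mem_stab_sub (hq : Odd m → B.q j = B.q k) {i : J} (hi : i = j ∨ i = k) {l : Λ}
    (h : B.f i l = 1) (hl : l ∈ B.stab (braidKer B.u j k m)) :
    l - B.α i ∈ B.stab (braidKer B.u j k m) := by
  intro v hv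
  rw [← T_u_apply (B := B) i v, ← one_apply h]
  exact u_mem hq hi (hl _ (u_mem hq hi hv))

/-- For pairing `2` it reads `x (l - 2 • α i) = (u i * x l - q i • x (l - α i)) * u i`, so the
middle weight is needed as well. -/
theorem mem_stab_sub_two (hq : Odd m → B.q j = B.q k) {i : J} (hi : i = j ∨ i = k) {l : Λ}
    (h : B.f i l = 2) (hl : l ∈ B.stab (braidKer B.u j k m))
    (hl' : l - B.α i ∈ B.stab (braidKer B.u j k m)) :
    l - 2 • B.α i ∈ B.stab (braidKer B.u j k m) := by
  intro v hv
  have e := two_apply h (B.u i v)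
  rw [T_u_apply] at e
  rw [← sub_eq_iff_eq_add.mpr e]
  exact sub_mem (u_mem hq hi (hl _ (u_mem hq hi hv)))
    (Submodule.smul_mem _ _ (hl' _ (u_mem hq hi hv)))

/-- Weights orthogonal to both roots stabilize the kernel, so only the pair of pairings matters. As
the stabilizer is a priori just a semigroup, weights for all four of `(±1, 0)` and `(0, ±1)` are
required. -/
theorem stab_eq_top {a a' b b' : Λ} (ha : a ∈ B.stab (braidKer B.u j k m))
    (ha' : a' ∈ B.stab (braidKer B.u j k m)) (hb : b ∈ B.stab (braidKer B.u j k m))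
    (hb' : b' ∈ B.stab (braidKer B.u j k m)) (haj : B.f j a = 1) (hak : B.f k a = 0)
    (haj' : B.f j a' = -1) (hak' : B.f k a' = 0) (hbj : B.f j b = 0) (hbk : B.f k b = 1)
    (hbj' : B.f j b' = 0) (hbk' : B.f k b' = -1) (l : Λ) :
    l ∈ B.stab (braidKer B.u j k m) := by
  have hz : (0 : Λ) ∈ B.stab (braidKer B.u j k m) :=
    mem_stab_of_zero (map_zero _) (map_zero _)
  have hn : ∀ {y : Λ}, y ∈ B.stab (braidKer B.u j k m) → ∀ n : ℕ,
      n • y ∈ B.stab (braidKer B.u j k m) := by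
    intro y hy n
    induction n with
    | zero => rwa [zero_smul]
    | succ n ih => rw [succ_nsmul]; exact add_mem ih hy
  have key : ∀ (p r p' r' : ℕ), B.f j l = p - p' → B.f k l = r - r' →
      l ∈ B.stab (braidKer B.u j k m) := by
    intro p r p' r' hp hr
    have h0 : l - (p • a + p' • a' + r • b + r' • b') ∈ B.stab (braidKer B.u j k m) := by
      apply mem_stab_of_zero <;>
      simp only [map_sub, map_add, map_nsmul, haj, hak, haj', hak', hbj, hbk, hbj', hbk', hp, hr,
        nsmul_eq_mul] <;> ring
    have := add_mem h0 (add_mem (add_mem (add_mem (hn ha p) (hn ha' p')) (hn hb r)) (hn hb' r'))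
    rwa [sub_add_cancel] at this
  exact key (B.f j l).toNat (B.f k l).toNat (-B.f j l).toNat (-B.f k l).toNat (by omega) (by omega)

/-- The model for all ranks two: moving `x ω` to the left through both words in `u` turns each
letter into `T`, except for one `u k` met at pairing `0`. The two results agree by the braid
relation for `T` applied to `u k v`. -/
theorem stab_two_aux (hq : Odd 2 → B.q j = B.q k) (hkj : B.f k (B.α j) = 0)
    {ω : Λ} (hj : B.f j ω = 1) (hk : B.f k ω = 0) : ω ∈ B.stab (braidKer B.u j k 2) := by
  intro v hv
  have hT := T_braid hq (u_mem hq (Or.inr rfl) hv)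
  rw [mem_braidKer]
  have k1 : B.f k (ω - B.α j) = 0 := by rw [map_sub]; omega
  simp only [altProd, mul_one, Module.End.mul_apply, T_u_apply] at hT ⊢
  have h1 := congrArg (fun y => B.u k y) hT
  simp only [u_T_apply] at h1
  rw [comm_apply hk, one_apply hj, one_apply hj, comm_apply k1, h1]

theorem stab_two (hjk : B.f j (B.α k) = 0) (hkj : B.f k (B.α j) = 0)
    {ω ω' : Λ} (hj : B.f j ω = 1) (hk : B.f k ω = 0) (hj' : B.f j ω' = 0) (hk' : B.f k ω' = 1)
    (l : Λ) : l ∈ B.stab (braidKer B.u j k 2) := by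
  have hq : Odd 2 → B.q j = B.q k := fun h => absurd h (by decide)
  have hω := stab_two_aux hq hkj hj hk
  have hω' := stab_two_aux (fun h => absurd h (by decide)) hjk hk' hj'
  rw [braidKer_comm] at hω'
  have h1 := B.f_α j
  have h2 := B.f_α k
  refine stab_eq_top hω (mem_stab_sub hq (Or.inl rfl) hj hω) hω'
    (mem_stab_sub hq (Or.inr rfl) hk' hω') hj hk ?_ ?_ hj' hk' ?_ ?_ l <;>
  rw [map_sub] <;> omega

theorem stab_three (hq : B.q j = B.q k) (hjk : B.f j (B.α k) = -1) (hkj : B.f k (B.α j) = -1)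
    {ω : Λ} (hj : B.f j ω = 1) (hk : B.f k ω = 0) (l : Λ) :
    l ∈ B.stab (braidKer B.u j k 3) := by
  have hq' : Odd 3 → B.q j = B.q k := fun _ => hq
  have h1 := B.f_α j
  have h2 := B.f_α k
  have j1 : B.f j (ω - B.α j) = -1 := by rw [map_sub]; omega
  have k1 : B.f k (ω - B.α j) = 1 := by rw [map_sub]; omega
  have j2 : B.f j (ω - B.α j - B.α k) = 0 := by rw [map_sub]; omega
  have k2 : B.f k (ω - B.α j - B.α k) = -1 := by rw [map_sub]; omega
  have hω : ω ∈ B.stab (braidKer B.u j k 3) := by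
    intro v hv
    have hT := T_braid hq' (u_mem hq' (Or.inr rfl) hv)
    rw [mem_braidKer]
    simp only [altProd, mul_one, Module.End.mul_apply, T_u_apply] at hT ⊢
    have h1 := congrArg (fun y => B.u j y) hT
    simp only [u_T_apply] at h1
    simp only [comm_apply hk, one_apply hj, one_apply k1, comm_apply j2, h1]
  have hω1 := mem_stab_sub hq' (Or.inl rfl) hj hω
  have hω2 := mem_stab_sub hq' (Or.inr rfl) k1 hω1
  -- The orbit of `ω` has pairings `(1, 0)`, `(-1, 1)`, `(0, -1)`; sums of these supply the missing
  -- `(-1, 0)` and `(0, 1)`.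
  refine stab_eq_top hω (add_mem hω1 hω2) (add_mem hω hω1) hω2 hj hk ?_ ?_ ?_ ?_ j2 k2 l <;>
  rw [map_add] <;> omega

theorem stab_four (hjk : B.f j (B.α k) = -2) (hkj : B.f k (B.α j) = -1)
    {ω : Λ} (hj : B.f j ω = 1) (hk : B.f k ω = 0) (l : Λ) :
    l ∈ B.stab (braidKer B.u j k 4) := by
  have hq' : Odd 4 → B.q j = B.q k := fun h => absurd h (by decide)
  have h1 := B.f_α j
  have h2 := B.f_α k
  have j1 : B.f j (ω - B.α j) = -1 := by rw [map_sub]; omega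
  have k1 : B.f k (ω - B.α j) = 1 := by rw [map_sub]; omega
  have j2 : B.f j (ω - B.α j - B.α k) = 1 := by rw [map_sub]; omega
  have k2 : B.f k (ω - B.α j - B.α k) = -1 := by rw [map_sub]; omega
  have j3 : B.f j (ω - B.α j - B.α k - B.α j) = -1 := by rw [map_sub]; omega
  have k3 : B.f k (ω - B.α j - B.α k - B.α j) = 0 := by rw [map_sub]; omega
  have hω : ω ∈ B.stab (braidKer B.u j k 4) := by
    intro v hv
    have hT := T_braid hq' (u_mem hq' (Or.inr rfl) hv)
    rw [mem_braidKer]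
    simp only [altProd, mul_one, Module.End.mul_apply, T_u_apply] at hT ⊢
    have h1 := congrArg (fun y => B.u k y) hT
    simp only [u_T_apply] at h1
    simp only [comm_apply hk, one_apply hj, one_apply k1, one_apply j2, comm_apply k3, h1]
  have hω1 := mem_stab_sub hq' (Or.inl rfl) hj hω
  have hω2 := mem_stab_sub hq' (Or.inr rfl) k1 hω1
  have hω3 := mem_stab_sub hq' (Or.inl rfl) j2 hω2
  refine stab_eq_top hω hω3 (add_mem hω hω1) (add_mem hω2 hω3) hj hk j3 k3 ?_ ?_ ?_ ?_ l <;>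
  rw [map_add] <;> omega

/-- In type `G₂` the orbit of `ω` meets pairing `2`, whence the field `two`. The correction terms
sit at a weight orthogonal to both roots and come out equal in the two words. -/
theorem stab_six (hjk : B.f j (B.α k) = -3) (hkj : B.f k (B.α j) = -1)
    {ω : Λ} (hj : B.f j ω = 1) (hk : B.f k ω = 0) (l : Λ) :
    l ∈ B.stab (braidKer B.u j k 6) := by
  have hq' : Odd 6 → B.q j = B.q k := fun h => absurd h (by decide)
  have h1 := B.f_α j
  have h2 := B.f_α k
  have j1 : B.f j (ω - B.α j) = -1 := by rw [map_sub]; omega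
  have k1 : B.f k (ω - B.α j) = 1 := by rw [map_sub]; omega
  have j2 : B.f j (ω - B.α j - B.α k) = 2 := by rw [map_sub]; omega
  have k2 : B.f k (ω - B.α j - B.α k) = -1 := by rw [map_sub]; omega
  have j0 : B.f j (ω - B.α j - B.α k - B.α j) = 0 := by rw [map_sub]; omega
  have k0 : B.f k (ω - B.α j - B.α k - B.α j) = 0 := by rw [map_sub]; omega
  have j3 : B.f j (ω - B.α j - B.α k - 2 • B.α j) = -2 := by
    rw [map_sub, map_nsmul, nsmul_eq_mul]; push_cast; omega
  have k3 : B.f k (ω - B.α j - B.α k - 2 • B.α j) = 1 := by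
    rw [map_sub, map_nsmul, nsmul_eq_mul]; push_cast; omega
  have j4 : B.f j (ω - B.α j - B.α k - 2 • B.α j - B.α k) = 1 := by rw [map_sub]; omega
  have k4 : B.f k (ω - B.α j - B.α k - 2 • B.α j - B.α k) = -1 := by rw [map_sub]; omega
  have j5 : B.f j (ω - B.α j - B.α k - 2 • B.α j - B.α k - B.α j) = -1 := by
    rw [map_sub]; omega
  have k5 : B.f k (ω - B.α j - B.α k - 2 • B.α j - B.α k - B.α j) = 0 := by
    rw [map_sub]; omega
  have hω : ω ∈ B.stab (braidKer B.u j k 6) := by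
    intro v hv
    have hT := T_braid hq' (u_mem hq' (Or.inr rfl) hv)
    rw [mem_braidKer]
    simp only [altProd, mul_one, Module.End.mul_apply, T_u_apply] at hT ⊢
    have h1 := congrArg (fun y => B.u k y) hT
    simp only [u_T_apply] at h1
    simp only [comm_apply hk, one_apply hj, one_apply k1, two_apply j2, one_apply k3,
      one_apply j4, comm_apply k5, comm_apply j0, comm_apply k0, map_add, map_smul, h1, u_T_apply]
  have hω1 := mem_stab_sub hq' (Or.inl rfl) hj hω
  have hω2 := mem_stab_sub hq' (Or.inr rfl) k1 hω1
  have hω3 := mem_stab_sub_two hq' (Or.inl rfl) j2 hω2 (mem_stab_of_zero j0 k0)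
  have hω4 := mem_stab_sub hq' (Or.inr rfl) k3 hω3
  have hω5 := mem_stab_sub hq' (Or.inl rfl) j4 hω4
  refine stab_eq_top hω hω5 (add_mem hω hω1) (add_mem hω4 hω5) hj hk j5 k5 ?_ ?_ ?_ ?_ l <;>
  rw [map_add] <;> omega

end

end BernsteinFamily

/-! ### Demazure–Lusztig operators -/

namespace DemazureLusztig

open AffineRootDatum (altProd)

section

variable {𝕜 Λ N : Type*} [CommRing 𝕜] [AddCommGroup Λ] [AddCommGroup N] [Module 𝕜 N]

variable (𝕜 N) in
/-- Multiplication by `X^l` on `N[Λ]`. -/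
def shift (l : Λ) : Module.End 𝕜 (Λ →₀ N) := Finsupp.lmapDomain N 𝕜 (l + ·)

theorem shift_single (l m : Λ) (v : N) :
    shift 𝕜 N l (Finsupp.single m v) = Finsupp.single (l + m) v := by
  simp [shift]

theorem shift_add (l m : Λ) : shift 𝕜 N (l + m) = shift 𝕜 N l * shift 𝕜 N m := by
  refine Finsupp.lhom_ext' fun a => LinearMap.ext fun v => ?_
  change shift 𝕜 N (l + m) (Finsupp.single a v) = shift 𝕜 N l (shift 𝕜 N m (Finsupp.single a v))
  simp only [shift_single, add_assoc]

theorem shift_zero : shift 𝕜 N (0 : Λ) = 1 := by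
  refine Finsupp.lhom_ext' fun a => LinearMap.ext fun v => ?_
  change shift 𝕜 N (0 : Λ) (Finsupp.single a v) = Finsupp.single a v
  rw [shift_single, zero_add]

theorem shift_comm (l m : Λ) : shift 𝕜 N l * shift 𝕜 N m = shift 𝕜 N m * shift 𝕜 N l := by
  rw [← shift_add, ← shift_add, add_comm]

variable (𝕜 N) in
/-- Multiplication by `(1 - X^{-n α}) / (1 - X^{-α})`. -/
def geom (α : Λ) (n : ℤ) : Module.End 𝕜 (Λ →₀ N) :=
  ∑ i ∈ Finset.range n.toNat, shift 𝕜 N (-(i • α)) -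
    ∑ i ∈ Finset.range (-n).toNat, shift 𝕜 N ((i + 1) • α)

theorem geom_zero (α : Λ) : geom 𝕜 N α 0 = 0 := by simp [geom]

theorem geom_succ (α : Λ) (n : ℤ) :
    geom 𝕜 N α (n + 1) = geom 𝕜 N α n + shift 𝕜 N (-(n • α)) := by
  rcases le_or_gt 0 n with hn | hn
  · obtain ⟨n, rfl⟩ := Int.eq_ofNat_of_zero_le hn
    have h1 : ((n : ℤ) + 1).toNat = n + 1 := by omega
    have h2 : (-((n : ℤ) + 1)).toNat = 0 := by omega
    have h3 : (-(n : ℤ)).toNat = 0 := by omega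
    rw [geom, geom, h1, h2, h3, Finset.sum_range_succ, Int.toNat_natCast, natCast_zsmul]
    abel
  · obtain ⟨k, hk⟩ := Int.eq_ofNat_of_zero_le (show 0 ≤ -n - 1 by omega)
    have hn' : n = -((k : ℤ) + 1) := by omega
    subst hn'
    have h1 : (-((k : ℤ) + 1) + 1).toNat = 0 := by omega
    have h2 : (-(-((k : ℤ) + 1) + 1)).toNat = k := by omega
    have h3 : (-((k : ℤ) + 1)).toNat = 0 := by omega
    have h4 : (- -((k : ℤ) + 1)).toNat = k + 1 := by omega
    have h5 : -(-((k : ℤ) + 1) • α) = (k + 1) • α := by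
      rw [neg_smul, neg_neg]
      exact_mod_cast natCast_zsmul α (k + 1)
    rw [geom, geom, h1, h2, h3, h4, h5, Finset.sum_range_succ]
    abel

/-- This is `1 - X^{-(m+n)α} = (1 - X^{-mα}) + X^{-mα}(1 - X^{-nα})` divided by `1 - X^{-α}`; it is
the cocycle identity behind the Bernstein relation. -/
theorem geom_add (α : Λ) (m n : ℤ) :
    geom 𝕜 N α (m + n) = geom 𝕜 N α m + shift 𝕜 N (-(m • α)) * geom 𝕜 N α n := by
  have step : ∀ n : ℤ, (geom 𝕜 N α (m + n) = geom 𝕜 N α m +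
      shift 𝕜 N (-(m • α)) * geom 𝕜 N α n ↔ geom 𝕜 N α (m + (n + 1)) = geom 𝕜 N α m +
      shift 𝕜 N (-(m • α)) * geom 𝕜 N α (n + 1)) := by
    intro n
    rw [← add_assoc, geom_succ, geom_succ, mul_add, ← shift_add, add_smul, neg_add, ← add_assoc,
      add_left_inj]
  induction n using Int.induction_on with
  | zero => rw [add_zero, geom_zero, mul_zero, add_zero]
  | succ n ih => exact (step n).mp ih
  | pred n ih =>
    rw [step]
    simpa using ih

theorem geom_one (α : Λ) : geom 𝕜 N α 1 = 1 := by
  have := geom_succ (𝕜 := 𝕜) (N := N) α 0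
  rwa [zero_add, geom_zero, zero_add, zero_smul, neg_zero, shift_zero] at this

theorem geom_two (α : Λ) : geom 𝕜 N α 2 = 1 + shift 𝕜 N (-α) := by
  have := geom_succ (𝕜 := 𝕜) (N := N) α 1
  rwa [one_add_one_eq_two, geom_one, one_smul] at this

theorem geom_neg_one (α : Λ) : geom 𝕜 N α (-1) = -shift 𝕜 N α := by
  have := geom_succ (𝕜 := 𝕜) (N := N) α (-1)
  rw [neg_add_cancel, geom_zero, neg_smul, one_smul, neg_neg] at this
  exact (neg_eq_of_add_eq_zero_left this.symm).symm

/-- The Demazure–Lusztig operator on `N[Λ]` that extends the operator `t` on `N`. -/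
def dl (α : Λ) (f : Λ →+ ℤ) (q : 𝕜) (t : Module.End 𝕜 N) : Module.End 𝕜 (Λ →₀ N) :=
  Finsupp.lsum 𝕜 fun l => Finsupp.lsingle (l - f l • α) ∘ₗ t +
    q • (geom 𝕜 N α (f l) ∘ₗ Finsupp.lsingle l)

variable (α : Λ) (f : Λ →+ ℤ) (q : 𝕜) (t : Module.End 𝕜 N)

theorem dl_single (l : Λ) (v : N) : dl α f q t (Finsupp.single l v) =
    Finsupp.single (l - f l • α) (t v) + q • geom 𝕜 N α (f l) (Finsupp.single l v) := by
  simp [dl]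

theorem dl_single_zero (v : N) :
    dl α f q t (Finsupp.single 0 v) = Finsupp.single 0 (t v) := by
  rw [dl_single, map_zero, geom_zero, zero_smul, sub_zero]
  simp

theorem dl_mul_shift (l : Λ) : dl α f q t * shift 𝕜 N l =
    shift 𝕜 N (l - f l • α) * dl α f q t + q • (shift 𝕜 N l * geom 𝕜 N α (f l)) := by
  refine Finsupp.lhom_ext' fun m => LinearMap.ext fun v => ?_
  change dl α f q t (shift 𝕜 N l (Finsupp.single m v)) =
    shift 𝕜 N (l - f l • α) (dl α f q t (Finsupp.single m v)) +
      q • (shift 𝕜 N l (geom 𝕜 N α (f l) (Finsupp.single m v)))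
  have hc : ∀ n : ℤ, geom 𝕜 N α n * shift 𝕜 N l = shift 𝕜 N l * geom 𝕜 N α n := by
    intro n
    simp only [geom, sub_mul, mul_sub, Finset.sum_mul, Finset.mul_sum, shift_comm _ l]
  have h1 : geom 𝕜 N α (f l + f m) * shift 𝕜 N l = shift 𝕜 N l * geom 𝕜 N α (f l) +
      shift 𝕜 N (l - f l • α) * geom 𝕜 N α (f m) := by
    rw [hc, geom_add, mul_add, ← mul_assoc, ← shift_add, sub_eq_add_neg]
  have h2 := LinearMap.congr_fun h1 (Finsupp.single m v)
  simp only [Module.End.mul_apply, LinearMap.add_apply] at h2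
  rw [shift_single] at h2
  rw [shift_single, dl_single, dl_single, map_add, map_add, h2, map_smul, shift_single, smul_add,
    add_smul, show l + m - (f l • α + f m • α) = l - f l • α + (m - f m • α) by abel]
  abel

variable {α f q t}

theorem dl_mul_shift_zero {l : Λ} (h : f l = 0) :
    dl α f q t * shift 𝕜 N l = shift 𝕜 N l * dl α f q t := by
  rw [dl_mul_shift, h, geom_zero, mul_zero, smul_zero, add_zero, zero_smul, sub_zero]

theorem dl_mul_shift_one {l : Λ} (h : f l = 1) :
    dl α f q t * shift 𝕜 N l = shift 𝕜 N (l - α) * dl α f q t + q • shift 𝕜 N l := by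
  rw [dl_mul_shift, h, geom_one, mul_one, one_smul]

/-- The defect of the quadratic relation vanishes on `X^0 ⊗ N` and commutes with every `X^l`. For
the latter, weights of pairing `0` and the single weight `ω` suffice, since together they generate
the lattice. -/
theorem dl_quadratic (hf : f α = 2) {ω : Λ} (hω : f ω = 1) (ht : t * t = q • t + 1) :
    dl α f q t * dl α f q t = q • dl α f q t + 1 := by
  have h1 : ∀ l, Commute (shift 𝕜 N l)
      (dl α f q t * dl α f q t - (q • dl α f q t + 1)) := by
    have hω1 : Commute (shift 𝕜 N ω) (dl α f q t * dl α f q t - (q • dl α f q t + 1)) := by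
      have e1 := dl_mul_shift_one (q := q) (t := t) (α := α) hω
      have e2 : dl α f q t * shift 𝕜 N (ω - α) + q • shift 𝕜 N ω =
          shift 𝕜 N ω * dl α f q t := by
        have e3 : shift 𝕜 N (ω - α) * geom 𝕜 N α (-1) = -shift 𝕜 N ω := by
          rw [geom_neg_one]
          refine (mul_neg (shift 𝕜 N (ω - α)) (shift 𝕜 N α)).trans ?_
          rw [← shift_add, sub_add_cancel]
        rw [dl_mul_shift, map_sub, hω, hf, show (1 : ℤ) - 2 = -1 by norm_num, e3, neg_smul,
          one_smul, sub_neg_eq_add, sub_add_cancel, add_assoc, ← smul_add]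
        refine (congrArg (fun z => _ + q • z) (neg_add_cancel (shift 𝕜 N ω))).trans ?_
        simp
      have e4 : dl α f q t * dl α f q t * shift 𝕜 N ω + q • (shift 𝕜 N ω * dl α f q t) =
          shift 𝕜 N ω * (dl α f q t * dl α f q t) + q • (dl α f q t * shift 𝕜 N ω) := by
        rw [mul_assoc, e1, mul_add, ← mul_assoc, ← mul_assoc, ← e2, add_mul, mul_smul_comm,
          smul_mul_assoc, e1, smul_add, e2]
        abel
      change _ * _ = _ * _
      rw [sub_mul, mul_sub, add_mul, mul_add, one_mul, mul_one, smul_mul_assoc, mul_smul_comm,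
        sub_eq_sub_iff_add_eq_add, ← add_assoc, ← add_assoc, add_right_cancel_iff]
      exact e4.symm
    have h0 : ∀ l, f l = 0 → Commute (shift 𝕜 N l)
        (dl α f q t * dl α f q t - (q • dl α f q t + 1)) := by
      intro l hl
      have c : Commute (shift 𝕜 N l) (dl α f q t) := (dl_mul_shift_zero hl).symm
      exact (c.mul_right c).sub_right ((c.smul_right q).add_right (Commute.one_right _))
    have hneg : ∀ l, Commute (shift 𝕜 N l) (dl α f q t * dl α f q t - (q • dl α f q t + 1)) →
        Commute (shift 𝕜 N (-l)) (dl α f q t * dl α f q t - (q • dl α f q t + 1)) := by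
      intro l hl
      have e1 : shift 𝕜 N (-l) * shift 𝕜 N l = 1 := by
        rw [← shift_add, neg_add_cancel, shift_zero]
      have e2 : shift 𝕜 N l * shift 𝕜 N (-l) = 1 := by
        rw [← shift_add, add_neg_cancel, shift_zero]
      exact Commute.units_inv_left (u := ⟨_, _, e2, e1⟩) hl
    have hn : ∀ n : ℕ, Commute (shift 𝕜 N (n • ω))
        (dl α f q t * dl α f q t - (q • dl α f q t + 1)) := by
      intro n
      induction n with
      | zero => rw [zero_smul, shift_zero]; exact Commute.one_left _
      | succ n ih => rw [succ_nsmul, shift_add]; exact ih.mul_left hω1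
    have hz : ∀ n : ℤ, Commute (shift 𝕜 N (n • ω))
        (dl α f q t * dl α f q t - (q • dl α f q t + 1)) := by
      intro n
      rcases Int.eq_nat_or_neg n with ⟨k, rfl | rfl⟩
      · rw [natCast_zsmul]; exact hn k
      · rw [neg_smul, natCast_zsmul]; exact hneg _ (hn k)
    intro l
    have hl : shift 𝕜 N l = shift 𝕜 N (l - f l • ω) * shift 𝕜 N (f l • ω) := by
      rw [← shift_add, sub_add_cancel]
    rw [hl]
    exact (h0 _ (by rw [map_sub, map_zsmul, hω, smul_eq_mul, mul_one, sub_self])).mul_left (hz _)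
  rw [← sub_eq_zero]
  refine Finsupp.lhom_ext' fun l => LinearMap.ext fun v => ?_
  change (dl α f q t * dl α f q t - (q • dl α f q t + 1)) (Finsupp.single l v) = 0
  have e : Finsupp.single l v = shift 𝕜 N l (Finsupp.single 0 v) := by rw [shift_single, add_zero]
  have e0 : (dl α f q t * dl α f q t - (q • dl α f q t + 1)) (Finsupp.single 0 v) = 0 := by
    have := LinearMap.congr_fun ht v
    simp only [Module.End.mul_apply, LinearMap.add_apply, LinearMap.smul_apply,
      Module.End.one_apply] at this
    simp only [LinearMap.sub_apply, Module.End.mul_apply, LinearMap.add_apply,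
      LinearMap.smul_apply, Module.End.one_apply, dl_single_zero, this, Finsupp.single_add,
      Finsupp.smul_single, sub_self]
  rw [e, ← Module.End.mul_apply, ← (h1 l).eq, Module.End.mul_apply, e0, map_zero]

end

/-! ### Extension of braid relations from `N` to `N[Λ]` -/

section Family

variable {𝕜 Λ N J : Type*} [CommRing 𝕜] [AddCommGroup Λ] [AddCommGroup N] [Module 𝕜 N]
  {α : J → Λ} {f : J → Λ →+ ℤ} {q : J → 𝕜} {t : J → Module.End 𝕜 N}

theorem mul_sub_smul_one {M : Type*} [AddCommGroup M] [Module 𝕜 M] {T : Module.End 𝕜 M} {c : 𝕜}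
    (h : T * T = c • T + 1) : T * (T - c • 1) = 1 ∧ (T - c • 1) * T = 1 ∧
      (T - c • 1) * (T - c • 1) = (-c) • (T - c • 1) + 1 := by
  have h1 : T * (T - c • 1) = 1 := by
    rw [mul_sub, h, mul_smul_comm, mul_one, add_sub_cancel_left]
  refine ⟨h1, ?_, ?_⟩
  · rw [sub_mul, h, smul_mul_assoc, one_mul, add_sub_cancel_left]
  · rw [sub_mul, h1, smul_mul_assoc, one_mul, neg_smul]
    abel

/-- The Demazure–Lusztig operators satisfy the Bernstein relations. -/
def family (hf : ∀ i, f i (α i) = 2) (hω : ∀ i, ∃ ω, f i ω = 1)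
    (ht : ∀ i, t i * t i = q i • t i + 1) : BernsteinFamily 𝕜 Λ (Λ →₀ N) J where
  x := shift 𝕜 N
  T i := dl (α i) (f i) (q i) (t i)
  u i := dl (α i) (f i) (q i) (t i) - q i • 1
  q := q
  α := α
  f := f
  x_add := shift_add
  T_eq i := by rw [sub_add_cancel]
  T_mul_u i := (mul_sub_smul_one (dl_quadratic (hf i) (hω i).choose_spec (ht i))).1
  u_mul_T i := (mul_sub_smul_one (dl_quadratic (hf i) (hω i).choose_spec (ht i))).2.1
  u_mul_u i := (mul_sub_smul_one (dl_quadratic (hf i) (hω i).choose_spec (ht i))).2.2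
  comm {i l} h := by
    rw [sub_mul, mul_sub, dl_mul_shift_zero h, smul_mul_assoc, mul_smul_comm, one_mul, mul_one]
  one {i l} h := by
    rw [sub_mul, dl_mul_shift_one h, smul_mul_assoc, one_mul, add_sub_cancel_right]
  two {i l} h := by
    rw [sub_mul, dl_mul_shift, h, geom_two, mul_add, mul_one, ← shift_add, smul_mul_assoc, one_mul,
      smul_add, ← sub_eq_add_neg, add_comm (q i • shift 𝕜 N l), ← add_assoc, add_sub_cancel_right,
      show (2 : ℤ) • α i = 2 • α i from mod_cast natCast_zsmul (α i) 2]
  f_α := hf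

/-- Braid relations on `N` extend to `N[Λ]`. -/
theorem dl_braid (hf : ∀ i, f i (α i) = 2) (hω : ∀ i, ∃ ω, f i ω = 1)
    (ht : ∀ i, t i * t i = q i • t i + 1) {j k : J} {m : ℕ}
    (hq : Odd m → q j = q k)
    (hN : altProd (t j) (t k) m = altProd (t k) (t j) m)
    (hstab : ∀ l, l ∈ (family hf hω ht).stab (braidKer (family hf hω ht).u j k m)) :
    altProd (dl (α j) (f j) (q j) (t j)) (dl (α k) (f k) (q k) (t k)) m =
      altProd (dl (α k) (f k) (q k) (t k)) (dl (α j) (f j) (q j) (t j)) m := by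
  have hN' : (⊤ : Submodule 𝕜 N) ≤ braidKer (fun i => t i - q i • 1) j k m :=
    braid_inv (f := t) (fun i => (mul_sub_smul_one (ht i)).1)
      (fun i => (mul_sub_smul_one (ht i)).2.1) (fun _ _ _ _ => Submodule.mem_top)
      (fun v _ => mem_braidKer.mpr (LinearMap.congr_fun hN v))
  have halt : ∀ (a b : J) (p : ℕ) (v : N),
      altProd ((family hf hω ht).u a) ((family hf hω ht).u b) p (Finsupp.single 0 v) =
        Finsupp.single 0 (altProd (t a - q a • 1) (t b - q b • 1) p v) := by
    intro a b p v
    induction p generalizing a b with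
    | zero => rfl
    | succ p ih =>
      rw [altProd, altProd, Module.End.mul_apply, Module.End.mul_apply, ih]
      change (dl (α a) (f a) (q a) (t a) - q a • 1) _ = _
      rw [LinearMap.sub_apply, LinearMap.sub_apply, dl_single_zero, Finsupp.single_sub]
      simp
  -- The inverses satisfy the braid relation on `X^0 ⊗ N`, which generates the module under the
  -- `X^l`, and these preserve the kernel by `hstab`.
  have htop : (⊤ : Submodule 𝕜 (Λ →₀ N)) ≤ braidKer (family hf hω ht).u j k m := by
    intro v _
    induction v using Finsupp.induction_linear with
    | zero => exact zero_mem _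
    | add v w hv hw => exact add_mem (hv trivial) (hw trivial)
    | single l v =>
      have e : Finsupp.single l v = shift 𝕜 N l (Finsupp.single 0 v) := by
        rw [shift_single, add_zero]
      rw [e]
      refine hstab l _ ?_
      rw [mem_braidKer, halt, halt]
      exact congrArg _ (mem_braidKer.mp (hN' Submodule.mem_top))
  ext1 v
  exact LinearMap.ext fun w =>
    BernsteinFamily.T_braid (B := family hf hω ht) hq (htop (x := Finsupp.single v w)
      Submodule.mem_top)

end Family

end DemazureLusztig

end

noncomputable section

namespace AffineRootDatum

section Representation

variable {ι V : Type*} [NormedAddCommGroup V] [InnerProductSpace ℝ V] (D : AffineRootDatum ι V)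

/-! ### The action of `Ω` on the simple affine roots -/

/-- The index `u_j` with `u a_j = a_{u_j}`. -/
def nodeAct (u : D.Ω) (j : D.Node) : D.Node := (D.exists_actFn_simple u.2 j).choose

theorem actFn_Ω (u : D.Ω) (j : D.Node) :
    actFn (u : V ≃ᵃ[ℝ] V) (D.simpleAffineRoot j) = D.simpleAffineRoot (D.nodeAct u j) :=
  (D.exists_actFn_simple u.2 j).choose_spec

variable {D} in
theorem eq_nodeAct {u : D.Ω} {j k : D.Node}
    (h : actFn (u : V ≃ᵃ[ℝ] V) (D.simpleAffineRoot j) = D.simpleAffineRoot k) :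
    k = D.nodeAct u j :=
  D.linearIndependent_simpleAffineRoot.injective (h.symm.trans (D.actFn_Ω u j))

theorem nodeAct_one (j : D.Node) : D.nodeAct 1 j = j := (eq_nodeAct rfl).symm

theorem nodeAct_mul (u u' : D.Ω) (j : D.Node) :
    D.nodeAct (u * u') j = D.nodeAct u (D.nodeAct u' j) := by
  refine (eq_nodeAct ?_).symm
  rw [Subgroup.coe_mul, actFn_mul, actFn_Ω, actFn_Ω]

theorem nodeAct_inv_nodeAct (u : D.Ω) (j : D.Node) : D.nodeAct u⁻¹ (D.nodeAct u j) = j := by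
  rw [← nodeAct_mul, inv_mul_cancel, nodeAct_one]

/-- The inclusion of `Ω` in `W`. -/
def ΩW (u : D.Ω) : D.W := ⟨u, u.2.1⟩

theorem ΩW_mul (u u' : D.Ω) : D.ΩW (u * u') = D.ΩW u * D.ΩW u' := rfl

theorem ΩW_mul_sW (u : D.Ω) (j : D.Node) :
    D.ΩW u * D.sW j = D.sW (D.nodeAct u j) * D.ΩW u :=
  Subtype.ext (mul_inv_eq_iff_eq_mul.mp (D.conj_s u.2.1 (D.actFn_Ω u j)))

theorem pos_ΩW_mul (u : D.Ω) (w : D.W) (j : D.Node) :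
    D.signSystem.pos (D.ΩW u * w)⁻¹ (D.nodeAct u j) ↔ D.signSystem.pos w⁻¹ j := by
  have : D.rootImage (D.ΩW u * w)⁻¹ (D.nodeAct u j) = D.rootImage w⁻¹ j := by
    have e : ((D.ΩW u * w)⁻¹ : D.W) = w⁻¹ * D.ΩW u⁻¹ := mul_inv_rev _ _
    rw [rootImage, e, Subgroup.coe_mul, actFn_mul]
    change actFn _ (actFn ((u⁻¹ : D.Ω) : V ≃ᵃ[ℝ] V) _) = _
    rw [actFn_Ω, nodeAct_inv_nodeAct]
    rfl
  change 0 < _ ↔ 0 < _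
  rw [this]

theorem linear_root_Ω (u : D.Ω) (j : D.Node) :
    (u : V ≃ᵃ[ℝ] V).linear (D.Φ.root (D.nodeIdx j)) = D.Φ.root (D.nodeIdx (D.nodeAct u j)) :=
  D.linear_root_of_actFn u.2.1 (D.actFn_Ω u j)

variable {D} in
theorem τ_eq {v : V ≃ₗ[ℝ] V} (hv : v ∈ D.W₀) {j k : D.Node}
    (h : v (D.Φ.root (D.nodeIdx j)) = D.Φ.root (D.nodeIdx k)) :
    D.τ j = D.τ k ∧ D.τinv j = D.τinv k := by
  have : Quotient.mk D.rootSetoid (D.nodeIdx j) = Quotient.mk D.rootSetoid (D.nodeIdx k) :=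
    Quotient.sound ⟨v, hv, h⟩
  simp only [τ, τinv, this, and_self]

/-- The parameter `τ_j - τ_j⁻¹` of the quadratic relation. -/
def q (j : D.Node) : D.𝕃 := D.τ j - D.τinv j

theorem q_nodeAct (u : D.Ω) (j : D.Node) : D.q (D.nodeAct u j) = D.q j := by
  obtain ⟨h1, h2⟩ := τ_eq (D.linear_mem_W₀ u.2.1) (D.linear_root_Ω u j)
  rw [q, q, h1, h2]

/-! ### The lattice of the representation -/

/-- The additive map `λ ↦ ⟪λ, α_j^∨⟫` on `P`. -/
def pairHom (j : D.Node) : D.P →+ ℤ :=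
  AddMonoidHom.mk' (fun x => D.corootPairing x j) fun x y => by
    have : (D.corootPairing (x + y) j : ℝ) = D.corootPairing x j + D.corootPairing y j := by
      rw [corootPairing_eq, corootPairing_eq, corootPairing_eq, ← inner_add_left]
      rfl
    exact_mod_cast this

variable {D} in
theorem corootPairing_αP {j k : D.Node} {n : ℤ}
    (h : ⟪D.Φ.root (D.nodeIdx j), D.Φ.coroot (D.nodeIdx k)⟫ = n) :
    D.corootPairing (D.αP j) k = n := by
  rw [corootPairing]
  change ⌊⟪D.Φ.root (D.nodeIdx j), _⟫⌋ = n
  rw [h, Int.floor_intCast]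

theorem gradAct_add (w : D.W) (x y : D.P) :
    D.gradAct w (x + y) = D.gradAct w x + D.gradAct w y :=
  Subtype.ext (map_add (w : V ≃ᵃ[ℝ] V).linear (x : V) y)

theorem corootPairing_gradAct (u : D.Ω) (x : D.P) (j : D.Node) :
    D.corootPairing (D.gradAct (D.ΩW u) x) (D.nodeAct u j) = D.corootPairing x j := by
  have := D.linear_coroot u.2.1 (D.linear_root_Ω u j)
  rw [corootPairing, corootPairing, ← this]
  exact congrArg _ (D.linear_inner u.2.1 _ _)

/-- The lattice `P × ℤ^{n+1}`, in which the simple roots have fundamental weights. -/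
abbrev Lat : Type _ := D.P × (D.Node → ℤ)

/-- The simple roots in the extended lattice. -/
def latRoot (j : D.Node) : D.Lat := (D.αP j, 0)

/-- The simple coroots of the extended lattice. -/
def latCoroot (j : D.Node) : D.Lat →+ ℤ :=
  (D.pairHom j).coprod (Pi.evalAddMonoidHom (fun _ => ℤ) j)

theorem latCoroot_apply (j : D.Node) (l : D.Lat) :
    D.latCoroot j l = D.corootPairing l.1 j + l.2 j := rfl

variable {D} in
theorem latCoroot_latRoot {j k : D.Node} {n : ℤ}
    (h : ⟪D.Φ.root (D.nodeIdx j), D.Φ.coroot (D.nodeIdx k)⟫ = n) :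
    D.latCoroot k (D.latRoot j) = n := by
  rw [latCoroot_apply, latRoot, corootPairing_αP h]
  exact add_zero n

theorem latCoroot_latRoot_self (j : D.Node) : D.latCoroot j (D.latRoot j) = 2 :=
  latCoroot_latRoot (by rw [inner_root_coroot]; norm_num)

open scoped Classical in
/-- Fundamental weights in the extended lattice. -/
def latWeight (j : D.Node) : D.Lat := (0, Pi.single j 1)

theorem latCoroot_latWeight_self (j : D.Node) : D.latCoroot j (D.latWeight j) = 1 := by
  have : D.corootPairing 0 j = 0 := map_zero (D.pairHom j)
  simp [latCoroot_apply, latWeight, this]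

theorem latCoroot_latWeight {j k : D.Node} (h : j ≠ k) : D.latCoroot k (D.latWeight j) = 0 := by
  have : D.corootPairing 0 k = 0 := map_zero (D.pairHom k)
  simp [latCoroot_apply, latWeight, this, h.symm]

/-- The action of `Ω` on the extended lattice. -/
def latAct (u : D.Ω) : D.Lat →+ D.Lat :=
  AddMonoidHom.mk' (fun l => (D.gradAct (D.ΩW u) l.1, fun j => l.2 (D.nodeAct u⁻¹ j)))
    fun _ _ => Prod.ext (D.gradAct_add _ _ _) rfl

theorem latAct_apply (u : D.Ω) (l : D.Lat) :
    D.latAct u l = (D.gradAct (D.ΩW u) l.1, fun j => l.2 (D.nodeAct u⁻¹ j)) := rfl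

theorem latAct_one (l : D.Lat) : D.latAct 1 l = l := by
  refine Prod.ext rfl (funext fun j => ?_)
  rw [latAct_apply]
  simp only [inv_one, nodeAct_one]

theorem latAct_mul (u u' : D.Ω) (l : D.Lat) :
    D.latAct (u * u') l = D.latAct u (D.latAct u' l) := by
  refine Prod.ext rfl (funext fun j => ?_)
  simp only [latAct_apply, mul_inv_rev, nodeAct_mul]

theorem latCoroot_latAct (u : D.Ω) (l : D.Lat) (j : D.Node) :
    D.latCoroot (D.nodeAct u j) (D.latAct u l) = D.latCoroot j l := by
  simp only [latCoroot_apply, latAct_apply, corootPairing_gradAct, nodeAct_inv_nodeAct]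

theorem latAct_latRoot (u : D.Ω) (j : D.Node) :
    D.latAct u (D.latRoot j) = D.latRoot (D.nodeAct u j) :=
  Prod.ext (Subtype.ext (D.linear_root_Ω u j)) rfl

/-! ### The representation -/

open DemazureLusztig

/-- The regular module of the Hecke algebra of `W`. -/
def RegMod : Type _ := D.W →₀ D.𝕃

instance : AddCommGroup D.RegMod := inferInstanceAs (AddCommGroup (D.W →₀ D.𝕃))

instance : Module D.𝕃 D.RegMod := inferInstanceAs (Module D.𝕃 (D.W →₀ D.𝕃))

/-- The standard basis of the regular module. -/
def regBasis (w : D.W) : D.RegMod := Finsupp.single w (1 : D.𝕃)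

variable {D} in
theorem regMod_ext {M : Type*} [AddCommMonoid M] [Module D.𝕃 M] {f g : D.RegMod →ₗ[D.𝕃] M}
    (h : ∀ w, f (D.regBasis w) = g (D.regBasis w)) : f = g :=
  Finsupp.lhom_ext' (α := D.W) (M := D.𝕃) fun w => LinearMap.ext_ring (h w)

/-- The action of `T_j` on the regular module. -/
def regT (j : D.Node) : Module.End D.𝕃 D.RegMod := D.signSystem.regular D.q j

variable {D} in
theorem regT_of_pos {j : D.Node} {w : D.W} (h : D.signSystem.pos w⁻¹ j) :
    D.regT j (D.regBasis w) = D.regBasis (D.sW j * w) :=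
  D.signSystem.regular_of_pos D.q h

variable {D} in
theorem regT_of_not_pos {j : D.Node} {w : D.W} (h : ¬ D.signSystem.pos w⁻¹ j) :
    D.regT j (D.regBasis w) = D.regBasis (D.sW j * w) + D.q j • D.regBasis w :=
  D.signSystem.regular_of_not_pos D.q h

theorem regT_quadratic (j : D.Node) : D.regT j * D.regT j = D.q j • D.regT j + 1 :=
  D.signSystem.regular_quadratic D.q j

variable {D} in
theorem regT_braid {j k : D.Node} (hq : Odd (orderOf (D.s j * D.s k)) → D.q j = D.q k) :
    altProd (D.regT j) (D.regT k) (orderOf (D.s j * D.s k)) =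
      altProd (D.regT k) (D.regT j) (orderOf (D.s j * D.s k)) := by
  have := D.signSystem.regular_braid D.q (j := j) (k := k)
  simp only [signSystem_s, orderOf_sW_mul] at this
  exact this hq

/-- Left multiplication by an element of `Ω` on the regular module. -/
def leftMul (u : D.Ω) : Module.End D.𝕃 D.RegMod :=
  Finsupp.lmapDomain D.𝕃 D.𝕃 (D.ΩW u * ·)

theorem leftMul_regBasis (u : D.Ω) (w : D.W) :
    D.leftMul u (D.regBasis w) = D.regBasis (D.ΩW u * w) :=
  Finsupp.mapDomain_single

theorem leftMul_regT (u : D.Ω) (j : D.Node) :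
    D.leftMul u * D.regT j = D.regT (D.nodeAct u j) * D.leftMul u := by
  refine regMod_ext fun w => ?_
  rw [Module.End.mul_apply, Module.End.mul_apply]
  have e : D.ΩW u * (D.sW j * w) = D.sW (D.nodeAct u j) * (D.ΩW u * w) := by
    rw [← mul_assoc, ← mul_assoc, ΩW_mul_sW]
  by_cases h : D.signSystem.pos w⁻¹ j
  · rw [leftMul_regBasis, regT_of_pos h, regT_of_pos ((D.pos_ΩW_mul u w j).mpr h),
      leftMul_regBasis, e]
  · rw [leftMul_regBasis, regT_of_not_pos h, regT_of_not_pos (mt (D.pos_ΩW_mul u w j).mp h),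
      map_add, map_smul, leftMul_regBasis, leftMul_regBasis, e, q_nodeAct]

/-- The regular module with the lattice adjoined. -/
abbrev Mod : Type _ := D.Lat →₀ D.RegMod

/-- The operator by which `T_j` acts. -/
def opT (j : D.Node) : Module.End D.𝕃 D.Mod :=
  dl (D.latRoot j) (D.latCoroot j) (D.q j) (D.regT j)

/-- The operator by which `T_u` acts. -/
def opU (u : D.Ω) : Module.End D.𝕃 D.Mod :=
  Finsupp.lsum D.𝕃 fun l => Finsupp.lsingle (D.latAct u l) ∘ₗ D.leftMul u

theorem opU_single (u : D.Ω) (l : D.Lat) (v : D.RegMod) :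
    D.opU u (Finsupp.single l v) = Finsupp.single (D.latAct u l) (D.leftMul u v) := by
  simp [opU]

theorem opU_one : D.opU 1 = 1 := by
  refine Finsupp.lhom_ext' fun l => regMod_ext fun w => ?_
  change D.opU 1 (Finsupp.single l (D.regBasis w)) = Finsupp.single l (D.regBasis w)
  rw [opU_single, leftMul_regBasis, latAct_one, show D.ΩW 1 * w = w from one_mul w]

theorem opU_mul (u u' : D.Ω) : D.opU u * D.opU u' = D.opU (u * u') := by
  refine Finsupp.lhom_ext' fun l => regMod_ext fun w => ?_
  change D.opU u (D.opU u' (Finsupp.single l (D.regBasis w))) =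
    D.opU (u * u') (Finsupp.single l (D.regBasis w))
  simp only [opU_single, leftMul_regBasis, latAct_mul, ΩW_mul, mul_assoc]

theorem opU_mul_shift (u : D.Ω) (l : D.Lat) : D.opU u * shift D.𝕃 D.RegMod l =
    shift D.𝕃 D.RegMod (D.latAct u l) * D.opU u := by
  refine Finsupp.lhom_ext' fun m => LinearMap.ext fun v => ?_
  change D.opU u (shift D.𝕃 D.RegMod l (Finsupp.single m v)) =
    shift D.𝕃 D.RegMod (D.latAct u l) (D.opU u (Finsupp.single m v))
  simp only [opU_single, shift_single, map_add]

theorem opU_mul_geom (u : D.Ω) (j : D.Node) (n : ℤ) :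
    D.opU u * geom D.𝕃 D.RegMod (D.latRoot j) n =
      geom D.𝕃 D.RegMod (D.latRoot (D.nodeAct u j)) n * D.opU u := by
  simp only [geom, mul_sub, sub_mul, Finset.mul_sum, Finset.sum_mul, opU_mul_shift, map_neg,
    map_nsmul, latAct_latRoot]

theorem opU_mul_opT (u : D.Ω) (j : D.Node) :
    D.opU u * D.opT j = D.opT (D.nodeAct u j) * D.opU u := by
  refine Finsupp.lhom_ext' fun l => LinearMap.ext fun v => ?_
  change D.opU u (D.opT j (Finsupp.single l v)) =
    D.opT (D.nodeAct u j) (D.opU u (Finsupp.single l v))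
  have h1 := LinearMap.congr_fun (D.opU_mul_geom u j (D.latCoroot j l)) (Finsupp.single l v)
  have h2 := LinearMap.congr_fun (D.leftMul_regT u j) v
  simp only [Module.End.mul_apply] at h1 h2
  rw [opU_single, opT, opT, dl_single, dl_single, map_add, map_smul, h1, opU_single, opU_single,
    h2, map_sub, map_zsmul, latAct_latRoot, latCoroot_latAct, q_nodeAct]

theorem opT_quadratic (j : D.Node) : D.opT j * D.opT j = D.q j • D.opT j + 1 :=
  dl_quadratic (D.latCoroot_latRoot_self j) (D.latCoroot_latWeight_self j)
    (D.regT_quadratic j)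

/-- In type `A₂` the element `s_j' s_k'` maps `α_j` to `α_k`, so both indeterminates belong to one
orbit. Order `3` is the only odd order that occurs. -/
theorem q_eq_of_cartan {j k : D.Node}
    (h1 : ⟪D.Φ.root (D.nodeIdx k), D.Φ.coroot (D.nodeIdx j)⟫ = -1)
    (h2 : ⟪D.Φ.root (D.nodeIdx j), D.Φ.coroot (D.nodeIdx k)⟫ = -1) : D.q j = D.q k := by
  have hv : ∀ i, D.refl i ∈ D.W₀ := fun i => Subgroup.subset_closure ⟨i, rfl⟩
  have e : (D.refl (D.nodeIdx j) * D.refl (D.nodeIdx k)) (D.Φ.root (D.nodeIdx j)) =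
      D.Φ.root (D.nodeIdx k) := by
    rw [LinearEquiv.mul_apply, refl_apply' D (D.nodeIdx k), h2, refl_apply', inner_sub_left,
      inner_smul_left, h1, inner_root_coroot]
    simp only [conj_trivial]
    module
  obtain ⟨e1, e2⟩ := τ_eq (mul_mem (hv _) (hv _)) e
  rw [q, q, e1, e2]

/-- In the orders `4` and `6` the fundamental weight used is that of the shorter root, and
`braidKer_comm` exchanges the nodes accordingly. For infinite order, `orderOf` is `0` and both words
are empty. -/
theorem opT_braid {j k : D.Node} (hjk : j ≠ k) :
    altProd (D.opT j) (D.opT k) (orderOf (D.s j * D.s k)) =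
      altProd (D.opT k) (D.opT j) (orderOf (D.s j * D.s k)) := by
  obtain ⟨b, c, hb, hc, hm⟩ := D.orderOf_cases hjk
  have fb : D.latCoroot j (D.latRoot k) = -b := latCoroot_latRoot (by rw [hb]; simp)
  have fc : D.latCoroot k (D.latRoot j) = -c := latCoroot_latRoot (by rw [hc]; simp)
  have hf := D.latCoroot_latRoot_self
  have hω : ∀ i, ∃ ω, D.latCoroot i ω = 1 := fun i => ⟨_, D.latCoroot_latWeight_self i⟩
  have ht := D.regT_quadratic
  have wj := D.latCoroot_latWeight_self j
  have wk := D.latCoroot_latWeight_self k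
  have wjk := D.latCoroot_latWeight hjk
  have wkj := D.latCoroot_latWeight hjk.symm
  have hq : Odd (orderOf (D.s j * D.s k)) → D.q j = D.q k := by
    intro hodd
    rcases hm with ⟨-, -, h⟩ | ⟨rfl, rfl, -⟩ | ⟨-, -, h⟩ | ⟨-, -, h⟩ | ⟨-, -, h⟩ | ⟨-, -, h⟩ | h
    · rw [h] at hodd; exact absurd hodd (by decide)
    · exact D.q_eq_of_cartan (by rw [hb]; simp) (by rw [hc]; simp)
    all_goals rw [h] at hodd; exact absurd hodd (by decide)
  refine dl_braid hf hω ht hq (regT_braid hq) fun l => ?_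
  rcases hm with ⟨rfl, rfl, h⟩ | ⟨rfl, rfl, h⟩ | ⟨rfl, rfl, h⟩ | ⟨rfl, rfl, h⟩ | ⟨rfl, rfl, h⟩ |
    ⟨rfl, rfl, h⟩ | h <;> rw [h] at hq ⊢
  · exact BernsteinFamily.stab_two (B := family hf hω ht) fb fc wj wjk wkj wk l
  · exact BernsteinFamily.stab_three (B := family hf hω ht) (hq (by decide)) fb fc wj wjk l
  · rw [braidKer_comm]
    exact BernsteinFamily.stab_four (B := family hf hω ht) fc fb wk wkj l
  · exact BernsteinFamily.stab_four (B := family hf hω ht) fb fc wj wjk l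
  · rw [braidKer_comm]
    exact BernsteinFamily.stab_six (B := family hf hω ht) fc fb wk wkj l
  · exact BernsteinFamily.stab_six (B := family hf hω ht) fb fc wj wjk l
  · exact fun v _ => mem_braidKer.mpr rfl

/-! ### Elements of the group algebra of the weight lattice -/

theorem fElem_single (x : D.P) (r : D.𝕃) :
    D.fElem (AddMonoidAlgebra.single x r) = r • D.fX x :=
  Finsupp.sum_single_index (zero_smul _ _)

/-- The map from `𝕃[P]` to the free algebra, as an additive map. -/
def fElemHom : D.𝕃P →+ D.Free :=
  AddMonoidHom.mk' D.fElem fun _ _ =>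
    Finsupp.sum_add_index' (fun _ => zero_smul _ _) fun _ _ _ => add_smul _ _ _

theorem fElem_demazure (j : D.Node) (x : D.P) : D.fElem (D.demazure j x) =
    ∑ i ∈ Finset.range (D.corootPairing x j).toNat, D.fX (x - i • D.αP j) -
      ∑ i ∈ Finset.range (-D.corootPairing x j).toNat, D.fX (x + (i + 1) • D.αP j) := by
  have h : ∀ y, D.fElemHom (AddMonoidAlgebra.single y 1) = D.fX y := fun y =>
    (D.fElem_single y 1).trans (one_smul _ _)
  change D.fElemHom _ = _
  simp only [demazure, map_sub, map_sum, h]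

theorem map_altProd {A B F : Type*} [Monoid A] [Monoid B] [FunLike F A B] [MonoidHomClass F A B]
    (φ : F) (a b : A) (m : ℕ) : φ (altProd a b m) = altProd (φ a) (φ b) m := by
  induction m generalizing a b with
  | zero => exact map_one φ
  | succ m ih => rw [altProd, altProd, map_mul, ih]

/-- The operators by which the generators act. -/
def opGen : D.Gen → Module.End D.𝕃 D.Mod
  | .T j => D.opT j
  | .U u => D.opU u
  | .X x => shift D.𝕃 D.RegMod (x, 0)

theorem lift_opGen_fT (j : D.Node) : FreeAlgebra.lift D.𝕃 D.opGen (D.fT j) = D.opT j :=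
  FreeAlgebra.lift_ι_apply _ _

theorem lift_opGen_fU (u : D.Ω) : FreeAlgebra.lift D.𝕃 D.opGen (D.fU u) = D.opU u :=
  FreeAlgebra.lift_ι_apply _ _

theorem lift_opGen_fX (x : D.P) :
    FreeAlgebra.lift D.𝕃 D.opGen (D.fX x) = shift D.𝕃 D.RegMod (x, 0) :=
  FreeAlgebra.lift_ι_apply _ _

theorem lift_opGen_rel {a b : D.Free} (h : D.Rel a b) :
    FreeAlgebra.lift D.𝕃 D.opGen a = FreeAlgebra.lift D.𝕃 D.opGen b := by
  cases h with
  | U_one => rw [lift_opGen_fU, map_one, opU_one]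
  | U_mul u u' => rw [map_mul, lift_opGen_fU, lift_opGen_fU, lift_opGen_fU, opU_mul]
  | U_T u j k h =>
    rw [map_mul, map_mul, lift_opGen_fU, lift_opGen_fT, lift_opGen_fT, eq_nodeAct h, opU_mul_opT]
  | quadratic j =>
    have h : D.τ j • D.opT j = D.q j • D.opT j + D.τinv j • D.opT j := by
      rw [← add_smul, q, sub_add_cancel]
    rw [map_mul, map_sub, map_add, AlgHom.commutes, AlgHom.commutes, lift_opGen_fT, map_zero,
      Algebra.algebraMap_eq_smul_one, Algebra.algebraMap_eq_smul_one, sub_mul, mul_add,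
      opT_quadratic, mul_smul_comm, mul_one, smul_mul_assoc, one_mul, smul_add, smul_smul,
      τ_mul_τinv, one_smul, h]
    abel
  | braid j k h =>
    rw [map_altProd, map_altProd, lift_opGen_fT, lift_opGen_fT, D.opT_braid h]
  | U_X u x =>
    rw [map_mul, map_mul, lift_opGen_fU, lift_opGen_fX, lift_opGen_fX, opU_mul_shift]
    rfl
  | T_X j x =>
    -- On `P × 0` the extended pairing and reflection restrict to the original ones, so the relation
    -- is an instance of `dl_mul_shift`.
    have e1 : ((x, 0) : D.Lat) - D.latCoroot j (x, 0) • D.latRoot j = (D.reflP j x, 0) := by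
      rw [latCoroot_apply, reflP_eq]
      refine Prod.ext ?_ ?_ <;> simp [latRoot]
    have e2 : D.latCoroot j (x, 0) = D.corootPairing x j := by
      exact add_zero (D.corootPairing x j)
    have e3 : ∀ i : ℕ, ((x, 0) : D.Lat) + -(i • D.latRoot j) = (x - i • D.αP j, 0) := by
      intro i
      refine Prod.ext ?_ ?_ <;> simp [latRoot, sub_eq_add_neg]
    have e4 : ∀ i : ℕ, ((x, 0) : D.Lat) + i • D.latRoot j = (x + i • D.αP j, 0) := by
      intro i
      refine Prod.ext ?_ ?_ <;> simp [latRoot]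
    rw [map_mul, map_add, map_mul, map_smul, lift_opGen_fT, lift_opGen_fX, lift_opGen_fX,
      fElem_demazure, map_sub, map_sum, map_sum, opT, dl_mul_shift, e1, e2]
    simp only [lift_opGen_fX, geom, mul_sub, Finset.mul_sum, ← shift_add, e3, e4]
    rfl
  | X_zero => rw [lift_opGen_fX, map_one]; exact shift_zero
  | X_add x y =>
    rw [map_mul, lift_opGen_fX, lift_opGen_fX, lift_opGen_fX, ← shift_add, Prod.mk_add_mk,
      add_zero]

/-- The representation of `ℋ` on the regular module with the lattice adjoined. -/
def rep : D.H →ₐ[D.𝕃] Module.End D.𝕃 D.Mod :=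
  RingQuot.liftAlgHom D.𝕃 ⟨FreeAlgebra.lift D.𝕃 D.opGen, fun _ _ => D.lift_opGen_rel⟩

theorem rep_toH (a : D.Free) : D.rep (D.toH a) = FreeAlgebra.lift D.𝕃 D.opGen a :=
  RingQuot.liftAlgHom_mkAlgHom_apply _ _ _ _

theorem rep_T (j : D.Node) : D.rep (D.T j) = D.opT j := (D.rep_toH _).trans (D.lift_opGen_fT j)

theorem rep_TΩ (u : D.Ω) : D.rep (D.TΩ u) = D.opU u := (D.rep_toH _).trans (D.lift_opGen_fU u)

theorem rep_X (x : D.P) : D.rep (D.X x) = shift D.𝕃 D.RegMod (x, 0) :=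
  (D.rep_toH _).trans (D.lift_opGen_fX x)

end Representation

end AffineRootDatum

end

noncomputable section

namespace AffineRootDatum

section Basis

variable {ι V : Type*} [NormedAddCommGroup V] [InnerProductSpace ℝ V] (D : AffineRootDatum ι V)

/-! ### Relations in `ℋ` -/

theorem TΩ_one : D.TΩ 1 = 1 := (D.toH_rel .U_one).trans (map_one _)

theorem TΩ_mul (u u' : D.Ω) : D.TΩ u * D.TΩ u' = D.TΩ (u * u') :=
  (map_mul _ _ _).symm.trans (D.toH_rel (.U_mul u u'))

theorem X_zero : D.X 0 = 1 := (D.toH_rel .X_zero).trans (map_one _)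

theorem X_mul (x y : D.P) : D.X x * D.X y = D.X (x + y) :=
  (map_mul _ _ _).symm.trans (D.toH_rel (.X_add x y))

theorem TΩ_mul_T (u : D.Ω) (j : D.Node) : D.TΩ u * D.T j = D.T (D.nodeAct u j) * D.TΩ u :=
  (map_mul _ _ _).symm.trans ((D.toH_rel (.U_T u j _ (D.actFn_Ω u j))).trans (map_mul _ _ _))

theorem TΩ_mul_X (u : D.Ω) (x : D.P) :
    D.TΩ u * D.X x = D.X (D.gradAct (D.ΩW u) x) * D.TΩ u :=
  (map_mul _ _ _).symm.trans ((D.toH_rel (.U_X u x)).trans (map_mul _ _ _))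

theorem T_mul_T (j : D.Node) : D.T j * D.T j = D.q j • D.T j + 1 := by
  have h := D.toH_rel (.quadratic j)
  rw [map_mul, map_sub, map_add, AlgHom.commutes, AlgHom.commutes, map_zero] at h
  change (D.T j - _) * (D.T j + _) = 0 at h
  have h1 : D.τ j • D.T j = D.q j • D.T j + D.τinv j • D.T j := by
    rw [← add_smul, q, sub_add_cancel]
  rw [Algebra.algebraMap_eq_smul_one, Algebra.algebraMap_eq_smul_one, sub_mul, mul_add,
    mul_smul_comm, mul_one, smul_mul_assoc, one_mul, smul_add, smul_smul, τ_mul_τinv, one_smul,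
    h1, sub_eq_zero] at h
  refine add_right_cancel (h.trans ?_)
  abel

theorem T_braid {j k : D.Node} (h : j ≠ k) :
    altProd (D.T j) (D.T k) (orderOf (D.s j * D.s k)) =
      altProd (D.T k) (D.T j) (orderOf (D.s j * D.s k)) :=
  (map_altProd D.toH _ _ _).symm.trans ((D.toH_rel (.braid j k h)).trans (map_altProd D.toH _ _ _))

/-- The image in `ℋ` of the quotient `(X^λ - X^{s_j' λ}) / (1 - X^{-α_j})`. -/
def dem (j : D.Node) (x : D.P) : D.H :=
  ∑ i ∈ Finset.range (D.corootPairing x j).toNat, D.X (x - i • D.αP j) -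
    ∑ i ∈ Finset.range (-D.corootPairing x j).toNat, D.X (x + (i + 1) • D.αP j)

theorem T_mul_X (j : D.Node) (x : D.P) :
    D.T j * D.X x = D.X (D.reflP j x) * D.T j + D.q j • D.dem j x := by
  have h := D.toH_rel (.T_X j x)
  rw [map_mul, map_add, map_mul, map_smul, fElem_demazure, map_sub, map_sum, map_sum] at h
  exact h

theorem corootPairing_reflP (j : D.Node) (x : D.P) :
    D.corootPairing (D.reflP j x) j = -D.corootPairing x j := by
  have h2 : D.pairHom j (D.αP j) = 2 :=
    corootPairing_αP (by rw [inner_root_coroot]; norm_num)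
  rw [reflP_eq]
  change D.pairHom j _ = -D.pairHom j x
  rw [map_sub, map_zsmul, h2]
  change D.pairHom j x - D.pairHom j x • 2 = _
  rw [smul_eq_mul]
  ring

theorem reflP_reflP (j : D.Node) (x : D.P) : D.reflP j (D.reflP j x) = x := by
  rw [reflP_eq D j (D.reflP j x), corootPairing_reflP, reflP_eq, neg_smul, sub_neg_eq_add,
    sub_add_cancel]

/-- The numerator of the quotient is antisymmetric in `λ` and `s_j' λ`. On the explicit sums this
amounts to reversing the order of summation. -/
theorem dem_reflP (j : D.Node) (x : D.P) : D.dem j (D.reflP j x) = -D.dem j x := by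
  have key : ∀ (n : ℕ) (y : D.P), ∑ i ∈ Finset.range n, D.X (y - n • D.αP j + (i + 1) • D.αP j) =
      ∑ i ∈ Finset.range n, D.X (y - i • D.αP j) := by
    intro n y
    rw [← Finset.sum_range_reflect]
    refine Finset.sum_congr rfl fun i hi => congrArg _ ?_
    have hi := Finset.mem_range.mp hi
    obtain ⟨m, rfl⟩ : ∃ m, n = m + 1 + i := ⟨n - 1 - i, by omega⟩
    rw [show m + 1 + i - 1 - i + 1 = m + 1 by omega, add_smul]
    abel
  rw [dem, corootPairing_reflP, neg_neg, dem, neg_sub]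
  rcases le_total 0 (D.corootPairing x j) with hn | hn
  · obtain ⟨n, hn'⟩ := Int.eq_ofNat_of_zero_le hn
    rw [reflP_eq, hn', natCast_zsmul]
    have h0 : (-(n : ℤ)).toNat = 0 := by omega
    simp only [h0, Int.toNat_natCast, Finset.range_zero, Finset.sum_empty, key]
  · obtain ⟨n, hn'⟩ := Int.eq_ofNat_of_zero_le (neg_nonneg.mpr hn)
    have hn'' : D.corootPairing x j = -(n : ℤ) := by omega
    have h0 : (-(n : ℤ)).toNat = 0 := by omega
    rw [reflP_eq, hn'', neg_smul, natCast_zsmul, sub_neg_eq_add, neg_neg]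
    simp only [h0, Int.toNat_natCast, Finset.range_zero, Finset.sum_empty, ← key,
      add_sub_cancel_right]

variable {D} in
/-- Induction on elements of `ℋ`. -/
theorem H_induction {p : D.H → Prop} (algebraMap : ∀ r, p (algebraMap D.𝕃 D.H r))
    (T : ∀ j, p (D.T j)) (U : ∀ u, p (D.TΩ u)) (X : ∀ x, p (D.X x))
    (add : ∀ a b, p a → p b → p (a + b)) (mul : ∀ a b, p a → p b → p (a * b)) (h : D.H) : p h := by
  obtain ⟨a, rfl⟩ := RingQuot.mkAlgHom_surjective D.𝕃 D.Rel h
  change p (D.toH a)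
  induction a using FreeAlgebra.induction with
  | grade0 r => rw [AlgHom.commutes]; exact algebraMap r
  | grade1 g =>
    cases g with
    | T j => exact T j
    | U u => exact U u
    | X x => exact X x
  | mul a b ha hb => rw [map_mul]; exact mul _ _ (ha) (hb)
  | add a b ha hb => rw [map_add]; exact add _ _ (ha) (hb)

/-! ### Reduced decompositions -/

/-- The length function of `W`. -/
def len (w : D.W) : ℕ := D.signSystem.len w

/-- The product of simple reflections in a word. -/
def word (l : List D.Node) : D.W := (l.map D.sW).prod

theorem word_cons (j : D.Node) (l : List D.Node) : D.word (j :: l) = D.sW j * D.word l :=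
  D.signSystem.word_cons j l

theorem exists_reduced (w : D.W) :
    ∃ (l : List D.Node) (u : D.Ω), l.length = D.len w ∧ w = D.word l * D.ΩW u := by
  obtain ⟨l, u, hl, h⟩ := D.signSystem.exists_reduced w
  exact ⟨l, ⟨u.1, u.2⟩, hl, h⟩

theorem len_le (l : List D.Node) (u : D.Ω) : D.len (D.word l * D.ΩW u) ≤ l.length :=
  D.signSystem.len_le l ⟨D.ΩW u, u.2⟩

theorem ΩW_mul_word (u : D.Ω) (l : List D.Node) :
    D.ΩW u * D.word l = D.word (l.map (D.nodeAct u)) * D.ΩW u := by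
  induction l with
  | nil => simp [word]
  | cons j l ih =>
    rw [List.map_cons, word_cons, word_cons, ← mul_assoc, ΩW_mul_sW, mul_assoc, ih, mul_assoc]

theorem TΩ_mul_prod (u : D.Ω) (l : List D.Node) :
    D.TΩ u * (l.map D.T).prod = ((l.map (D.nodeAct u)).map D.T).prod * D.TΩ u := by
  induction l with
  | nil => simp
  | cons j l ih =>
    simp only [List.map_cons, List.prod_cons] at ih ⊢
    rw [← mul_assoc, TΩ_mul_T, mul_assoc, ih, mul_assoc]

theorem len_ΩW_mul_word_le (u : D.Ω) (l : List D.Node) : D.len (D.ΩW u * D.word l) ≤ l.length := by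
  rw [ΩW_mul_word, ← List.length_map (D.nodeAct u)]
  exact D.len_le _ _

theorem len_ΩW_mul (u : D.Ω) (w : D.W) : D.len (D.ΩW u * w) = D.len w := by
  have h : ∀ (u : D.Ω) w, D.len (D.ΩW u * w) ≤ D.len w := by
    intro u w
    obtain ⟨l, v, hl, e⟩ := D.exists_reduced w
    rw [← hl, e, ← mul_assoc, ΩW_mul_word, mul_assoc, ← ΩW_mul, ← List.length_map (D.nodeAct u)]
    exact D.len_le _ _
  refine le_antisymm (h u w) ?_
  have := h u⁻¹ (D.ΩW u * w)
  rwa [← mul_assoc, ← ΩW_mul, inv_mul_cancel, show D.ΩW 1 * w = w from one_mul w] at this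

/-- Conjugation by `Ω` permutes the simple reflections, so `u` passes from the right end to the left
end at the cost of relabelling the letters. -/
theorem exists_reduced_left (w : D.W) :
    ∃ (u : D.Ω) (l : List D.Node), l.length = D.len w ∧ w = D.ΩW u * D.word l := by
  obtain ⟨l, u, hl, h⟩ := D.exists_reduced w
  refine ⟨u, l.map (D.nodeAct u⁻¹), by rw [List.length_map, hl], ?_⟩
  rw [ΩW_mul_word, List.map_map, h]
  congr 2
  have : D.nodeAct u ∘ D.nodeAct u⁻¹ = id := by
    funext j
    rw [Function.comp_apply, ← nodeAct_mul, mul_inv_cancel, nodeAct_one, id]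
  rw [this, List.map_id]

variable {D} in
theorem isDecomposition_iff {w : D.W} {u : D.Ω} {l : List D.Node} :
    D.IsDecomposition w u l ↔ w = D.ΩW u * D.word l := by
  rw [IsDecomposition, Subtype.ext_iff, Subgroup.coe_mul, word, coe_prod_sW]
  rfl

variable {D} in
theorem isReducedDecomposition_iff {w : D.W} {u : D.Ω} {l : List D.Node} :
    D.IsReducedDecomposition w u l ↔ w = D.ΩW u * D.word l ∧ l.length = D.len w := by
  simp only [IsReducedDecomposition, isDecomposition_iff]
  refine and_congr_right fun h => ⟨fun hmin => ?_, fun hl u' l' h' => ?_⟩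
  · obtain ⟨u', l', hl', h'⟩ := D.exists_reduced_left w
    refine le_antisymm (hl' ▸ hmin u' l' h') ?_
    rw [h]
    exact D.len_ΩW_mul_word_le u l
  · rw [hl, h']
    exact D.len_ΩW_mul_word_le u' l'

theorem word_inv (l : List D.Node) : (D.word l)⁻¹ = D.word l.reverse := by
  rw [word, word, List.prod_inv_reverse, List.map_map, ← List.map_reverse]
  congr 1
  exact List.map_congr_left fun j _ => D.signSystem.s_inv j

theorem len_inv (w : D.W) : D.len w⁻¹ = D.len w := by
  have h : ∀ w, D.len w⁻¹ ≤ D.len w := by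
    intro w
    obtain ⟨l, u, hl, e⟩ := D.exists_reduced w
    have e' : w⁻¹ = D.ΩW u⁻¹ * D.word l.reverse := by
      rw [← word_inv, e, mul_inv_rev]
      rfl
    rw [e', ← hl, ← List.length_reverse]
    exact D.len_ΩW_mul_word_le _ _
  exact le_antisymm (h w) (by simpa using h w⁻¹)

variable {D} in
-- Peeling first letters off a reduced word reaches every element from `Ω` through length-increasing
-- steps only.
theorem W_induction {p : D.W → Prop} (Ω : ∀ u, p (D.ΩW u))
    (mul : ∀ j w, D.signSystem.pos w⁻¹ j → p w → p (D.sW j * w)) (w : D.W) : p w := by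
  obtain ⟨n, hn⟩ : ∃ n, D.len w = n := ⟨_, rfl⟩
  induction n generalizing w with
  | zero =>
    obtain ⟨l, u, hl, rfl⟩ := D.exists_reduced w
    rw [hn, List.length_eq_zero_iff] at hl
    rw [hl, show D.word [] * D.ΩW u = D.ΩW u from one_mul _]
    exact Ω u
  | succ n ih =>
    obtain ⟨l, u, hl, e⟩ := D.exists_reduced w
    obtain ⟨j, l, rfl⟩ := List.exists_cons_of_length_eq_add_one (hl.trans hn)
    rw [List.length_cons] at hl
    have e' : D.sW j * w = D.word l * D.ΩW u := by
      rw [e, word_cons, mul_assoc]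
      exact D.signSystem.s_mul_s_mul j _
    have hlen : D.len (D.sW j * w) ≤ l.length := e' ▸ D.len_le l u
    have hneg : ¬ D.signSystem.pos w⁻¹ j := by
      intro hpos
      have : D.len (D.sW j * w) = D.len w + 1 := D.signSystem.len_of_pos hpos
      omega
    have h1 : D.len w = D.len (D.sW j * w) + 1 := D.signSystem.len_of_not_pos hneg
    have := mul j (D.sW j * w) ((D.signSystem.pos_inv_s_mul w j).mpr hneg) (ih _ (by omega))
    rwa [show D.sW j * (D.sW j * w) = w from D.signSystem.s_mul_s_mul j w] at this

/-! ### The elements `T_w` -/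

/-- The element `T_w` of `ℋ`. -/
def Tw (w : D.W) : D.H :=
  ((D.exists_reduced w).choose.map D.T).prod * D.TΩ (D.exists_reduced w).choose_spec.choose

variable {D} in
theorem Tw_eq {w : D.W} {l : List D.Node} {u : D.Ω} (hl : l.length = D.len w)
    (h : w = D.word l * D.ΩW u) : D.Tw w = (l.map D.T).prod * D.TΩ u := by
  obtain ⟨hl', h'⟩ := (D.exists_reduced w).choose_spec.choose_spec
  rw [Tw]
  generalize (D.exists_reduced w).choose_spec.choose = u' at *
  generalize (D.exists_reduced w).choose = l' at *
  refine D.signSystem.matsumoto D.T (fun v => D.TΩ ⟨v.1, v.2⟩) (fun j k hjk => ?_)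
    (u := ⟨D.ΩW u', u'.2⟩) (u' := ⟨D.ΩW u, u.2⟩) (h'.symm.trans h) (hl'.trans ?_) (hl.trans ?_)
  · rw [signSystem_s, signSystem_s, orderOf_sW_mul]
    exact D.T_braid hjk
  all_goals exact congrArg D.len h'

variable {D} in
theorem Tw_eq_left {w : D.W} {l : List D.Node} {u : D.Ω} (hl : l.length = D.len w)
    (h : w = D.ΩW u * D.word l) : D.Tw w = D.TΩ u * (l.map D.T).prod := by
  rw [TΩ_mul_prod]
  rw [ΩW_mul_word] at h
  exact Tw_eq (by rw [List.length_map, hl]) h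

theorem Tw_ΩW (u : D.Ω) : D.Tw (D.ΩW u) = D.TΩ u := by
  have e : D.ΩW u = D.word [] * D.ΩW u := (one_mul _).symm
  have h := D.len_le [] u
  rw [← e] at h
  rw [Tw_eq (l := []) (Nat.le_zero.mp h).symm e, List.map_nil, List.prod_nil, one_mul]

theorem TΩ_mul_Tw (u : D.Ω) (w : D.W) : D.TΩ u * D.Tw w = D.Tw (D.ΩW u * w) := by
  obtain ⟨v, l, hl, h⟩ := D.exists_reduced_left w
  rw [Tw_eq_left hl h, Tw_eq_left (hl.trans (D.len_ΩW_mul u w).symm)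
    (h ▸ (mul_assoc _ _ _).symm : D.ΩW u * w = D.ΩW (u * v) * D.word l), ← TΩ_mul, mul_assoc]

variable {D} in
theorem T_mul_Tw_of_pos {j : D.Node} {w : D.W} (hw : D.signSystem.pos w⁻¹ j) :
    D.T j * D.Tw w = D.Tw (D.sW j * w) := by
  obtain ⟨l, u, hl, h⟩ := D.exists_reduced w
  have h1 : D.len (D.sW j * w) = D.len w + 1 := D.signSystem.len_of_pos hw
  have h2 : D.sW j * w = D.word (j :: l) * D.ΩW u := by rw [word_cons, mul_assoc, ← h]
  rw [Tw_eq hl h, Tw_eq (by rw [List.length_cons, hl, h1]) h2, List.map_cons, List.prod_cons,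
    mul_assoc]

variable {D} in
theorem T_mul_Tw_of_not_pos {j : D.Node} {w : D.W} (hw : ¬ D.signSystem.pos w⁻¹ j) :
    D.T j * D.Tw w = D.q j • D.Tw w + D.Tw (D.sW j * w) := by
  have h := T_mul_Tw_of_pos ((D.signSystem.pos_inv_s_mul w j).mpr hw)
  rw [signSystem_s, show D.sW j * (D.sW j * w) = w from D.signSystem.s_mul_s_mul j w] at h
  rw [← h, ← mul_assoc, T_mul_T, add_mul, one_mul, smul_mul_assoc]

/-! ### The basis `X^λ T_w` -/

/-- The span of the elements `X^λ T_w`. -/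
def spanXT : Submodule D.𝕃 D.H :=
  Submodule.span D.𝕃 (Set.range fun p : D.P × D.W => D.X p.1 * D.Tw p.2)

theorem X_mul_Tw_mem (x : D.P) (w : D.W) : D.X x * D.Tw w ∈ D.spanXT :=
  Submodule.subset_span ⟨(x, w), rfl⟩

variable {D} in
theorem mul_mem_spanXT {a : D.H} (h : ∀ x w, a * (D.X x * D.Tw w) ∈ D.spanXT) {b : D.H}
    (hb : b ∈ D.spanXT) : a * b ∈ D.spanXT := by
  induction hb using Submodule.span_induction with
  | mem b hb => obtain ⟨p, rfl⟩ := hb; exact h p.1 p.2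
  | zero => rw [mul_zero]; exact zero_mem _
  | add b c _ _ hb hc => rw [mul_add]; exact add_mem hb hc
  | smul r b _ hb => rw [mul_smul_comm]; exact Submodule.smul_mem _ r hb

theorem X_mul_mem_spanXT (y : D.P) {b : D.H} (hb : b ∈ D.spanXT) : D.X y * b ∈ D.spanXT := by
  refine mul_mem_spanXT (fun x w => ?_) hb
  rw [← mul_assoc, X_mul]
  exact D.X_mul_Tw_mem _ _

/-- The span contains `1` and is stable under left multiplication by the generators: `T_j` and `T_u`
pass to the right of `X^λ`, and `T_j T_w` is a combination of `T_w` and `T_{s_j w}`. -/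
theorem spanXT_eq_top : D.spanXT = ⊤ := by
  have key : ∀ a : D.H, ∀ b ∈ D.spanXT, a * b ∈ D.spanXT := by
    intro a
    induction a using H_induction with
    | algebraMap r =>
      intro b hb
      rw [← Algebra.smul_def]
      exact Submodule.smul_mem _ r hb
    | T j =>
      intro b hb
      refine mul_mem_spanXT (fun x w => ?_) hb
      have hT : D.T j * D.Tw w ∈ Submodule.span D.𝕃 (Set.range D.Tw) := by
        by_cases hw : D.signSystem.pos w⁻¹ j
        · rw [T_mul_Tw_of_pos hw]
          exact Submodule.subset_span ⟨_, rfl⟩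
        · rw [T_mul_Tw_of_not_pos hw]
          exact add_mem (Submodule.smul_mem _ _ (Submodule.subset_span ⟨_, rfl⟩))
            (Submodule.subset_span ⟨_, rfl⟩)
      have hle : Submodule.span D.𝕃 (Set.range D.Tw) ≤ D.spanXT := by
        refine Submodule.span_le.mpr ?_
        rintro _ ⟨v, rfl⟩
        have := D.X_mul_Tw_mem 0 v
        rwa [X_zero, one_mul] at this
      rw [← mul_assoc, T_mul_X, add_mul, mul_assoc, smul_mul_assoc, dem, sub_mul, Finset.sum_mul,
        Finset.sum_mul]
      exact add_mem (D.X_mul_mem_spanXT _ (hle hT)) (Submodule.smul_mem _ _ (sub_mem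
        (sum_mem fun i _ => D.X_mul_Tw_mem _ _) (sum_mem fun i _ => D.X_mul_Tw_mem _ _)))
    | U u =>
      intro b hb
      refine mul_mem_spanXT (fun x w => ?_) hb
      rw [← mul_assoc, TΩ_mul_X, mul_assoc, TΩ_mul_Tw]
      exact D.X_mul_Tw_mem _ _
    | X x => exact fun b hb => D.X_mul_mem_spanXT x hb
    | add a b ha hb => exact fun c hc => by rw [add_mul]; exact add_mem (ha c hc) (hb c hc)
    | mul a b ha hb => exact fun c hc => by rw [mul_assoc]; exact ha _ (hb c hc)
  refine eq_top_iff.mpr fun a _ => ?_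
  have h1 : (1 : D.H) ∈ D.spanXT := by
    have := D.X_mul_Tw_mem 0 (D.ΩW 1)
    rwa [Tw_ΩW, TΩ_one, X_zero, one_mul] at this
  simpa using key a 1 h1

theorem rep_Tw (w : D.W) : D.rep (D.Tw w) (Finsupp.single 0 (D.regBasis 1)) =
    Finsupp.single 0 (D.regBasis w) := by
  induction w using W_induction with
  | Ω u =>
    rw [Tw_ΩW, rep_TΩ, opU_single, leftMul_regBasis, map_zero, mul_one]
  | mul j w hw ih =>
    rw [← T_mul_Tw_of_pos hw, map_mul, Module.End.mul_apply, ih, rep_T, opT,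
      DemazureLusztig.dl_single_zero, regT_of_pos hw]

theorem rep_X_mul_Tw (x : D.P) (w : D.W) :
    D.rep (D.X x * D.Tw w) (Finsupp.single 0 (D.regBasis 1)) =
      Finsupp.single (x, 0) (D.regBasis w) := by
  rw [map_mul, Module.End.mul_apply, rep_Tw, rep_X, DemazureLusztig.shift_single, add_zero]

theorem linearIndependent_regBasis : LinearIndependent D.𝕃 D.regBasis :=
  Finsupp.linearIndependent_single_one D.𝕃 D.W

/-- Applied to `X^0 ⊗ e_1`, the operators of these elements give the vectors `X^{(λ, 0)} ⊗ e_w`,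
which are distinct members of a basis. -/
theorem linearIndependent_X_mul_Tw :
    LinearIndependent D.𝕃 fun p : D.P × D.W => D.X p.1 * D.Tw p.2 := by
  have h1 := Finsupp.linearIndependent_single (ι := D.Lat) (fun _ => D.regBasis)
    fun _ => D.linearIndependent_regBasis
  have hinj : Function.Injective fun p : D.P × D.W =>
      (⟨((p.1, 0) : D.Lat), p.2⟩ : Σ _ : D.Lat, D.W) := by
    rintro ⟨x, w⟩ ⟨y, v⟩ h
    simpa using h
  refine LinearIndependent.of_comp
    ((LinearMap.applyₗ (Finsupp.single 0 (D.regBasis 1))) ∘ₗ D.rep.toLinearMap) ?_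
  convert h1.comp _ hinj using 1
  funext p
  exact D.rep_X_mul_Tw p.1 p.2

/-- The basis `X^λ T_w` of `ℋ`. -/
def basisXT : Module.Basis (D.P × D.W) D.𝕃 D.H :=
  Module.Basis.mk D.linearIndependent_X_mul_Tw D.spanXT_eq_top.ge

theorem basisXT_apply (x : D.P) (w : D.W) : D.basisXT (x, w) = D.X x * D.Tw w :=
  Module.Basis.mk_apply _ _ _

/-! ### The anti-involution -/

open MulOpposite

theorem altProd_op {J A : Type*} [Monoid A] (f : J → A) (j k : J) (m : ℕ) :
    altProd (op (f j)) (op (f k)) m =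
      op (altProd (f (altNext k j m)) (f (altNext j k m)) m) := by
  induction m generalizing j k with
  | zero => rfl
  | succ m ih =>
    have h : altNext (altNext j k m) (altNext k j m) m = j := by
      rcases Nat.even_or_odd m with hm | hm
      · rw [altNext_even hm, altNext_even hm]
      · rw [altNext_odd hm, altNext_odd hm]
    rw [altProd, ih, ← op_mul, altNext, altNext, altProd_succ_right, h]

/-- The images of the generators under the anti-involution. -/
def antiGen : D.Gen → D.Hᵐᵒᵖ
  | .T j => op (D.T j)
  | .U u => op (D.TΩ u⁻¹)
  | .X x => op (D.X x)

theorem lift_antiGen_fT (j : D.Node) : FreeAlgebra.lift D.𝕃 D.antiGen (D.fT j) = op (D.T j) :=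
  FreeAlgebra.lift_ι_apply _ _

theorem lift_antiGen_fU (u : D.Ω) : FreeAlgebra.lift D.𝕃 D.antiGen (D.fU u) = op (D.TΩ u⁻¹) :=
  FreeAlgebra.lift_ι_apply _ _

theorem lift_antiGen_fX (x : D.P) : FreeAlgebra.lift D.𝕃 D.antiGen (D.fX x) = op (D.X x) :=
  FreeAlgebra.lift_ι_apply _ _

theorem gradAct_inv_gradAct (u : D.Ω) (x : D.P) :
    D.gradAct (D.ΩW u⁻¹) (D.gradAct (D.ΩW u) x) = x :=
  Subtype.ext ((u : V ≃ᵃ[ℝ] V).linear.symm_apply_apply x)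

theorem lift_antiGen_rel {a b : D.Free} (h : D.Rel a b) :
    FreeAlgebra.lift D.𝕃 D.antiGen a = FreeAlgebra.lift D.𝕃 D.antiGen b := by
  cases h with
  | U_one => rw [lift_antiGen_fU, map_one, inv_one, TΩ_one, op_one]
  | U_mul u u' =>
    rw [map_mul, lift_antiGen_fU, lift_antiGen_fU, lift_antiGen_fU, ← op_mul, TΩ_mul, mul_inv_rev]
  | U_T u j k h =>
    rw [map_mul, map_mul, lift_antiGen_fU, lift_antiGen_fT, lift_antiGen_fT, ← op_mul, ← op_mul,
      TΩ_mul_T, eq_nodeAct h, nodeAct_inv_nodeAct]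
  | quadratic j =>
    have h1 : D.τ j • D.T j = D.q j • D.T j + D.τinv j • D.T j := by
      rw [← add_smul, q, sub_add_cancel]
    rw [map_mul, map_sub, map_add, AlgHom.commutes, AlgHom.commutes, lift_antiGen_fT, map_zero]
    refine unop_injective ?_
    change (D.T j + algebraMap _ _ _) * (D.T j - algebraMap _ _ _) = 0
    rw [Algebra.algebraMap_eq_smul_one, Algebra.algebraMap_eq_smul_one, mul_sub, add_mul,
      add_mul, T_mul_T, mul_smul_comm, mul_smul_comm, mul_one, smul_mul_assoc, one_mul, mul_one,
      smul_smul, τ_mul_τinv, one_smul, h1]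
    abel
  | braid j k h =>
    rw [map_altProd, map_altProd, lift_antiGen_fT, lift_antiGen_fT, altProd_op, altProd_op]
    rcases Nat.even_or_odd (orderOf (D.s j * D.s k)) with hm | hm
    · rw [altNext_even hm, altNext_even hm, D.T_braid h]
    · rw [altNext_odd hm, altNext_odd hm, D.T_braid h]
  | U_X u x =>
    rw [map_mul, map_mul, lift_antiGen_fU, lift_antiGen_fX, lift_antiGen_fX, ← op_mul, ← op_mul,
      TΩ_mul_X]
    exact congrArg (fun y => op (D.X y * D.TΩ u⁻¹)) (D.gradAct_inv_gradAct u x).symm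
  -- Reversed, the relation at `λ` is the original relation at `s_j' λ`, because the quotient
  -- changes sign under `s_j'`.
  | T_X j x =>
    have e : FreeAlgebra.lift D.𝕃 D.antiGen (D.fElem (D.demazure j x)) = op (D.dem j x) := by
      rw [fElem_demazure, map_sub, map_sum, map_sum, dem, op_sub, Finset.op_sum, Finset.op_sum]
      simp only [lift_antiGen_fX]
    rw [map_mul, map_add, map_mul, map_smul, e, lift_antiGen_fT, lift_antiGen_fX, lift_antiGen_fX,
      ← op_mul, ← op_mul, ← op_smul, ← op_add, T_mul_X, reflP_reflP, dem_reflP, smul_neg, q,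
      neg_add_cancel_right]
  | X_zero => rw [lift_antiGen_fX, map_one, X_zero, op_one]
  | X_add x y =>
    rw [map_mul, lift_antiGen_fX, lift_antiGen_fX, lift_antiGen_fX, ← op_mul, X_mul, add_comm]

/-- The anti-involution of `ℋ` as a homomorphism to the opposite algebra. -/
def antiHom : D.H →ₐ[D.𝕃] D.Hᵐᵒᵖ :=
  RingQuot.liftAlgHom D.𝕃 ⟨FreeAlgebra.lift D.𝕃 D.antiGen, fun _ _ => D.lift_antiGen_rel⟩

theorem antiHom_toH (a : D.Free) : D.antiHom (D.toH a) = FreeAlgebra.lift D.𝕃 D.antiGen a :=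
  RingQuot.liftAlgHom_mkAlgHom_apply _ _ _ _

/-- The anti-involution of `ℋ` that fixes `T_j` and `X^λ` and maps `T_u` to `T_u⁻¹`. -/
def anti : D.H →ₗ[D.𝕃] D.H := (opLinearEquiv D.𝕃).symm.toLinearMap ∘ₗ D.antiHom.toLinearMap

theorem anti_T (j : D.Node) : D.anti (D.T j) = D.T j :=
  congrArg unop ((D.antiHom_toH _).trans (D.lift_antiGen_fT j))

theorem anti_TΩ (u : D.Ω) : D.anti (D.TΩ u) = D.TΩ u⁻¹ :=
  congrArg unop ((D.antiHom_toH _).trans (D.lift_antiGen_fU u))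

theorem anti_X (x : D.P) : D.anti (D.X x) = D.X x :=
  congrArg unop ((D.antiHom_toH _).trans (D.lift_antiGen_fX x))

theorem anti_mul (a b : D.H) : D.anti (a * b) = D.anti b * D.anti a :=
  congrArg unop (map_mul D.antiHom a b)

theorem anti_algebraMap (r : D.𝕃) : D.anti (algebraMap D.𝕃 D.H r) = algebraMap D.𝕃 D.H r :=
  congrArg unop (D.antiHom.commutes r)

theorem anti_anti (a : D.H) : D.anti (D.anti a) = a := by
  induction a using H_induction with
  | algebraMap r => rw [anti_algebraMap, anti_algebraMap]
  | T j => rw [anti_T, anti_T]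
  | U u => rw [anti_TΩ, anti_TΩ, inv_inv]
  | X x => rw [anti_X, anti_X]
  | add a b ha hb => rw [map_add, map_add, ha, hb]
  | mul a b ha hb => rw [anti_mul, anti_mul, ha, hb]

theorem anti_prod (l : List D.Node) : D.anti (l.map D.T).prod = (l.reverse.map D.T).prod := by
  induction l with
  | nil =>
    have := D.anti_algebraMap 1
    rwa [map_one] at this
  | cons j l ih => simp [anti_mul, ih, anti_T]

/-- Reversing a reduced decomposition of `w` and inverting its `Ω`-part gives one of `w⁻¹`, of the
same length. -/
theorem anti_Tw (w : D.W) : D.anti (D.Tw w) = D.Tw w⁻¹ := by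
  obtain ⟨l, u, hl, e⟩ := D.exists_reduced w
  have e' : w⁻¹ = D.ΩW u⁻¹ * D.word l.reverse := by
    rw [← word_inv, e, mul_inv_rev]
    rfl
  rw [Tw_eq hl e, anti_mul, anti_TΩ, anti_prod,
    Tw_eq_left (by rw [List.length_reverse, hl, len_inv]) e']

/-- The basis `T_w X^λ` of `ℋ`. -/
def basisTX : Module.Basis (D.P × D.W) D.𝕃 D.H :=
  (D.basisXT.map (LinearEquiv.ofInvolutive D.anti D.anti_anti)).reindex
    ((Equiv.refl D.P).prodCongr (Equiv.inv D.W))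

theorem basisTX_apply (x : D.P) (w : D.W) : D.basisTX (x, w) = D.Tw w * D.X x := by
  rw [basisTX, Module.Basis.reindex_apply, Module.Basis.map_apply]
  change D.anti (D.basisXT (x, w⁻¹)) = _
  rw [basisXT_apply, anti_mul, anti_X, anti_Tw, inv_inv]

end Basis

end AffineRootDatum

theorem mainTheorem2 {ι V : Type*} [NormedAddCommGroup V] [InnerProductSpace ℝ V]
    (D : AffineRootDatum ι V) :
    (∀ w : D.W, ∃ u l, D.IsReducedDecomposition w u l) ∧
    ∃ Tw : D.W → D.H,
      (∀ w u l, D.IsReducedDecomposition w u l → Tw w = D.TΩ u * (l.map D.T).prod) ∧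
      (∃ B : Module.Basis (D.P × D.W) D.𝕃 D.H, ∀ x w, B (x, w) = D.X x * Tw w) ∧
      (∃ B : Module.Basis (D.P × D.W) D.𝕃 D.H, ∀ x w, B (x, w) = Tw w * D.X x) := by
  refine ⟨fun w => ?_, D.Tw, fun w u l h => ?_, ⟨D.basisXT, D.basisXT_apply⟩,
    ⟨D.basisTX, D.basisTX_apply⟩⟩
  · obtain ⟨u, l, hl, h⟩ := D.exists_reduced_left w
    exact ⟨u, l, AffineRootDatum.isReducedDecomposition_iff.mpr ⟨h, hl⟩⟩
  · obtain ⟨h, hl⟩ := AffineRootDatum.isReducedDecomposition_iff.mp h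
    exact AffineRootDatum.Tw_eq_left hl h

end
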